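/- Let $d\ge 5$ be an integer. For real $\lambda\ge 0$ such that $\lambda^2$ is a non-negative integer, let $N_\lambda=|\{m\in\mathbb Z^d: |m|=\lambda\}|$, where $|\cdot|$ is the Euclidean norm, and for $f:\mathbb Z^d\to\mathbb R$ and $n\in\mathbb Z^d$ put $$A_\lambda f(n)=N_\lambda^{-1}\sum_{m\in\mathbb Z^d,\ |m|=\lambda} f(n-m),\qquad A_*f(n)=\sup_{\lambda\ge 0,\ \lambda^2\in\mathbb Z}|A_\lambda f(n)|\in[0,\infty].$$ Then there is a constant $C_d<\infty$, depending only on $d$, such that for every $f:\mathbb Z^d\to\mathbb R$ $$\|A_*f\|_2\le C_d\,\|f\|_2,$$ where $\|g\|_2=\bigl(\sum_{n\in\mathbb Z^d}|g(n)|^2\bigr)^{1/2}\in[0,\infty]$ is the $\ell^2(\mathbb Z^d)$ norm. In particular $A_*$ is bounded on $\ell^2(\mathbb Z^d)$. -/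

import Mathlib

open MeasureTheory
open scoped NNReal ENNReal

noncomputable section

/-- The discrete sphere `{m ∈ ℤ^d : |m| = lam}`, where `|·|` is the Euclidean length. -/
def discreteSphere (d : ℕ) (lam : ℝ) : Set (Fin d → ℤ) :=
  {m | √(∑ i, (m i : ℝ) ^ 2) = lam}

theorem discreteSphere_finite (d : ℕ) (lam : ℝ) : (discreteSphere d lam).Finite := by
  refine (Set.finite_Icc (fun _ : Fin d => -⌈lam⌉) (fun _ => ⌈lam⌉)).subset ?_
  intro m hm
  have key : ∀ i, |(m i : ℝ)| ≤ lam := fun i => by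
    rw [← show √(∑ i, (m i : ℝ) ^ 2) = lam from hm]
    exact Real.abs_le_sqrt
      (Finset.single_le_sum (f := fun i => (m i : ℝ) ^ 2) (fun j _ => sq_nonneg _)
        (Finset.mem_univ i))
  refine ⟨fun i => ?_, fun i => ?_⟩
  · have h := (abs_le.1 (key i)).1
    have h2 := Int.le_ceil lam
    have : ((-⌈lam⌉ : ℤ) : ℝ) ≤ m i := by push_cast; linarith
    exact_mod_cast this
  · have h := (abs_le.1 (key i)).2.trans (Int.le_ceil lam)
    exact_mod_cast h

/-- The points of the discrete sphere as a finite set. -/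
def discreteSphereFinset (d : ℕ) (lam : ℝ) : Finset (Fin d → ℤ) :=
  (discreteSphere_finite d lam).toFinset

/-- The discrete spherical average
`A_lam f (n) = N_lam⁻¹ ∑_{|m| = lam} f (n - m)`, `N_lam` being the number of lattice points `m`
with `|m| = lam`. -/
def sphericalAverage {d : ℕ} (lam : ℝ) (f : (Fin d → ℤ) → ℝ) (n : Fin d → ℤ) : ℝ :=
  ((discreteSphereFinset d lam).card : ℝ)⁻¹ * ∑ m ∈ discreteSphereFinset d lam, f (n - m)

/-- The admissible radii: `lam ≥ 0` such that `lam ^ 2` is a natural number. -/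
def admissibleRadii : Set ℝ :=
  {lam | 0 ≤ lam ∧ ∃ k : ℕ, lam ^ 2 = k}

/-- The discrete spherical maximal function `A_* f (n) = sup_lam |A_lam f (n)|`, with values in
`[0, ∞]`, so that the supremum always exists. -/
def sphericalMaximal {d : ℕ} (f : (Fin d → ℤ) → ℝ) (n : Fin d → ℤ) : ℝ≥0∞ :=
  ⨆ lam ∈ admissibleRadii, ENNReal.ofReal |sphericalAverage lam f n|

end

noncomputable section

open Complex (I)

/-! The proof is the circle method, arranged so that the supremum over all radii becomes one over
powers of 4. Let `S = 4 ^ j` and `n < 4 * S`. By orthogonality of characters, the sum of `f` over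
the sphere of radius `√n`, times `S ^ (-d/2) * exp (-2πn/S)`, is the integral over `t ∈ [0,1]` of
`e(-nt)` times the convolution of `f` with the theta kernel `S ^ (-d/2) * e((t + i/S)|m|²)`.
Absolute values inside the integral eliminate `n`, so only `j` is left. Dirichlet's theorem places
each `t` at `r + u/S` with `r` rational of denominator `q` and `q² max(1, u²) ≤ S`. For fixed `r`
and `u` one takes the supremum over `j`, and then sums over `r` and integrates over `u`
(`enorm_sum_sphere_le`, `circleMaximal`).

For one pair `(r, u)`, Poisson summation (`thetaMultiplier_eq`) shows that the multiplier is close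
to a factor independent of `j`, of size about `(q √(1+u²)) ^ (-d/2)`, times the multiplier of a
positive Gaussian kernel on `q ℤ^d`. The positive part has an `ℓ²` maximal inequality uniform in
`q`, proved by a `T T*` argument. The errors are square-summable in `j`, so Plancherel controls
their supremum by a square function. The resulting operator bound is a constant times `(q √(1+u²)) ^
(-d/2) * √(1+u²)` (`tsum_iSup_thetaKernelPi_sq_le`). There are `O(q)` fractions of denominator `q`,
so for `d ≥ 5` these bounds have a finite sum over `r` and integral over `u`
(`tsum_circleMaximal_sq_le`).

To pass from sums to averages one needs `N ≥ c n ^ (d/2 - 1)` for the number `N` of lattice points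
on a nonempty sphere with `n > 0`. For large `n` the circle method is used again, with major arcs
around `b/Q`, `Q = M!`. The main term is a local density modulo `Q`, at least `1/16` by Gauss sum
bounds, times a positive singular integral. The minor arcs are bounded by a tail of the same
convergent sum over arcs (`card_discreteSphereFinset_lower_bound`). Finally, monotone convergence
extends the inequality from finitely supported functions to all functions. -/

/-! ### Quadratic Gauss sums. -/

/-- The quadratic Gauss sum `∑ x mod q, e((a x² + n x) / q)`. -/
def quadGaussSum (q : ℕ) [NeZero q] (a n : ZMod q) : ℂ :=
  ∑ x : ZMod q, ZMod.stdAddChar (a * x ^ 2 + n * x)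

/-- Solutions have representatives divisible by `q / gcd c q`, and dividing by that number injects
them into `range (gcd c q)`. -/
theorem ZMod.card_mul_eq_zero_le (q : ℕ) [NeZero q] (c : ℕ) :
    (Finset.univ.filter fun h : ZMod q => (c : ZMod q) * h = 0).card ≤ c.gcd q := by
  have hq : 0 < q := Nat.pos_of_ne_zero (NeZero.ne q)
  have hg : 0 < c.gcd q := Nat.gcd_pos_of_pos_right c hq
  have hdiv : c.gcd q * (q / c.gcd q) = q := Nat.mul_div_cancel' (Nat.gcd_dvd_right c q)
  have hqg : 0 < q / c.gcd q := Nat.div_pos (Nat.le_of_dvd hq (Nat.gcd_dvd_right c q)) hg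
  have key : ∀ h : ZMod q, (c : ZMod q) * h = 0 → q / c.gcd q ∣ h.val := by
    intro h hh
    have h1 : ((c * h.val : ℕ) : ZMod q) = 0 := by
      rw [Nat.cast_mul, ZMod.natCast_zmod_val, hh]
    have h2 : q ∣ c * h.val := (ZMod.natCast_eq_zero_iff _ _).1 h1
    have h3 : q / c.gcd q ∣ (c / c.gcd q) * h.val := by
      refine Nat.dvd_of_mul_dvd_mul_left hg ?_
      rw [hdiv, ← mul_assoc, Nat.mul_div_cancel' (Nat.gcd_dvd_left c q)]
      exact h2
    exact (Nat.coprime_div_gcd_div_gcd hg).symm.dvd_of_dvd_mul_left h3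
  calc _ ≤ (Finset.range (c.gcd q)).card := by
        refine Finset.card_le_card_of_injOn (fun h => h.val / (q / c.gcd q)) ?_ ?_
        · intro h _
          simp only [Finset.coe_range, Set.mem_Iio]
          rw [Nat.div_lt_iff_lt_mul hqg, hdiv]
          exact ZMod.val_lt h
        · intro x hx y hy hxy
          simp only [Finset.coe_filter, Finset.mem_univ, true_and, Set.mem_ofPred_eq] at hx hy
          apply ZMod.val_injective q
          rw [← Nat.div_mul_cancel (key x hx), ← Nat.div_mul_cancel (key y hy)]
          simp only at hxy
          rw [hxy]
    _ = _ := Finset.card_range _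

/-- Weyl differencing: in `G * conj G`, put `x = h + y`. The quadratic terms in `y` cancel and the
sum over `y` is a complete linear character sum, which vanishes unless `2 a h = 0`. Each surviving
`h` contributes at most `q`. -/
theorem norm_quadGaussSum_sq_le (q : ℕ) [NeZero q] (a : ℕ) (n : ZMod q) :
    ‖quadGaussSum q a n‖ ^ 2 ≤ q * ((2 * a).gcd q : ℕ) := by
  have hconj : ∀ x : ZMod q, (starRingEnd ℂ) (ZMod.stdAddChar x) = ZMod.stdAddChar (-x) := by
    intro x
    rw [ZMod.stdAddChar_apply, ZMod.stdAddChar_apply, ← Circle.coe_inv_eq_conj,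
      AddChar.map_neg_eq_inv]
  have h1 : ((‖quadGaussSum q a n‖ ^ 2 : ℝ) : ℂ) =
      ∑ h : ZMod q, ZMod.stdAddChar ((a : ZMod q) * h ^ 2 + n * h) *
        (if ((2 * a : ℕ) : ZMod q) * h = 0 then (q : ℂ) else 0) := by
    have : ((‖quadGaussSum q a n‖ ^ 2 : ℝ) : ℂ) =
        quadGaussSum q a n * (starRingEnd ℂ) (quadGaussSum q a n) := by
      rw [Complex.mul_conj, Complex.normSq_eq_norm_sq]
    rw [this, quadGaussSum, map_sum, Finset.sum_mul_sum, Finset.sum_comm]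
    have : ∀ y : ZMod q, ∑ x : ZMod q, (ZMod.stdAddChar ((a : ZMod q) * x ^ 2 + n * x) : ℂ) *
        (starRingEnd ℂ) (ZMod.stdAddChar ((a : ZMod q) * y ^ 2 + n * y)) =
        ∑ h : ZMod q, ZMod.stdAddChar ((a : ZMod q) * h ^ 2 + n * h) *
          ZMod.stdAddChar (y * (((2 * a : ℕ) : ZMod q) * h)) := by
      intro y
      rw [← Equiv.sum_comp (Equiv.addRight y)]
      refine Finset.sum_congr rfl fun h _ => ?_
      rw [hconj, ← AddChar.map_add_eq_mul, ← AddChar.map_add_eq_mul]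
      congr 1
      simp only [Equiv.coe_addRight]
      push_cast
      ring
    simp_rw [this]
    rw [Finset.sum_comm]
    refine Finset.sum_congr rfl fun h _ => ?_
    rw [← Finset.mul_sum, AddChar.sum_mulShift _ (ZMod.isPrimitive_stdAddChar q), ZMod.card]
    split_ifs <;> simp
  have h2 : ‖((‖quadGaussSum q a n‖ ^ 2 : ℝ) : ℂ)‖ = ‖quadGaussSum q a n‖ ^ 2 := by
    rw [Complex.norm_real, Real.norm_of_nonneg (by positivity)]
  rw [← h2, h1]
  calc _ ≤ ∑ h : ZMod q, (if ((2 * a : ℕ) : ZMod q) * h = 0 then (q : ℝ) else 0) := by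
        refine (norm_sum_le _ _).trans (Finset.sum_le_sum fun h _ => ?_)
        rw [norm_mul, ZMod.stdAddChar_apply, Circle.norm_coe, one_mul]
        split_ifs <;> simp
    _ = q * (Finset.univ.filter fun h : ZMod q => ((2 * a : ℕ) : ZMod q) * h = 0).card := by
        rw [← Finset.sum_filter, Finset.sum_const, nsmul_eq_mul, mul_comm]
    _ ≤ _ := by
        gcongr
        exact ZMod.card_mul_eq_zero_le q (2 * a)

theorem norm_quadGaussSum_le_sqrt (q : ℕ) [NeZero q] (a : ℤ) (ha : IsCoprime a (q : ℤ))
    (n : ZMod q) : ‖quadGaussSum q a n‖ ≤ √(2 * q) := by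
  have h0 : ((a : ZMod q)) = (((a : ZMod q).val : ℕ) : ZMod q) := by
    rw [ZMod.natCast_zmod_val]
  have hc : Nat.Coprime (a : ZMod q).val q := by
    rw [← ZMod.isUnit_iff_coprime, ZMod.natCast_zmod_val]
    exact (ZMod.coe_int_isUnit_iff_isCoprime a q).2 ha.symm
  apply Real.le_sqrt_of_sq_le
  rw [h0]
  refine (norm_quadGaussSum_sq_le q _ n).trans ?_
  rw [mul_comm]
  gcongr
  rw [Nat.Coprime.gcd_mul_right_cancel _ hc]
  exact_mod_cast Nat.gcd_le_left q two_pos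

theorem norm_quadGaussSum_le (q : ℕ) [NeZero q] (a n : ZMod q) : ‖quadGaussSum q a n‖ ≤ q := by
  refine (norm_sum_le _ _).trans ?_
  simp only [ZMod.stdAddChar_apply, Circle.norm_coe]
  simp [ZMod.card]

/-! ### One-dimensional theta kernels and Poisson summation. -/

/-- The one-dimensional kernel `S^{-1/2} e((t + i / S) m²)`. -/
def thetaKernel (S t : ℝ) (m : ℤ) : ℂ :=
  ((√S)⁻¹ : ℝ) * Complex.exp (2 * Real.pi * I * m ^ 2 * (t + I / S))

/-- The Fourier multiplier of `thetaKernel`. -/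
def thetaMultiplier (S t x : ℝ) : ℂ :=
  ∑' m : ℤ, thetaKernel S t m * Complex.exp (2 * Real.pi * I * m * x)

/-- The factor `(2 (1 - i u))^{-1/2}`. -/
def thetaFactor (u : ℝ) : ℂ := ((2 * (1 - u * I)) ^ (1 / 2 : ℂ))⁻¹

theorem Int.tsum_eq_sum_zmod {F : ℤ → ℂ} (hF : Summable F) (q : ℕ) [NeZero q] :
    ∑' m, F m = ∑ x : ZMod q, ∑' k : ℤ, F (q * k + x.val) := by
  have h1 : Summable fun p : ℤ × Fin q => F ((Int.divModEquiv q).symm p) :=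
    (Equiv.summable_iff (Int.divModEquiv q).symm).2 hF
  rw [← (Int.divModEquiv q).symm.tsum_eq F]
  have h2 : Summable fun p : Fin q × ℤ => F ((Int.divModEquiv q).symm (p.2, p.1)) :=
    (Equiv.summable_iff (Equiv.prodComm (Fin q) ℤ)).2 h1
  rw [← (Equiv.prodComm (Fin q) ℤ).tsum_eq]
  change ∑' p : Fin q × ℤ, F ((Int.divModEquiv q).symm (p.2, p.1)) = _
  rw [h2.tsum_prod, tsum_fintype]
  have : ∀ x : ZMod q, (((ZMod.finEquiv q).symm x : Fin q) : ℕ) = x.val := by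
    obtain ⟨n, rfl⟩ := Nat.exists_eq_succ_of_ne_zero (NeZero.ne q)
    intro x
    rfl
  refine Fintype.sum_equiv (ZMod.finEquiv q).toEquiv _ _ fun r => tsum_congr fun k => ?_
  congr 1
  have hr := this (ZMod.finEquiv q r)
  rw [RingEquiv.symm_apply_apply] at hr
  simp only [Int.divModEquiv_symm_apply, RingEquiv.toEquiv_eq_coe, EquivLike.coe_coe]
  rw [← hr]
  ring

theorem norm_thetaKernel (S t : ℝ) (m : ℤ) :
    ‖thetaKernel S t m‖ = (√S)⁻¹ * Real.exp (-(2 * Real.pi * m ^ 2 / S)) := by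
  rw [thetaKernel, norm_mul, Complex.norm_real, Real.norm_of_nonneg (by positivity),
    Complex.norm_exp]
  congr 2
  have : (2 * Real.pi * I * (m : ℂ) ^ 2 * (t + I / S)) =
      ((-(2 * Real.pi * m ^ 2 / S) : ℝ) : ℂ) + ((2 * Real.pi * m ^ 2 * t : ℝ) : ℂ) * I := by
    push_cast
    linear_combination (2 * Real.pi * (m : ℂ) ^ 2 / S) * Complex.I_sq
  rw [this, Complex.add_re, Complex.ofReal_re, Complex.re_ofReal_mul, Complex.I_re]
  ring

/-- The sum of the inverse squares of the nonzero integers. -/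
def intInvSqSum : ℝ := ∑' n : ℤ, 1 / (n : ℝ) ^ 2

theorem intInvSqSum_nonneg : 0 ≤ intInvSqSum := tsum_nonneg fun n => by positivity

theorem half_abs_sub_round_le (n : ℤ) (y : ℝ) (hn : n ≠ round y) :
    |((n - round y : ℤ) : ℝ)| / 2 ≤ |n - y| := by
  have h1 : (1 : ℝ) ≤ |((n - round y : ℤ) : ℝ)| := by
    exact_mod_cast Int.one_le_abs (sub_ne_zero.2 hn)
  have h2 := abs_sub_round y
  have h3 : |((n - round y : ℤ) : ℝ)| ≤ |n - y| + |y - round y| := by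
    push_cast
    exact abs_sub_le _ _ _
  linarith

theorem norm_exp_neg_mul_ofReal_sq (w : ℂ) (z : ℝ) :
    ‖Complex.exp (-w * (z : ℂ) ^ 2)‖ = Real.exp (-(w.re * z ^ 2)) := by
  rw [Complex.norm_exp]
  congr 1
  rw [← Complex.ofReal_pow, mul_comm, Complex.re_ofReal_mul, Complex.neg_re]
  ring

/-- For `n` other than the integer nearest to `y`, `|n - y|` is at least half of `|n - round y|`.
The bound `exp (-x) ≤ 1/x` then replaces Gaussian decay by quadratic decay, which suffices and gives
explicit constants. -/
theorem norm_gaussian_le {w : ℂ} (hw : 0 < w.re) {y : ℝ} {n : ℤ} (hn : n ≠ round y) :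
    ‖Complex.exp (-w * (n - y) ^ 2)‖ ≤ 4 / w.re * (1 / ((n - round y : ℤ) : ℝ) ^ 2) := by
  have h1 : (0 : ℝ) < |((n - round y : ℤ) : ℝ)| := by
    rw [abs_pos]
    exact_mod_cast sub_ne_zero.2 hn
  have h2 : ((n - round y : ℤ) : ℝ) ^ 2 / 4 ≤ (n - y) ^ 2 := by
    rw [← sq_abs, ← sq_abs ((n : ℝ) - y)]
    have := half_abs_sub_round_le n y hn
    nlinarith [abs_nonneg ((n : ℝ) - y)]
  have h3 : 0 < ((n - round y : ℤ) : ℝ) ^ 2 := by rw [← sq_abs]; positivity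
  generalize ((n - round y : ℤ) : ℝ) = k at h2 h3
  have h6 : ‖Complex.exp (-w * ((n : ℂ) - y) ^ 2)‖ = Real.exp (-(w.re * (n - y) ^ 2)) := by
    rw [← norm_exp_neg_mul_ofReal_sq, Complex.ofReal_sub, Complex.ofReal_intCast]
  rw [h6]
  generalize (n - y : ℝ) ^ 2 = z at h2
  have h4 : 0 < w.re * z := mul_pos hw (by linarith)
  have h5 : Real.exp (-(w.re * z)) ≤ 1 / (w.re * z) := by
    rw [Real.exp_neg, ← one_div]
    exact one_div_le_one_div_of_le h4 (by linarith [Real.add_one_le_exp (w.re * z)])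
  calc _ ≤ 1 / (w.re * (k ^ 2 / 4)) :=
        h5.trans (one_div_le_one_div_of_le (by positivity)
          (mul_le_mul_of_nonneg_left h2 hw.le))
    _ = _ := by field_simp

/-- A sum over the integers is close to its term of index `N`, if the other ones decay
quadratically. -/
theorem summable_of_quadratic_decay {F : ℤ → ℂ} {b : ℝ} (N : ℤ) (hb : 0 ≤ b)
    (hF : ∀ n, n ≠ N → ‖F n‖ ≤ b * (1 / ((n - N : ℤ) : ℝ) ^ 2)) :
    Summable F ∧ ‖∑' n, F n - F N‖ ≤ b * intInvSqSum := by
  have hs0 : Summable fun n : ℤ => 1 / (n : ℝ) ^ 2 :=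
    Real.summable_one_div_int_pow.2 one_lt_two
  have hs : HasSum (fun n : ℤ => b * (1 / ((n - N : ℤ) : ℝ) ^ 2)) (b * intInvSqSum) :=
    HasSum.mul_left _ ((Equiv.hasSum_iff (f := fun n : ℤ => 1 / (n : ℝ) ^ 2)
      (Equiv.subRight N)).2 hs0.hasSum)
  have hbound : ∀ n, ‖if n = N then 0 else F n‖ ≤
      b * (1 / ((n - N : ℤ) : ℝ) ^ 2) := by
    intro n
    split_ifs with h
    · rw [norm_zero]; positivity
    · exact hF n h
  have hsum' : Summable fun n => if n = N then 0 else F n :=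
    Summable.of_norm_bounded hs.summable hbound
  have hsum : Summable F := by
    refine (summable_congr_cofinite ?_).1 hsum'
    filter_upwards [(Set.finite_singleton N).compl_mem_cofinite] with n hn
    rw [if_neg (by simpa using hn)]
  refine ⟨hsum, ?_⟩
  rw [hsum.tsum_eq_add_tsum_ite N, add_sub_cancel_left]
  exact tsum_of_norm_bounded hs hbound

/-- A Gaussian sum over the integers with bounded coefficients is dominated by the term nearest to
the centre of the Gaussian. -/
theorem summable_gaussian_nearest {g : ℤ → ℂ} {b : ℝ} (hg : ∀ n, ‖g n‖ ≤ b) {w : ℂ} (hw : 0 < w.re)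
    (y : ℝ) :
    Summable (fun n : ℤ => g n * Complex.exp (-w * (n - y) ^ 2)) ∧
    ‖∑' n : ℤ, g n * Complex.exp (-w * (n - y) ^ 2) -
      g (round y) * Complex.exp (-w * (round y - y) ^ 2)‖ ≤ b * (4 / w.re) * intInvSqSum := by
  have hb : 0 ≤ b := (norm_nonneg _).trans (hg 0)
  refine summable_of_quadratic_decay (round y) (F := fun n : ℤ => g n * Complex.exp (-w * (n - y) ^ 2))
    (by positivity) fun n hn => ?_
  rw [norm_mul, mul_assoc]
  exact mul_le_mul (hg n) (norm_gaussian_le hw hn) (norm_nonneg _) hb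

theorem re_div_one_sub_mul_I (c u : ℝ) : ((c : ℂ) / (1 - u * I)).re = c / (1 + u ^ 2) := by
  rw [Complex.div_re]
  simp [Complex.normSq_apply]
  ring

theorem summable_exp_neg_mul_int_sq {c : ℝ} (hc : 0 < c) :
    Summable fun m : ℤ => Real.exp (-(c * m ^ 2)) := by
  have h := (summable_gaussian_nearest (g := fun _ => 1) (b := 1) (by simp) (w := c)
    (by simpa using hc) 0).1.norm
  refine h.congr fun m => ?_
  rw [one_mul, ← Complex.ofReal_intCast, ← Complex.ofReal_sub, norm_exp_neg_mul_ofReal_sq,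
    sub_zero, Complex.ofReal_re]

theorem summable_norm_thetaKernel {S : ℝ} (hS : 0 < S) (t : ℝ) :
    Summable fun m => ‖thetaKernel S t m‖ := by
  simp_rw [norm_thetaKernel]
  refine Summable.mul_left _ ?_
  refine (summable_exp_neg_mul_int_sq (c := 2 * Real.pi / S) (by positivity)).congr fun m => ?_
  congr 1
  ring

theorem norm_exp_two_pi_I_mul (m : ℤ) (x : ℝ) :
    ‖Complex.exp (2 * Real.pi * I * m * x)‖ = 1 := by
  have : (2 * Real.pi * I * m * x : ℂ) = ((2 * Real.pi * m * x : ℝ) : ℂ) * I := by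
    push_cast; ring
  rw [this, Complex.norm_exp_ofReal_mul_I]

theorem summable_thetaMultiplier {S : ℝ} (hS : 0 < S) (t x : ℝ) :
    Summable fun m : ℤ => thetaKernel S t m * Complex.exp (2 * Real.pi * I * m * x) := by
  refine Summable.of_norm ((summable_norm_thetaKernel hS t).congr fun m => ?_)
  rw [norm_mul, norm_exp_two_pi_I_mul, mul_one]

theorem norm_one_sub_mul_I (u : ℝ) : ‖(1 - u * I : ℂ)‖ = √(1 + u ^ 2) := by
  have := Complex.norm_add_mul_I 1 (-u)
  rw [one_pow, neg_sq] at this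
  rw [← this]
  congr 1
  push_cast
  ring

theorem norm_thetaFactor_sq (u : ℝ) : ‖thetaFactor u‖ ^ 2 = (2 * √(1 + u ^ 2))⁻¹ := by
  rw [thetaFactor, norm_inv, inv_pow, ← norm_pow, ← Complex.cpow_nat_mul]
  norm_num [norm_one_sub_mul_I]

theorem thetaFactor_pow (u : ℝ) (d : ℕ) :
    thetaFactor u ^ d = ((2 * (1 - u * I)) ^ (d / 2 : ℂ))⁻¹ := by
  rw [thetaFactor, inv_pow, ← Complex.cpow_nat_mul]
  congr 2
  ring

theorem one_sub_mul_I_ne_zero (u : ℝ) : (1 - u * I : ℂ) ≠ 0 := by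
  rw [← norm_ne_zero_iff, norm_one_sub_mul_I]
  positivity

/-- Poisson summation for the theta multiplier near the rational `a / q`. -/
theorem thetaMultiplier_eq {S : ℝ} (hS : 0 < S) (q : ℕ) [NeZero q] (a : ℤ) (u x : ℝ) :
    thetaMultiplier S (a / q + u / S) x = thetaFactor u / q *
      ∑' n : ℤ, quadGaussSum q a n *
        Complex.exp (-(Real.pi * S / (2 * q ^ 2) / (1 - u * I)) * (n - q * x) ^ 2) := by
  have hq : (0 : ℝ) < q := by exact_mod_cast Nat.pos_of_ne_zero (NeZero.ne q)
  have hqC : (q : ℂ) ≠ 0 := by exact_mod_cast hq.ne'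
  have hSC : (S : ℂ) ≠ 0 := by exact_mod_cast hS.ne'
  have hu := one_sub_mul_I_ne_zero u
  have hpi : (Real.pi : ℂ) ≠ 0 := by exact_mod_cast Real.pi_ne_zero
  -- Along `m = q k + r` the kernel is a Gaussian in `k` with parameter `A`, since `2πi m² (u + i)/S
  -- = -2π m² (1 - i u)/S`.
  set A : ℂ := ((q ^ 2 / S : ℝ) : ℂ) * (2 * (1 - u * I)) with hA
  have hAne : A ≠ 0 := by
    rw [hA]
    refine mul_ne_zero ?_ (mul_ne_zero two_ne_zero hu)
    exact_mod_cast (by positivity : q ^ 2 / S ≠ 0)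
  have hAre : 0 < A.re := by
    rw [hA, Complex.re_ofReal_mul]
    simp
    positivity
  -- The positive real factor leaves the principal square root without a branch ambiguity. What is
  -- left is the inverse of `thetaFactor u`.
  have hA2 : A ^ (1 / 2 : ℂ) = ((q / √S : ℝ) : ℂ) * (2 * (1 - u * I)) ^ (1 / 2 : ℂ) := by
    rw [Complex.cpow_def_of_ne_zero hAne, Complex.cpow_def_of_ne_zero (mul_ne_zero two_ne_zero hu),
      hA, Complex.log_ofReal_mul (by positivity) (mul_ne_zero two_ne_zero hu), add_mul,
      Complex.exp_add]
    congr 1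
    rw [← Complex.ofReal_one, ← Complex.ofReal_ofNat, ← Complex.ofReal_div, ← Complex.ofReal_mul,
      ← Complex.ofReal_exp]
    congr 1
    rw [← Real.rpow_def_of_pos (by positivity), ← Real.sqrt_eq_rpow, Real.sqrt_div (by positivity),
      Real.sqrt_sq hq.le]
  have key : ∀ y : ZMod q, ∑' k : ℤ, thetaKernel S (a / q + u / S) ((q : ℤ) * k + (y.val : ℤ)) *
      Complex.exp (2 * Real.pi * I * (((q : ℤ) * k + (y.val : ℤ) : ℤ) : ℂ) * x) =
      thetaFactor u / q * ∑' n : ℤ, ZMod.stdAddChar ((a : ZMod q) * y ^ 2 + (n : ZMod q) * y) *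
        Complex.exp (-(Real.pi * S / (2 * q ^ 2) / (1 - u * I)) * (n - q * x) ^ 2) := by
    intro y
    set r : ℤ := (y.val : ℤ) with hr
    have hy : y = (r : ZMod q) := by rw [hr]; simp
    have hP := Complex.tsum_exp_neg_quadratic hAre (-A * (r / q) + I * q * x)
    have e1 : ∀ k : ℤ, thetaKernel S (a / q + u / S) ((q : ℤ) * k + r) *
        Complex.exp (2 * Real.pi * I * (((q : ℤ) * k + r : ℤ) : ℂ) * x) =
        (((√S)⁻¹ : ℝ) * Complex.exp (2 * Real.pi * I * (a * r ^ 2 : ℤ) / q) *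
          Complex.exp (-Real.pi * A * (r / q) ^ 2 + 2 * Real.pi * I * r * x)) *
        Complex.exp (-Real.pi * A * (k : ℂ) ^ 2 + 2 * Real.pi * (-A * (r / q) + I * q * x) * k) := by
      intro k
      rw [thetaKernel, mul_assoc (((√S)⁻¹ : ℝ) : ℂ), mul_assoc (((√S)⁻¹ : ℝ) : ℂ),
        mul_assoc (((√S)⁻¹ : ℝ) : ℂ), ← Complex.exp_add, ← Complex.exp_add, ← Complex.exp_add]
      congr 1
      rw [Complex.exp_eq_exp_iff_exists_int]
      -- `a (q k + r)² / q` differs from `a r² / q` by this integer, so the arithmetic phase depends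
      -- only on the residue class.
      refine ⟨a * (q * k ^ 2 + 2 * k * r), ?_⟩
      rw [hA]
      push_cast
      field_simp
      linear_combination ((q * k + r) ^ 2 * q) * Complex.I_sq
    have e2 : ∀ n : ℤ, Complex.exp (-Real.pi / A * (n + I * (-A * (r / q) + I * q * x)) ^ 2) =
        Complex.exp (-(-Real.pi * A * (r / q) ^ 2 + 2 * Real.pi * I * r * x)) *
        (Complex.exp (2 * Real.pi * I * (n * r : ℤ) / q) *
          Complex.exp (-(Real.pi * S / (2 * q ^ 2) / (1 - u * I)) * (n - q * x) ^ 2)) := by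
      intro n
      rw [← Complex.exp_add, ← Complex.exp_add]
      congr 1
      have h1 : Real.pi * S / (2 * q ^ 2) / (1 - u * I) = Real.pi / A := by
        rw [hA]
        push_cast
        field_simp
      have h2 : (n : ℂ) + I * (-A * (r / q) + I * q * x) = (n - q * x) - I * A * (r / q) := by
        linear_combination (q * x : ℂ) * Complex.I_sq
      rw [h1, h2]
      clear_value A
      push_cast
      field_simp
      linear_combination (-(A ^ 2 * r ^ 2)) * Complex.I_sq
    rw [tsum_congr e1, tsum_mul_left, hP, tsum_congr e2, tsum_mul_left, ← tsum_mul_left,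
      ← tsum_mul_left, ← tsum_mul_left, ← tsum_mul_left]
    refine tsum_congr fun n => ?_
    have e3 : (ZMod.stdAddChar ((a : ZMod q) * y ^ 2 + (n : ZMod q) * y) : ℂ) =
        Complex.exp (2 * Real.pi * I * (a * r ^ 2 : ℤ) / q) *
        Complex.exp (2 * Real.pi * I * (n * r : ℤ) / q) := by
      rw [← ZMod.stdAddChar_coe, ← ZMod.stdAddChar_coe, ← AddChar.map_add_eq_mul, hy]
      congr 1
      push_cast
      ring
    rw [e3, Complex.exp_neg, hA2, thetaFactor]
    have := Complex.exp_ne_zero (-Real.pi * A * (r / q) ^ 2 + 2 * Real.pi * I * r * x)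
    have hs : ((√S : ℝ) : ℂ) ≠ 0 := by exact_mod_cast (Real.sqrt_pos.2 hS).ne'
    push_cast
    field_simp
  rw [thetaMultiplier, Int.tsum_eq_sum_zmod (summable_thetaMultiplier hS _ x) q]
  rw [Finset.sum_congr rfl fun y _ => key y, ← Finset.mul_sum]
  congr 1
  rw [← Summable.tsum_finsetSum]
  · refine tsum_congr fun n => ?_
    rw [quadGaussSum, Finset.sum_mul]
  · intro y _
    have hre : 0 < (((Real.pi * S / (2 * q ^ 2) : ℝ) : ℂ) / (1 - u * I) : ℂ).re := by
      rw [re_div_one_sub_mul_I]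
      positivity
    refine (summable_gaussian_nearest (g := fun n : ℤ =>
      ZMod.stdAddChar ((a : ZMod q) * y ^ 2 + (n : ZMod q) * y)) (b := 1) (fun n => ?_) hre
      (q * x)).1.congr fun n => ?_
    · rw [ZMod.stdAddChar_apply, Circle.norm_coe]
    · push_cast
      rfl

/-- The theta multiplier at `a / q + u / S` is close to its main term. -/
theorem norm_thetaMultiplier_sub_le {S : ℝ} (hS : 0 < S) (q : ℕ) [NeZero q] (a : ℤ) (u x : ℝ)
    {b : ℝ} (hb : ∀ n : ZMod q, ‖quadGaussSum q a n‖ ≤ b) :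
    ‖thetaMultiplier S (a / q + u / S) x - thetaFactor u / q * (quadGaussSum q a (round (q * x) : ℤ) *
      Complex.exp (-((Real.pi * S / (2 * q ^ 2) : ℝ) / (1 - u * I)) * (round (q * x) - q * x) ^ 2))‖
      ≤ ‖thetaFactor u‖ / q * (b * (4 / (Real.pi * S / (2 * q ^ 2) / (1 + u ^ 2))) * intInvSqSum) := by
  have hq : (0 : ℝ) < q := by exact_mod_cast Nat.pos_of_ne_zero (NeZero.ne q)
  have hre := re_div_one_sub_mul_I (Real.pi * S / (2 * q ^ 2)) u
  have h := (summable_gaussian_nearest (g := fun n : ℤ => quadGaussSum q a n)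
    (fun n => hb n) (by rw [hre]; positivity) (q * x)).2
  rw [hre] at h
  have h2 := mul_le_mul_of_nonneg_left h (by positivity : 0 ≤ ‖thetaFactor u‖ / q)
  refine le_trans (le_of_eq ?_) h2
  rw [thetaMultiplier_eq hS, ← mul_sub, norm_mul, norm_div, Complex.norm_natCast]
  push_cast
  rfl

/-! ### Product sums and the `ℓ²` maximal inequality for positive kernels. -/

theorem hasSum_prod_fin {d : ℕ} {f : Fin d → ℤ → ℂ} (hf : ∀ i, Summable fun k => ‖f i k‖) :
    (Summable fun m : Fin d → ℤ => ‖∏ i, f i (m i)‖) ∧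
      HasSum (fun m : Fin d → ℤ => ∏ i, f i (m i)) (∏ i, ∑' k, f i k) := by
  induction d with
  | zero =>
    refine ⟨(hasSum_unique _).summable, ?_⟩
    simp
  | succ n ih =>
    obtain ⟨h1, h2⟩ := ih (f := fun i => f i.succ) fun i => hf i.succ
    have e : ∀ p : ℤ × (Fin n → ℤ), ∏ i, f i (Fin.consEquiv (fun _ => ℤ) p i) =
        f 0 p.1 * ∏ i : Fin n, f i.succ (p.2 i) := by
      intro p
      rw [Fin.prod_univ_succ]
      simp [Fin.consEquiv]
    have h3 : Summable fun p : ℤ × (Fin n → ℤ) => ‖f 0 p.1 * ∏ i : Fin n, f i.succ (p.2 i)‖ :=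
      Summable.mul_norm (f := f 0) (g := fun m : Fin n → ℤ => ∏ i : Fin n, f i.succ (m i)) (hf 0) h1
    constructor
    · rw [← (Fin.consEquiv fun _ => ℤ).summable_iff]
      exact h3.congr fun p => by rw [← e]; rfl
    · rw [← (Fin.consEquiv fun _ => ℤ).hasSum_iff, Fin.prod_univ_succ, ← h2.tsum_eq,
        tsum_mul_tsum_of_summable_norm (hf 0) h1]
      exact h3.of_norm.hasSum.congr_fun fun p => by rw [← e]; rfl

theorem ENNReal.tsum_prod_fin {d : ℕ} (f : Fin d → ℤ → ℝ≥0∞) :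
    ∑' m : Fin d → ℤ, ∏ i, f i (m i) = ∏ i, ∑' k, f i k := by
  induction d with
  | zero => simp
  | succ n ih =>
    rw [← (Fin.consEquiv fun _ => ℤ).tsum_eq, ENNReal.tsum_prod', Fin.prod_univ_succ, ← ih,
      ← ENNReal.tsum_mul_right]
    refine tsum_congr fun k => ?_
    rw [← ENNReal.tsum_mul_left]
    refine tsum_congr fun m => ?_
    rw [Fin.prod_univ_succ]
    simp [Fin.consEquiv]

theorem ENNReal.lintegral_mul_sq_le {α : Type*} [MeasurableSpace α] (μ : Measure α)
    {f g : α → ℝ≥0∞} (hf : AEMeasurable f μ) (hg : AEMeasurable g μ) :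
    (∫⁻ x, f x * g x ∂μ) ^ 2 ≤ (∫⁻ x, f x ^ 2 ∂μ) * ∫⁻ x, g x ^ 2 ∂μ := by
  have h := ENNReal.lintegral_mul_le_Lp_mul_Lq μ Real.HolderConjugate.two_two hf hg
  calc _ ≤ ((∫⁻ a, f a ^ (2 : ℝ) ∂μ) ^ (1 / (2 : ℝ)) *
        (∫⁻ a, g a ^ (2 : ℝ) ∂μ) ^ (1 / (2 : ℝ))) ^ 2 := by gcongr; exact h
    _ = _ := by
      rw [mul_pow, ← ENNReal.rpow_natCast, ← ENNReal.rpow_natCast, ← ENNReal.rpow_mul,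
        ← ENNReal.rpow_mul]
      norm_num

theorem ENNReal.tsum_mul_sq_le {α : Type*} (f g : α → ℝ≥0∞) :
    (∑' x, f x * g x) ^ 2 ≤ (∑' x, f x ^ 2) * ∑' x, g x ^ 2 := by
  let _ : MeasurableSpace α := ⊤
  simpa [lintegral_count] using ENNReal.lintegral_mul_sq_le Measure.count
    (measurable_from_top (f := f)).aemeasurable (measurable_from_top (f := g)).aemeasurable

/-- The absorption step of the `T T*` argument. Cancelling `V` requires `V ≠ ∞`, which is why
finiteness is checked before each use. -/
theorem ENNReal.le_of_sq_le_mul {V A : ℝ≥0∞} (hV : V ≠ ∞) (h : V ^ 2 ≤ A * V) : V ≤ A := by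
  rcases eq_or_ne V 0 with h0 | h0
  · simp [h0]
  · rw [sq] at h
    exact (ENNReal.mul_le_mul_iff_left h0 hV).1 h

/-- A positive kernel `k` with `k k* ≤ C (k + k*)` is bounded on `ℓ²`. -/
theorem ENNReal.tsum_kernel_sq_le {X : Type*} {k : X → X → ℝ≥0∞} {C : ℝ≥0∞} (hC : C ≠ ∞)
    (hC0 : C ≠ 0) (hk : ∀ x, k x x ≠ ∞)
    (hkk : ∀ x x', ∑' y, k x y * k x' y ≤ C * (k x x' + k x' x)) (g : X → ℝ≥0∞) :
    ∑' x, (∑' y, k x y * g y) ^ 2 ≤ (2 * C) ^ 2 * ∑' y, g y ^ 2 := by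
  rcases eq_or_ne (∑' y, g y ^ 2) ∞ with hg | hg
  · rw [hg, ENNReal.mul_top (by simpa using hC0)]
    exact le_top
  have hkx : ∀ x, ∑' y, k x y ^ 2 ≠ ∞ := by
    intro x
    simp_rw [sq]
    exact ne_top_of_le_ne_top (ENNReal.mul_ne_top hC (ENNReal.add_ne_top.2 ⟨hk x, hk x⟩)) (hkk x x)
  have hS : ∀ x, ∑' y, k x y * g y ≠ ∞ := by
    intro x hx
    have := ENNReal.tsum_mul_sq_le (k x) g
    rw [hx] at this
    simp only [ne_eq, OfNat.ofNat_ne_zero, not_false_eq_true, ENNReal.top_pow, top_le_iff] at this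
    exact ENNReal.mul_ne_top (hkx x) hg this
  -- the dual estimate, for finitely supported functions
  have dual : ∀ (s : Finset X) (h : X → ℝ≥0∞), (∀ x, h x ≠ ∞) →
      ∑' y, (∑ x ∈ s, k x y * h x) ^ 2 ≤ (2 * C) ^ 2 * ∑ x ∈ s, h x ^ 2 := by
    intro s h hh
    set φ : X → ℝ≥0∞ := fun y => ∑ x ∈ s, k x y * h x with hφ
    have e1 : ∑' y, φ y ^ 2 = ∑ x ∈ s, ∑ x' ∈ s, h x * h x' * ∑' y, k x y * k x' y := by
      have : ∀ y, φ y ^ 2 = ∑ x ∈ s, ∑ x' ∈ s, h x * h x' * (k x y * k x' y) := by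
        intro y
        rw [hφ, sq, Finset.sum_mul_sum]
        exact Finset.sum_congr rfl fun x _ => Finset.sum_congr rfl fun x' _ => by ring
      simp_rw [this]
      rw [Summable.tsum_finsetSum fun _ _ => ENNReal.summable]
      refine Finset.sum_congr rfl fun x _ => ?_
      rw [Summable.tsum_finsetSum fun _ _ => ENNReal.summable]
      exact Finset.sum_congr rfl fun x' _ => ENNReal.tsum_mul_left
    -- The hypothesis on the kernel bounds the quadratic form by its own linear version: each of the
    -- two terms `k x x'`, `k x' x` reproduces `∑ h φ`. Cauchy–Schwarz then leaves `∑' φ²` on both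
    -- sides, to a lower power on the right.
    have e2 : ∑' y, φ y ^ 2 ≤ 2 * C * ∑ x ∈ s, h x * φ x := by
      rw [e1]
      calc _ ≤ ∑ x ∈ s, ∑ x' ∈ s, h x * h x' * (C * (k x x' + k x' x)) := by
            gcongr with x _ x' _
            exact hkk x x'
        _ = C * ∑ x ∈ s, ∑ x' ∈ s, h x * h x' * k x x' +
              C * ∑ x ∈ s, ∑ x' ∈ s, h x * h x' * k x' x := by
            simp_rw [Finset.mul_sum, ← Finset.sum_add_distrib]
            exact Finset.sum_congr rfl fun x _ => Finset.sum_congr rfl fun x' _ => by ring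
        _ = C * ∑ x ∈ s, h x * φ x + C * ∑ x ∈ s, h x * φ x := by
            congr 2
            · rw [Finset.sum_comm]
              refine Finset.sum_congr rfl fun x _ => ?_
              rw [hφ, Finset.mul_sum]
              exact Finset.sum_congr rfl fun x' _ => by ring
            · refine Finset.sum_congr rfl fun x _ => ?_
              rw [hφ, Finset.mul_sum]
              exact Finset.sum_congr rfl fun x' _ => by ring
        _ = _ := by ring
    have e3 : ∑' y, φ y ^ 2 ≠ ∞ := by
      rw [e1]
      refine ENNReal.sum_ne_top.2 fun x _ => ENNReal.sum_ne_top.2 fun x' _ => ?_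
      refine ENNReal.mul_ne_top (ENNReal.mul_ne_top (hh _) (hh _)) fun htop => ?_
      have := ENNReal.tsum_mul_sq_le (k x) (k x')
      rw [htop] at this
      simp only [ne_eq, OfNat.ofNat_ne_zero, not_false_eq_true, ENNReal.top_pow, top_le_iff] at this
      exact ENNReal.mul_ne_top (hkx x) (hkx x') this
    refine ENNReal.le_of_sq_le_mul e3 ?_
    have e4 : (∑ x ∈ s, h x * φ x) ^ 2 ≤ (∑ x ∈ s, h x ^ 2) * ∑' y, φ y ^ 2 := by
      have := ENNReal.tsum_mul_sq_le (fun x : s => h x) (fun x : s => φ x)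
      rw [tsum_fintype, tsum_fintype, Finset.sum_coe_sort s fun x => h x * φ x,
        Finset.sum_coe_sort s fun x => h x ^ 2] at this
      exact this.trans (mul_le_mul' le_rfl (ENNReal.tsum_comp_le_tsum_of_injective
        Subtype.val_injective fun x => φ x ^ 2))
    calc _ ≤ (2 * C * ∑ x ∈ s, h x * φ x) ^ 2 := by gcongr
      _ = (2 * C) ^ 2 * (∑ x ∈ s, h x * φ x) ^ 2 := by ring
      _ ≤ (2 * C) ^ 2 * ((∑ x ∈ s, h x ^ 2) * ∑' y, φ y ^ 2) := by gcongr
      _ = _ := by ring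
  rw [ENNReal.tsum_eq_iSup_sum]
  refine iSup_le fun s => ?_
  set h : X → ℝ≥0∞ := fun x => ∑' y, k x y * g y with hh
  refine ENNReal.le_of_sq_le_mul (ENNReal.sum_ne_top.2 fun x _ => ENNReal.pow_ne_top (hS x)) ?_
  -- The dual estimate is tested on `h`, the image of `g` itself.
  have e5 : ∑ x ∈ s, h x ^ 2 = ∑' y, (∑ x ∈ s, k x y * h x) * g y := by
    simp_rw [Finset.sum_mul]
    rw [Summable.tsum_finsetSum fun _ _ => ENNReal.summable]
    refine Finset.sum_congr rfl fun x _ => ?_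
    rw [sq]
    nth_rw 2 [hh]
    simp only
    rw [← ENNReal.tsum_mul_left]
    exact tsum_congr fun y => by ring
  calc (∑ x ∈ s, h x ^ 2) ^ 2 = (∑' y, (∑ x ∈ s, k x y * h x) * g y) ^ 2 := by rw [e5]
    _ ≤ (∑' y, (∑ x ∈ s, k x y * h x) ^ 2) * ∑' y, g y ^ 2 := ENNReal.tsum_mul_sq_le _ _
    _ ≤ ((2 * C) ^ 2 * ∑ x ∈ s, h x ^ 2) * ∑' y, g y ^ 2 := by
        gcongr
        exact dual s h hS
    _ = _ := by ring

/-- The positive kernel `t / (t + |m|)²` on the integers, of total mass at most `3` for `t ≥ 1`. -/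
def tentKernel (t : ℝ) (m : ℤ) : ℝ≥0∞ := ENNReal.ofReal (t / (t + |(m : ℝ)|) ^ 2)

theorem tentKernel_neg (t : ℝ) (m : ℤ) : tentKernel t (-m) = tentKernel t m := by
  simp [tentKernel]

theorem tsum_tentKernel_le {t : ℝ} (ht : 1 ≤ t) : ∑' m, tentKernel t m ≤ 3 := by
  have h0 : tentKernel t 0 ≤ 1 := by
    rw [tentKernel, ENNReal.ofReal_le_one]
    simp only [Int.cast_zero, abs_zero, add_zero]
    rw [div_le_one (by positivity)]
    nlinarith
  have h1 : ∑' n : ℕ, tentKernel t ((n : ℤ) + 1) ≤ 1 := by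
    refine ENNReal.tsum_le_of_sum_range_le fun N => ?_
    have hb : ∀ n : ℕ, t / (t + |(((n : ℤ) + 1 : ℤ) : ℝ)|) ^ 2 ≤ t / (t + n) - t / (t + (n + 1 : ℕ)) := by
      intro n
      have : |(((n : ℤ) + 1 : ℤ) : ℝ)| = n + 1 := by
        push_cast
        rw [abs_of_nonneg (by positivity)]
      rw [this]
      push_cast
      rw [div_sub_div _ _ (by positivity) (by positivity), div_le_div_iff₀ (by positivity)
        (by positivity)]
      have : 0 ≤ t * (t + (n + 1)) := by positivity
      nlinarith
    simp only [tentKernel]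
    rw [← ENNReal.ofReal_sum_of_nonneg fun n _ => by positivity, ENNReal.ofReal_le_one]
    refine (Finset.sum_le_sum fun n _ => hb n).trans ?_
    rw [Finset.sum_range_sub' (fun n : ℕ => t / (t + n))]
    have : 0 ≤ t / (t + N) := by positivity
    have h2 : t / (t + (0 : ℕ)) = 1 := by simp; positivity
    linarith
  have h2 : ∑' n : ℕ, tentKernel t n ≤ 2 := by
    rw [tsum_eq_zero_add' ENNReal.summable]
    push_cast
    calc _ ≤ (1 : ℝ≥0∞) + 1 := add_le_add h0 h1
      _ = 2 := one_add_one_eq_two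
  have h3 : ∑' n : ℕ, tentKernel t (-((n : ℤ) + 1)) ≤ 1 := by
    simp_rw [tentKernel_neg]
    exact h1
  have := HasSum.of_nat_of_neg_add_one (f := tentKernel t) ENNReal.summable.hasSum
    ENNReal.summable.hasSum
  rw [this.tsum_eq]
  calc _ ≤ (2 : ℝ≥0∞) + 1 := add_le_add h2 h3
    _ = 3 := by norm_num

/-- Since `M ≤ Y + Z`, one of the two factors is comparable to the wide tent at `M`. If `M ≤ t` or
`M ≤ 2 Z`, it is the factor of width `t`. Otherwise `Y > M / 2` and `t < M`, and the narrow factor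
is small enough because `s ≤ t`. -/
theorem tent_mul_tent_le {s t Y Z M : ℝ} (hs : 0 < s) (hst : s ≤ t) (hY : 0 ≤ Y) (hZ : 0 ≤ Z)
    (hM : 0 ≤ M) (hMYZ : M ≤ Y + Z) :
    s / (s + Y) ^ 2 * (t / (t + Z) ^ 2) ≤
      16 * (t / (t + M) ^ 2) * (s / (s + Y) ^ 2 + t / (t + Z) ^ 2) := by
  have ht : 0 < t := hs.trans_le hst
  have p1 : 0 ≤ s / (s + Y) ^ 2 := by positivity
  have p2 : 0 ≤ t / (t + Z) ^ 2 := by positivity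
  have p3 : 0 ≤ t / (t + M) ^ 2 := by positivity
  by_cases h : M ≤ t ∨ M ≤ 2 * Z
  · have : t / (t + Z) ^ 2 ≤ 16 * (t / (t + M) ^ 2) := by
      rw [← mul_div_assoc, div_le_div_iff₀ (by positivity) (by positivity)]
      have : (t + M) ≤ 4 * (t + Z) := by rcases h with h | h <;> linarith
      have h2 : (t + M) ^ 2 ≤ 16 * (t + Z) ^ 2 := by nlinarith
      nlinarith
    nlinarith [mul_le_mul_of_nonneg_left this p1, mul_nonneg p3 p2]
  · push Not at h
    have : s / (s + Y) ^ 2 ≤ 16 * (t / (t + M) ^ 2) := by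
      rw [← mul_div_assoc, div_le_div_iff₀ (by positivity) (by positivity)]
      have h1 : (t + M) ≤ 4 * (s + Y) := by linarith
      have h2 : (t + M) ^ 2 ≤ 16 * (s + Y) ^ 2 := by nlinarith
      nlinarith [mul_le_mul hst h2 (by positivity) ht.le]
    nlinarith [mul_le_mul_of_nonneg_right this p2, mul_nonneg p3 p1]

/-- The convolution of two tents is bounded by the wider one. The constant is `16 * (3 + 3)`, from
the pointwise bound and the two masses. -/
theorem tsum_tentKernel_mul_le {s t : ℝ} (hs : 1 ≤ s) (hst : s ≤ t) (x x' : ℤ) :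
    ∑' y, tentKernel s (x - y) * tentKernel t (x' - y) ≤ 96 * tentKernel t (x - x') := by
  have hs0 : 0 < s := by linarith
  have ht0 : 0 < t := by linarith
  have hb : ∀ y, tentKernel s (x - y) * tentKernel t (x' - y) ≤
      16 * tentKernel t (x - x') * (tentKernel s (x - y) + tentKernel t (x' - y)) := by
    intro y
    have h : |((x - x' : ℤ) : ℝ)| ≤ |((x - y : ℤ) : ℝ)| + |((x' - y : ℤ) : ℝ)| := by
      push_cast
      rw [abs_sub_comm (x' : ℝ) y]
      exact abs_sub_le _ _ _
    have := tent_mul_tent_le hs0 hst (abs_nonneg _) (abs_nonneg _) (abs_nonneg _) h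
    simp only [tentKernel]
    rw [← ENNReal.ofReal_mul (by positivity), ← ENNReal.ofReal_add (by positivity) (by positivity),
      show (16 : ℝ≥0∞) = ENNReal.ofReal 16 by simp, ← ENNReal.ofReal_mul (by positivity),
      ← ENNReal.ofReal_mul (by positivity)]
    exact ENNReal.ofReal_le_ofReal this
  have hsum : ∀ (r : ℝ) (_ : 1 ≤ r) (z : ℤ), ∑' y, tentKernel r (z - y) ≤ 3 := by
    intro r hr z
    exact ((Equiv.subLeft z).tsum_eq (tentKernel r)).le.trans (tsum_tentKernel_le hr)
  calc _ ≤ ∑' y, 16 * tentKernel t (x - x') * (tentKernel s (x - y) + tentKernel t (x' - y)) :=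
        ENNReal.tsum_le_tsum hb
    _ = 16 * tentKernel t (x - x') *
          (∑' y, tentKernel s (x - y) + ∑' y, tentKernel t (x' - y)) := by
        rw [ENNReal.tsum_mul_left, ENNReal.tsum_add]
    _ ≤ 16 * tentKernel t (x - x') * (3 + 3) := by
        gcongr
        · exact hsum s hs x
        · exact hsum t (hs.trans hst) x'
    _ = _ := by
        rw [mul_right_comm]
        norm_num

/-- The product kernel on `ℤ^d` of `tentKernel`. -/
def tentKernelPi {d : ℕ} (t : ℝ) (m : Fin d → ℤ) : ℝ≥0∞ := ∏ i, tentKernel t (m i)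

theorem tentKernelPi_ne_top {d : ℕ} (t : ℝ) (m : Fin d → ℤ) : tentKernelPi t m ≠ ∞ :=
  ENNReal.prod_ne_top fun _ _ => ENNReal.ofReal_ne_top

/-- In every coordinate the wider kernel survives. Not knowing which of `s`, `t` is larger, one
keeps both; this symmetric form is the hypothesis of `ENNReal.tsum_kernel_sq_le` for a kernel whose
width varies with the point. -/
theorem tsum_tentKernelPi_mul_le {d : ℕ} {s t : ℝ} (hs : 1 ≤ s) (ht : 1 ≤ t) (x x' : Fin d → ℤ) :
    ∑' y, tentKernelPi s (x - y) * tentKernelPi t (x' - y) ≤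
      96 ^ d * (tentKernelPi s (x - x') + tentKernelPi t (x' - x)) := by
  have key : ∀ {s t : ℝ} (_ : 1 ≤ s) (_ : s ≤ t) (x x' : Fin d → ℤ),
      ∑' y, tentKernelPi s (x - y) * tentKernelPi t (x' - y) ≤ 96 ^ d * tentKernelPi t (x' - x) := by
    intro s t hs hst x x'
    simp only [tentKernelPi, Pi.sub_apply, ← Finset.prod_mul_distrib]
    rw [ENNReal.tsum_prod_fin fun i y => tentKernel s (x i - y) * tentKernel t (x' i - y)]
    calc _ ≤ ∏ i, 96 * tentKernel t (x i - x' i) :=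
          Finset.prod_le_prod' fun i _ => tsum_tentKernel_mul_le hs hst _ _
      _ = _ := by
          rw [Finset.prod_mul_distrib, Finset.prod_const, Finset.card_univ, Fintype.card_fin]
          congr 1
          exact Finset.prod_congr rfl fun i _ => by rw [← tentKernel_neg, neg_sub]
  rcases le_total s t with h | h
  · exact (key hs h x x').trans (mul_le_mul' le_rfl le_add_self)
  · refine (le_of_eq ?_).trans ((key ht h x' x).trans (mul_le_mul' le_rfl le_self_add))
    exact tsum_congr fun y => mul_comm _ _

/-- The maximal inequality on `ℓ²(ℤ^d)` for averages over the kernels `tentKernelPi`. -/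
theorem tsum_iSup_tentKernelPi_sq_le {d : ℕ} {ι : Type*} {τ : ι → ℝ} (hτ : ∀ j, 1 ≤ τ j)
    (g : (Fin d → ℤ) → ℝ≥0∞) :
    ∑' x, (⨆ j, ∑' m, tentKernelPi (τ j) m * g (x - m)) ^ 2 ≤
      4 * ((2 * 96 ^ d) ^ 2 * ∑' y, g y ^ 2) := by
  have hC0 : (96 : ℝ≥0∞) ^ d ≠ 0 := by positivity
  have hC : (96 : ℝ≥0∞) ^ d ≠ ∞ := ENNReal.pow_ne_top (by simp)
  rcases eq_or_ne (∑' y, g y ^ 2) ∞ with hg | hg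
  · rw [hg, ENNReal.mul_top (by positivity), ENNReal.mul_top (by norm_num)]
    exact le_top
  have hP : ∀ j x, ∑' m, tentKernelPi (τ j) m * g (x - m) = ∑' y, tentKernelPi (τ j) (x - y) * g y := by
    intro j x
    rw [← (Equiv.subLeft x).tsum_eq]
    exact tsum_congr fun y => by simp
  simp_rw [hP]
  -- Linearisation of the supremum: the index is allowed to depend arbitrarily on `x`, and the
  -- kernel bound does not see the choice `J`.
  have lin : ∀ J : (Fin d → ℤ) → ι, ∑' x, (∑' y, tentKernelPi (τ (J x)) (x - y) * g y) ^ 2 ≤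
      (2 * 96 ^ d) ^ 2 * ∑' y, g y ^ 2 := by
    intro J
    refine ENNReal.tsum_kernel_sq_le (k := fun x y => tentKernelPi (τ (J x)) (x - y)) hC hC0
      (fun x => tentKernelPi_ne_top _ _) (fun x x' => ?_) g
    exact tsum_tentKernelPi_mul_le (hτ _) (hτ _) x x'
  set V : (Fin d → ℤ) → ℝ≥0∞ := fun x => ⨆ j, ∑' y, tentKernelPi (τ j) (x - y) * g y with hV
  rcases isEmpty_or_nonempty ι with hι | hι
  · simp
  have hVtop : ∀ x, V x ≠ ∞ := by
    intro x
    have hB : (2 * 96 ^ d) ^ 2 * ∑' y, g y ^ 2 ≠ ∞ :=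
      ENNReal.mul_ne_top (ENNReal.pow_ne_top (ENNReal.mul_ne_top (by simp) hC)) hg
    have : V x ≤ 1 + (2 * 96 ^ d) ^ 2 * ∑' y, g y ^ 2 := by
      refine iSup_le fun j => ?_
      have h1 := (ENNReal.le_tsum x).trans (lin fun _ => j)
      by_cases h : (∑' y, tentKernelPi (τ j) (x - y) * g y) ≤ 1
      · exact h.trans le_self_add
      · refine le_trans ?_ (h1.trans le_add_self)
        exact le_self_pow₀ (le_of_not_ge h) two_ne_zero
    exact ne_top_of_le_ne_top (ENNReal.add_ne_top.2 ⟨by simp, hB⟩) this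
  -- An index within a factor 2 of the supremum; squared, this is the 4 in the statement. Finiteness
  -- of `V x` ensures that half the supremum is strictly smaller.
  have hJ : ∀ x, ∃ j, V x ≤ 2 * ∑' y, tentKernelPi (τ j) (x - y) * g y := by
    intro x
    rcases eq_or_ne (V x) 0 with h0 | h0
    · exact ⟨Classical.arbitrary ι, by simp [h0]⟩
    · obtain ⟨j, hj⟩ := lt_iSup_iff.1 (ENNReal.half_lt_self h0 (hVtop x))
      refine ⟨j, ?_⟩
      rw [ENNReal.div_lt_iff (by simp) (by simp)] at hj
      rw [mul_comm]
      exact hj.le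
  choose J hJ using hJ
  calc ∑' x, V x ^ 2 ≤ ∑' x, 4 * (∑' y, tentKernelPi (τ (J x)) (x - y) * g y) ^ 2 := by
        refine ENNReal.tsum_le_tsum fun x => ?_
        calc _ ≤ (2 * ∑' y, tentKernelPi (τ (J x)) (x - y) * g y) ^ 2 := by gcongr; exact hJ x
          _ = _ := by rw [mul_pow]; norm_num
    _ ≤ _ := by
        rw [ENNReal.tsum_mul_left]
        gcongr
        exact lin J

/-- The maximal inequality along the sublattice `q ℤ^d`, uniformly in `q`. -/
theorem tsum_iSup_tentKernelPi_smul_sq_le {d : ℕ} (q : ℕ) [NeZero q] {ι : Type*} {τ : ι → ℝ}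
    (hτ : ∀ j, 1 ≤ τ j) (g : (Fin d → ℤ) → ℝ≥0∞) :
    ∑' x, (⨆ j, ∑' m, tentKernelPi (τ j) m * g (x - (q : ℤ) • m)) ^ 2 ≤
      4 * ((2 * 96 ^ d) ^ 2 * ∑' y, g y ^ 2) := by
  -- Decomposition of `ℤ^d` into cosets of `q ℤ^d`. The operator preserves each coset and acts there
  -- as the operator with `q = 1`, hence the uniformity in `q`.
  let E : (Fin d → Fin q) × (Fin d → ℤ) ≃ (Fin d → ℤ) :=
    (Equiv.prodComm _ _).trans ((Equiv.arrowProdEquivProdArrow (Fin d) (fun _ => ℤ)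
      (fun _ => Fin q)).symm.trans
      (Equiv.piCongrRight fun _ => (Int.divModEquiv q).symm))
  have hE : ∀ p, E p = fun i => (p.1 i : ℤ) + (q : ℤ) * p.2 i := by
    intro p
    ext i
    simp [E, Equiv.arrowProdEquivProdArrow, Int.divModEquiv_symm_apply]
    ring
  have hsub : ∀ r k m, E (r, k) - (q : ℤ) • m = E (r, k - m) := by
    intro r k m
    rw [hE, hE]
    ext i
    simp
    ring
  rw [← E.tsum_eq, ← E.tsum_eq (fun y => g y ^ 2), ENNReal.tsum_prod', ENNReal.tsum_prod',
    ← ENNReal.tsum_mul_left, ← ENNReal.tsum_mul_left]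
  refine ENNReal.tsum_le_tsum fun r => ?_
  simp_rw [hsub]
  exact tsum_iSup_tentKernelPi_sq_le hτ fun k => g (E (r, k))

/-! ### Fourier series on the torus. -/

section Fourier

open UnitAddTorus

attribute [local instance] instMeasureSpaceUnitAddCircle
attribute [local instance] instIsProbabilityMeasureUnitAddCircleVolume

/-- Parseval with values in `[0, ∞]`, so that sums over frequencies, scales and positions can later
be interchanged freely. Boundedness provides membership in `L²`. -/
theorem tsum_enorm_mFourierCoeff_sq {d : ℕ} {g : UnitAddTorus (Fin d) → ℂ} {B : ℝ}
    (hg : Measurable g) (hB : ∀ t, ‖g t‖ ≤ B) :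
    ∑' x, ‖mFourierCoeff g x‖ₑ ^ 2 = ∫⁻ t, ‖g t‖ₑ ^ 2 := by
  have hmem : MemLp g 2 volume := MemLp.of_bound hg.aestronglyMeasurable B (by simp [hB])
  have h := hasSum_sq_mFourierCoeff hmem.toLp
  have e1 : ∀ x, mFourierCoeff hmem.toLp x = mFourierCoeff g x := fun x =>
    integral_congr_ae (by filter_upwards [hmem.coeFn_toLp] with t ht; rw [ht])
  have e2 : ∫ t, ‖hmem.toLp g t‖ ^ 2 = ∫ t, ‖g t‖ ^ 2 :=
    integral_congr_ae (by filter_upwards [hmem.coeFn_toLp] with t ht; rw [ht])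
  rw [e2] at h
  simp_rw [e1] at h
  have e3 : ∀ z : ℂ, ‖z‖ₑ ^ 2 = ENNReal.ofReal (‖z‖ ^ 2) := fun z => by
    rw [ENNReal.ofReal_pow (norm_nonneg _), ofReal_norm]
  simp_rw [e3]
  rw [← ENNReal.ofReal_tsum_of_nonneg (fun x => by positivity) h.summable, h.tsum_eq,
    ofReal_integral_eq_lintegral_ofReal _ (Filter.Eventually.of_forall fun t => by positivity)]
  refine Integrable.of_bound (C := B ^ 2) (by fun_prop) (Filter.Eventually.of_forall fun t => ?_)
  rw [Real.norm_of_nonneg (by positivity)]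
  gcongr
  exact hB t

theorem norm_mFourier_apply {d : ℕ} (n : Fin d → ℤ) (t : UnitAddTorus (Fin d)) :
    ‖mFourier n t‖ = 1 := by
  simp only [mFourier, fourier_apply, ContinuousMap.coe_mk, norm_prod, Circle.norm_coe,
    Finset.prod_const_one]

/-- Convolution along `q ℤ^d` multiplies by a trigonometric series. -/
theorem hasSum_mul_mFourierCoeff {d : ℕ} {k : (Fin d → ℤ) → ℂ} (hk : Summable fun m => ‖k m‖)
    {g : UnitAddTorus (Fin d) → ℂ} (hg : Integrable g) (q : ℤ) (x : Fin d → ℤ) :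
    HasSum (fun m => k m * mFourierCoeff g (x - q • m))
      (mFourierCoeff (fun t => (∑' m, k m * mFourier (q • m) t) * g t) x) := by
  have h_int : ∀ m, Integrable fun t => k m * (mFourier (-(x - q • m)) t • g t) := fun m =>
    (hg.bdd_mul (c := 1) (by fun_prop)
      (Filter.Eventually.of_forall fun t => (norm_mFourier_apply _ t).le)).const_mul _
  have h := hasSum_integral_of_summable_integral_norm h_int (by
    have : ∀ m, ∫ t, ‖k m * (mFourier (-(x - q • m)) t • g t)‖ = ‖k m‖ * ∫ t, ‖g t‖ := by
      intro m
      rw [← integral_const_mul]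
      simp only [norm_mul, norm_smul, norm_mFourier_apply, one_mul]
    simp_rw [this]
    exact hk.mul_right _)
  simp_rw [integral_const_mul] at h
  suffices e : mFourierCoeff (fun t => (∑' m, k m * mFourier (q • m) t) * g t) x =
      ∫ t, ∑' m, k m * (mFourier (-(x - q • m)) t • g t) by
    rw [e]
    exact h
  refine integral_congr_ae (Filter.Eventually.of_forall fun t => ?_)
  simp only [smul_eq_mul]
  rw [← tsum_mul_right, ← tsum_mul_left]
  refine tsum_congr fun m => ?_
  rw [neg_sub, sub_eq_add_neg, mFourier_add]
  ring

theorem mFourierCoeff_mFourier {d : ℕ} (n x : Fin d → ℤ) :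
    mFourierCoeff (mFourier n) x = if x = n then 1 else 0 := by
  have h := (orthonormal_iff_ite.1 (orthonormal_mFourier (d := Fin d))) x n
  rw [← h, ContinuousMap.inner_toLp]
  simp only [mFourierCoeff, smul_eq_mul, mFourier_neg]
  exact integral_congr_ae (Filter.Eventually.of_forall fun t => by simp [mul_comm])

theorem mFourierCoeff_sum {d : ℕ} (s : Finset (Fin d → ℤ)) (f : (Fin d → ℤ) → ℂ)
    (hf : ∀ n ∉ s, f n = 0) (x : Fin d → ℤ) :
    mFourierCoeff (fun t => ∑ n ∈ s, f n * mFourier n t) x = f x := by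
  simp only [mFourierCoeff, Finset.smul_sum]
  rw [integral_finsetSum]
  · have : ∀ n, ∫ t, mFourier (-x) t • (f n * mFourier n t) = f n * if x = n then 1 else 0 := by
      intro n
      rw [← mFourierCoeff_mFourier, mFourierCoeff, ← integral_const_mul]
      exact integral_congr_ae (Filter.Eventually.of_forall fun t => by
        simp only [smul_eq_mul]; ring)
    simp_rw [this]
    by_cases hx : x ∈ s
    · simp [hx]
    · simp [hx, hf x hx]
  · intro n _
    refine Integrable.of_bound (C := ‖f n‖) (by fun_prop)
      (Filter.Eventually.of_forall fun t => ?_)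
    rw [norm_smul, norm_mul, norm_mFourier_apply, norm_mFourier_apply, one_mul, mul_one]

end Fourier

/-! ### Approximation of the theta multiplier near a rational. -/

/-- Factors are exchanged one at a time. The error is measured relative to the size `R`, so the
power `R ^ d` comes out undamaged; this power is what later gives decay in `q` and `u`. -/
theorem norm_prod_sub_prod_le {d : ℕ} {a b : Fin d → ℂ} {R ε : ℝ} (hR : 0 ≤ R)
    (ha : ∀ i, ‖a i‖ ≤ R) (hb : ∀ i, ‖b i‖ ≤ R) (hab : ∀ i, ‖a i - b i‖ ≤ R * ε) :
    ‖∏ i, a i - ∏ i, b i‖ ≤ d * R ^ d * ε := by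
  induction d with
  | zero => simp
  | succ n ih =>
    rw [Fin.prod_univ_succ, Fin.prod_univ_succ]
    have e : a 0 * ∏ i : Fin n, a i.succ - b 0 * ∏ i : Fin n, b i.succ =
        (a 0 - b 0) * ∏ i : Fin n, a i.succ +
          b 0 * (∏ i : Fin n, a i.succ - ∏ i : Fin n, b i.succ) := by ring
    have h1 : ‖∏ i : Fin n, a i.succ‖ ≤ R ^ n := by
      rw [norm_prod]
      calc _ ≤ ∏ _i : Fin n, R := Finset.prod_le_prod (fun i _ => norm_nonneg _) fun i _ => ha _
        _ = R ^ n := by simp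
    have h2 := ih (a := fun i => a i.succ) (b := fun i => b i.succ) (fun i => ha _)
      (fun i => hb _) fun i => hab _
    have h3 : 0 ≤ R * ε := (norm_nonneg _).trans (hab 0)
    rw [e]
    calc _ ≤ ‖a 0 - b 0‖ * ‖∏ i : Fin n, a i.succ‖ +
          ‖b 0‖ * ‖∏ i : Fin n, a i.succ - ∏ i : Fin n, b i.succ‖ := by
          refine (norm_add_le _ _).trans ?_
          rw [norm_mul, norm_mul]
      _ ≤ R * ε * R ^ n + R * (n * R ^ n * ε) :=
          add_le_add (mul_le_mul (hab 0) h1 (norm_nonneg _) h3)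
            (mul_le_mul (hb 0) h2 (norm_nonneg _) hR)
      _ = _ := by push_cast; ring

theorem thetaFactor_ne_zero (u : ℝ) : thetaFactor u ≠ 0 := by
  rw [← norm_ne_zero_iff]
  intro h
  have := norm_thetaFactor_sq u
  rw [h] at this
  have h2 : 0 < (2 * √(1 + u ^ 2))⁻¹ := by positivity
  rw [← this] at h2
  simp at h2

theorem quadGaussSum_one (a n : ZMod 1) : quadGaussSum 1 a n = 1 := by
  simp [quadGaussSum, Subsingleton.elim a 0, Subsingleton.elim n 0]

theorem norm_thetaMultiplier_zero_sub_le {s : ℝ} (hs : 0 < s) (y : ℝ) :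
    ‖thetaMultiplier s 0 y - thetaFactor 0 * Complex.exp (-(Real.pi * s / 2 : ℝ) * (round y - y) ^ 2)‖
      ≤ ‖thetaFactor 0‖ * (4 / (Real.pi * s / 2) * intInvSqSum) := by
  have h := norm_thetaMultiplier_sub_le hs 1 0 0 y (b := 1) (by simp [quadGaussSum_one])
  simpa [quadGaussSum_one] using h

/-- The bound for the main term of the theta multiplier near a rational of denominator `q`. -/
def majorBound (q : ℕ) (u : ℝ) : ℝ := ‖thetaFactor u‖ / q * √(2 * q)

theorem majorBound_nonneg (q : ℕ) (u : ℝ) : 0 ≤ majorBound q u := by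
  rw [majorBound]; positivity

theorem majorBound_sq (q : ℕ) [NeZero q] (u : ℝ) :
    majorBound q u ^ 2 = (q * √(1 + u ^ 2))⁻¹ := by
  have hq : (0 : ℝ) < q := by exact_mod_cast Nat.pos_of_ne_zero (NeZero.ne q)
  rw [majorBound, mul_pow, div_pow, norm_thetaFactor_sq, Real.sq_sqrt (by positivity)]
  field_simp

/-- The value of the main term of the theta multiplier at the nearest rational, normalized. -/
def majorCoeff (q : ℕ) [NeZero q] (a : ℤ) (u x : ℝ) : ℂ :=
  thetaFactor u / q * quadGaussSum q a (round (q * x) : ℤ) / thetaFactor 0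

/-- The constant bounding the theta multiplier by its main term. -/
def thetaConst : ℝ := 1 + 16 * intInvSqSum / Real.pi

theorem one_le_thetaConst : 1 ≤ thetaConst := by
  have := intInvSqSum_nonneg
  rw [thetaConst]
  have : 0 ≤ 16 * intInvSqSum / Real.pi := by positivity
  linarith

/-- The arc condition is what keeps the Gaussians produced by Poisson summation uniformly narrow:
the real part of their parameter is bounded below, so the term nearest to the centre dominates. -/
theorem pi_div_four_le {q : ℕ} [NeZero q] {u S : ℝ} (hS : q ^ 2 * max 1 (u ^ 2) ≤ S) :
    Real.pi / 4 ≤ Real.pi * S / (2 * q ^ 2) / (1 + u ^ 2) := by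
  have hq : (0 : ℝ) < q := by exact_mod_cast Nat.pos_of_ne_zero (NeZero.ne q)
  have h1 : 1 + u ^ 2 ≤ 2 * max 1 (u ^ 2) := by
    have := le_max_left 1 (u ^ 2)
    have := le_max_right 1 (u ^ 2)
    linarith
  rw [div_div, div_le_div_iff₀ (by positivity) (by positivity)]
  have h2 : (q : ℝ) ^ 2 * (1 + u ^ 2) ≤ 2 * S := by
    nlinarith [mul_le_mul_of_nonneg_left h1 (sq_nonneg (q : ℝ))]
  nlinarith [Real.pi_pos]

theorem pos_of_sq_mul_max_le {q : ℕ} [NeZero q] {u S : ℝ} (hS : q ^ 2 * max 1 (u ^ 2) ≤ S) :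
    0 < S := by
  have hq : (0 : ℝ) < q := by exact_mod_cast Nat.pos_of_ne_zero (NeZero.ne q)
  have : (0 : ℝ) < max 1 (u ^ 2) := lt_max_of_lt_left one_pos
  have : 0 < q ^ 2 * max 1 (u ^ 2) := by positivity
  linarith

/-- Both exponentials are within `O(X)` of 1 for small `X`, and both are at most `(1 + u²)/X` in
general. Two-sided decay in `X` makes the sum over the scales `4 ^ j` converge. -/
theorem norm_exp_sub_exp_le (u X : ℝ) (hX : 0 ≤ X) :
    ‖Complex.exp (-(X / (1 - u * I))) - Complex.exp (-X)‖ ≤ 4 * min X ((1 + u ^ 2) / X) := by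
  have hn : ∀ v : ℝ, ‖Complex.exp (-(X / (1 - v * I)))‖ = Real.exp (-(X / (1 + v ^ 2))) := by
    intro v
    rw [Complex.norm_exp, Complex.neg_re, re_div_one_sub_mul_I]
  have hn0 : ‖Complex.exp (-X)‖ = Real.exp (-X) := by
    rw [Complex.norm_exp, Complex.neg_re, Complex.ofReal_re]
  rcases hX.eq_or_lt with rfl | hX0
  · simp
  rw [mul_min_of_nonneg _ _ (by norm_num : (0 : ℝ) ≤ 4), le_min_iff]
  constructor
  · by_cases h1 : X ≤ 1
    · have e1 : ∀ z : ℂ, ‖z‖ ≤ X → ‖Complex.exp z - 1‖ ≤ 2 * X := fun z hz =>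
        (Complex.norm_exp_sub_one_le (hz.trans h1)).trans (by linarith)
      have b1 : ‖-((X : ℂ) / (1 - u * I))‖ ≤ X := by
        rw [norm_neg, norm_div, norm_one_sub_mul_I, Complex.norm_real, Real.norm_of_nonneg hX]
        refine div_le_self hX ?_
        rw [Real.one_le_sqrt]
        nlinarith [sq_nonneg u]
      have b2 : ‖(-X : ℂ)‖ ≤ X := by
        rw [norm_neg, Complex.norm_real, Real.norm_of_nonneg hX]
      have := norm_sub_le (Complex.exp (-(X / (1 - u * I))) - 1) (Complex.exp (-X) - 1)
      rw [sub_sub_sub_cancel_right] at this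
      linarith [e1 _ b1, e1 _ b2]
    · refine (norm_sub_le _ _).trans ?_
      rw [hn, hn0]
      have h3 : Real.exp (-(X / (1 + u ^ 2))) ≤ 1 := Real.exp_le_one_iff.2 (by
        rw [neg_nonpos]; positivity)
      have h4 : Real.exp (-X) ≤ 1 := Real.exp_le_one_iff.2 (by linarith)
      linarith
  · refine (norm_sub_le _ _).trans ?_
    rw [hn, hn0]
    have h5 : ∀ y : ℝ, 0 < y → Real.exp (-y) ≤ 1 / y := by
      intro y hy
      rw [Real.exp_neg, ← one_div]
      exact one_div_le_one_div_of_le hy (by linarith [Real.add_one_le_exp y])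
    have h6 := h5 (X / (1 + u ^ 2)) (by positivity)
    have h7 : Real.exp (-X) ≤ Real.exp (-(X / (1 + u ^ 2))) := by
      apply Real.exp_le_exp.2
      apply neg_le_neg
      exact div_le_self hX (by nlinarith [sq_nonneg u])
    rw [one_div_div] at h6
    have : 0 ≤ (1 + u ^ 2) / X := by positivity
    linarith

/-- Comparison of the `d`-dimensional theta multiplier near `a / q` with the one of a Gaussian on
the lattice `q ℤ^d`. -/
theorem norm_prod_thetaMultiplier_sub_le {d : ℕ} (q : ℕ) [NeZero q] (a : ℤ)
    (ha : IsCoprime a (q : ℤ)) (u S : ℝ) (hS : q ^ 2 * max 1 (u ^ 2) ≤ S) (x : Fin d → ℝ) :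
    ‖∏ i, thetaMultiplier S (a / q + u / S) (x i) -
      (∏ i, majorCoeff q a u (x i)) * ∏ i, thetaMultiplier (S / q ^ 2) 0 (q * x i)‖ ≤
    majorBound q u ^ d * (2 * (d * thetaConst ^ d *
        (4 / (Real.pi * S / (2 * q ^ 2) / (1 + u ^ 2)) * intInvSqSum)) +
      4 * min (Real.pi * S / (2 * q ^ 2) * ∑ i, (round (q * x i) - q * x i) ^ 2)
        ((1 + u ^ 2) / (Real.pi * S / (2 * q ^ 2) * ∑ i, (round (q * x i) - q * x i) ^ 2))) := by
  have hq : (0 : ℝ) < q := by exact_mod_cast Nat.pos_of_ne_zero (NeZero.ne q)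
  have hS0 : 0 < S := pos_of_sq_mul_max_le hS
  have hρ := pi_div_four_le hS
  set σ : ℝ := Real.pi * S / (2 * q ^ 2) with hσ
  have hσ0 : 0 < σ := by positivity
  set ε : ℝ := 4 / (σ / (1 + u ^ 2)) * intInvSqSum with hε
  have hZ := intInvSqSum_nonneg
  have hε0 : 0 ≤ ε := by positivity
  have hD1 := one_le_thetaConst
  have hεD : 1 + ε ≤ thetaConst := by
    rw [thetaConst, hε]
    have : 4 / (σ / (1 + u ^ 2)) ≤ 4 / (Real.pi / 4) :=
      div_le_div_of_nonneg_left (by norm_num) (by positivity) hρ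
    have h2 : 4 / (Real.pi / 4) = 16 / Real.pi := by field_simp; norm_num
    rw [h2] at this
    have := mul_le_mul_of_nonneg_right this hZ
    rw [mul_div_right_comm]
    linarith
  set B := majorBound q u with hB
  have hB0 : 0 ≤ B := majorBound_nonneg q u
  set z : Fin d → ℝ := fun i => round (q * x i) - q * x i with hz
  set c : Fin d → ℂ := fun i => thetaFactor u / q * quadGaussSum q a (round (q * x i) : ℤ) with hc
  have hcB : ∀ i, ‖c i‖ ≤ B := by
    intro i
    rw [hc, hB, majorBound]
    simp only
    rw [norm_mul, norm_div, Complex.norm_natCast]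
    gcongr
    exact norm_quadGaussSum_le_sqrt q a ha _
  set E : Fin d → ℂ := fun i => Complex.exp (-(σ / (1 - u * I)) * (z i) ^ 2) with hE
  set E' : Fin d → ℂ := fun i => Complex.exp (-σ * (z i) ^ 2) with hE'
  have hE1 : ∀ i, ‖E i‖ ≤ 1 := by
    intro i
    rw [hE]
    simp only
    rw [norm_exp_neg_mul_ofReal_sq, re_div_one_sub_mul_I]
    apply Real.exp_le_one_iff.2
    rw [neg_nonpos]
    positivity
  have hE1' : ∀ i, ‖E' i‖ ≤ 1 := by
    intro i
    rw [hE']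
    simp only
    rw [norm_exp_neg_mul_ofReal_sq, Complex.ofReal_re]
    apply Real.exp_le_one_iff.2
    rw [neg_nonpos]
    positivity
  have hμ : ∀ i, ‖thetaMultiplier S (a / q + u / S) (x i) - c i * E i‖ ≤ B * ε := by
    intro i
    have h := norm_thetaMultiplier_sub_le hS0 q a u (x i) (norm_quadGaussSum_le_sqrt q a ha)
    have e : c i * E i = thetaFactor u / q * (quadGaussSum q a (round (q * x i) : ℤ) *
      Complex.exp (-((σ : ℝ) / (1 - u * I)) * (round (q * x i) - q * x i) ^ 2)) := by
      rw [hc, hE, hz]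
      push_cast
      ring
    rw [e]
    refine h.trans (le_of_eq ?_)
    rw [hB, hε, majorBound]
    ring
  have hν : ∀ i, ‖majorCoeff q a u (x i) * thetaMultiplier (S / q ^ 2) 0 (q * x i) - c i * E' i‖ ≤
      B * ε := by
    intro i
    have h := norm_thetaMultiplier_zero_sub_le (s := S / q ^ 2) (by positivity) (q * x i)
    have hs : Real.pi * (S / q ^ 2) / 2 = σ := by rw [hσ]; field_simp
    rw [hs] at h
    -- The division by `thetaFactor 0` in `majorCoeff` cancels the factor carried by the theta
    -- multiplier at `t = 0`, so both products have the same leading coefficients `c i`.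
    have e : majorCoeff q a u (x i) * thetaMultiplier (S / q ^ 2) 0 (q * x i) - c i * E' i =
        c i * (thetaFactor 0)⁻¹ * (thetaMultiplier (S / q ^ 2) 0 (q * x i) -
          thetaFactor 0 * Complex.exp (-(σ : ℝ) * (round (q * x i) - (q * x i : ℝ)) ^ 2)) := by
      have := thetaFactor_ne_zero 0
      rw [majorCoeff, hc, hE', hz]
      push_cast
      field_simp
    rw [e, norm_mul, norm_mul, norm_inv]
    have h0 : 0 < ‖thetaFactor 0‖ := norm_pos_iff.2 (thetaFactor_ne_zero 0)
    have hσρ : 4 / σ ≤ 4 / (σ / (1 + u ^ 2)) :=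
      div_le_div_of_nonneg_left (by norm_num) (by positivity)
        (div_le_self hσ0.le (by nlinarith [sq_nonneg u]))
    calc _ ≤ ‖c i‖ * ‖thetaFactor 0‖⁻¹ * (‖thetaFactor 0‖ * (4 / σ * intInvSqSum)) := by gcongr
      _ = ‖c i‖ * (4 / σ * intInvSqSum) := by field_simp
      _ ≤ B * ε := by
        rw [hε]
        gcongr
        exact hcB i
  have hB1 : B ≤ B * thetaConst := le_mul_of_one_le_right hB0 hD1
  have hp : ∀ (F : Fin d → ℂ), (∀ i, ‖F i‖ ≤ 1) → ∀ i, ‖c i * F i‖ ≤ B := by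
    intro F hF i
    rw [norm_mul]
    calc _ ≤ B * 1 := mul_le_mul (hcB i) (hF i) (norm_nonneg _) hB0
      _ = B := mul_one B
  -- Used twice: each multiplier is compared with its own nearest Gaussian, `E` with complex
  -- parameter and `E'` with real parameter.
  have hprod : ∀ (α F : Fin d → ℂ), (∀ i, ‖F i‖ ≤ 1) → (∀ i, ‖α i - c i * F i‖ ≤ B * ε) →
      ‖∏ i, α i - ∏ i, c i * F i‖ ≤ B ^ d * (d * thetaConst ^ d * ε) := by
    intro α F hF hα
    refine (norm_prod_sub_prod_le (R := B * thetaConst) (ε := ε) (by positivity) (fun i => ?_)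
      (fun i => (hp F hF i).trans hB1) fun i => (hα i).trans ?_).trans (le_of_eq ?_)
    · have := norm_le_norm_add_norm_sub' (α i) (c i * F i)
      calc _ ≤ _ := this
        _ ≤ B + B * ε := add_le_add (hp F hF i) (hα i)
        _ = B * (1 + ε) := by ring
        _ ≤ _ := by gcongr
    · gcongr
    · rw [mul_pow]; ring
  have h1 := hprod _ E hE1 hμ
  have h2 := hprod _ E' hE1' hν
  rw [Finset.prod_mul_distrib] at h2
  -- The two leading Gaussians differ only through `σ / (1 - u i)` against `σ`. This comparison
  -- takes place after multiplying over coordinates, where the exponents add up.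
  have h3 : ‖∏ i, c i * E i - ∏ i, c i * E' i‖ ≤
      B ^ d * (4 * min (σ * ∑ i, z i ^ 2) ((1 + u ^ 2) / (σ * ∑ i, z i ^ 2))) := by
    rw [Finset.prod_mul_distrib (f := c) (g := E), Finset.prod_mul_distrib (f := c) (g := E'),
      ← mul_sub, norm_mul]
    have e1 : ∏ i, E i = Complex.exp (-((σ * ∑ i, z i ^ 2 : ℝ) / (1 - u * I))) := by
      rw [hE, ← Complex.exp_sum, ← Finset.mul_sum]
      congr 1
      push_cast
      ring
    have e2 : ∏ i, E' i = Complex.exp (-((σ * ∑ i, z i ^ 2 : ℝ) : ℂ)) := by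
      rw [hE', ← Complex.exp_sum, ← Finset.mul_sum]
      congr 1
      push_cast
      ring
    rw [e1, e2]
    refine mul_le_mul ?_ (norm_exp_sub_exp_le u _ ?_) (norm_nonneg _) (by positivity)
    · rw [norm_prod]
      calc _ ≤ ∏ _i : Fin d, B := Finset.prod_le_prod (fun i _ => norm_nonneg _) fun i _ => hcB i
        _ = B ^ d := by simp
    · exact mul_nonneg hσ0.le (Finset.sum_nonneg fun i _ => sq_nonneg _)
  have h4 := norm_sub_le_norm_sub_add_norm_sub
    (∏ i, thetaMultiplier S (a / q + u / S) (x i)) (∏ i, c i * E i)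
    ((∏ i, majorCoeff q a u (x i)) * ∏ i, thetaMultiplier (S / q ^ 2) 0 (q * x i))
  have h5 := norm_sub_le_norm_sub_add_norm_sub (∏ i, c i * E i) (∏ i, c i * E' i)
    ((∏ i, majorCoeff q a u (x i)) * ∏ i, thetaMultiplier (S / q ^ 2) 0 (q * x i))
  rw [norm_sub_rev] at h2
  refine h4.trans ((add_le_add h1 (h5.trans (add_le_add h3 h2))).trans (le_of_eq ?_))
  ring

/-! ### Telescoping over the scales and domination by tents. -/

/-- A bounded increasing function on `[0, ∞)`, used for telescoping. -/
def cayley (c : ℝ) : ℝ := c / (1 + c)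

theorem cayley_sub_nonneg {c : ℝ} (hc : 0 ≤ c) : 0 ≤ cayley (16 * c) - cayley c := by
  rw [cayley, cayley, div_sub_div _ _ (by positivity) (by positivity)]
  apply div_nonneg _ (by positivity)
  nlinarith

/-- With `c = X² / A` the left side is at most `A min(c, 1/c)`, while the increment of `cayley` is
`15c / ((1 + 16c)(1 + c))`. Replacing `X` by `4 X` replaces `c` by `16 c`, so these increments
telescope along the scales `4 ^ j`. -/
theorem min_sq_le_cayley {X A : ℝ} (hX : 0 ≤ X) (hA : 0 < A) :
    min X (A / X) ^ 2 ≤ 3 * A * (cayley (16 * (X ^ 2 / A)) - cayley (X ^ 2 / A)) := by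
  rcases hX.eq_or_lt with rfl | hX0
  · simp
  have hmin : 0 ≤ min X (A / X) := le_min hX (by positivity)
  set c := X ^ 2 / A with hc
  have hc0 : 0 < c := by positivity
  have h1 : min X (A / X) ^ 2 ≤ A * c := by
    calc _ ≤ X ^ 2 := by gcongr; exact min_le_left _ _
      _ = _ := by rw [hc]; field_simp
  have h2 : min X (A / X) ^ 2 ≤ A * (1 / c) := by
    calc _ ≤ (A / X) ^ 2 := by gcongr; exact min_le_right _ _
      _ = _ := by rw [hc]; field_simp
  have h3 : cayley (16 * c) - cayley c = 15 * c / ((1 + 16 * c) * (1 + c)) := by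
    rw [cayley, cayley]
    field_simp
    ring
  rw [h3, mul_comm 3 A, mul_assoc]
  rcases le_total c 1 with h | h
  · refine h1.trans (mul_le_mul_of_nonneg_left ?_ hA.le)
    rw [← mul_div_assoc, le_div_iff₀ (by positivity)]
    nlinarith [mul_pos hc0 hc0, mul_le_mul_of_nonneg_left h hc0.le,
      mul_le_mul_of_nonneg_left h (mul_pos hc0 hc0).le]
  · refine h2.trans (mul_le_mul_of_nonneg_left ?_ hA.le)
    rw [← mul_div_assoc, div_le_div_iff₀ (by positivity) (by positivity)]
    nlinarith

theorem tsum_cayley_le {c : ℝ} (hc : 0 ≤ c) :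
    ∑' j : ℕ, ENNReal.ofReal (cayley (16 * (16 ^ j * c)) - cayley (16 ^ j * c)) ≤ 1 := by
  refine ENNReal.tsum_le_of_sum_range_le fun N => ?_
  rw [← ENNReal.ofReal_sum_of_nonneg fun j _ => cayley_sub_nonneg (by positivity),
    ENNReal.ofReal_le_one]
  have : ∀ j : ℕ, 16 * ((16 : ℝ) ^ j * c) = 16 ^ (j + 1) * c := fun j => by rw [pow_succ]; ring
  simp_rw [this]
  rw [Finset.sum_range_sub (fun j : ℕ => cayley (16 ^ j * c))]
  have h1 : cayley (16 ^ N * c) ≤ 1 := by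
    rw [cayley, div_le_one (by positivity)]
    linarith
  have h2 : 0 ≤ cayley (16 ^ 0 * c) := by rw [cayley]; positivity
  linarith

/-- The `d`-dimensional product of `thetaKernel`. -/
def thetaKernelPi {d : ℕ} (S t : ℝ) (m : Fin d → ℤ) : ℂ := ∏ i, thetaKernel S t (m i)

theorem summable_norm_thetaKernelPi {d : ℕ} {S : ℝ} (hS : 0 < S) (t : ℝ) :
    Summable fun m : Fin d → ℤ => ‖thetaKernelPi S t m‖ :=
  (hasSum_prod_fin fun _ => summable_norm_thetaKernel hS t).1

/-- The phase does not affect the norm, and `(r + y)² ≤ 2 r² (1 + y²/r²) ≤ 2 r² exp (2π y²/r²)` with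
`r = √s`. -/
theorem norm_thetaKernel_le_tent {s : ℝ} (hs : 0 < s) (t : ℝ) (m : ℤ) :
    ‖thetaKernel s t m‖ₑ ≤ 2 * tentKernel √s m := by
  rw [← ofReal_norm, norm_thetaKernel, tentKernel, show (2 : ℝ≥0∞) = ENNReal.ofReal 2 by simp,
    ← ENNReal.ofReal_mul (by norm_num)]
  apply ENNReal.ofReal_le_ofReal
  have hr : 0 < √s := Real.sqrt_pos.2 hs
  have hsr : s = √s ^ 2 := (Real.sq_sqrt hs.le).symm
  set r := √s
  rw [hsr, ← mul_div_assoc, inv_mul_eq_div, div_le_div_iff₀ hr (by positivity)]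
  set y := |(m : ℝ)| with hy
  have hy0 : 0 ≤ y := abs_nonneg _
  rw [← sq_abs (m : ℝ), ← hy]
  have h1 : (r + y) ^ 2 ≤ 2 * r ^ 2 * (1 + y ^ 2 / r ^ 2) := by
    have : 2 * r ^ 2 * (1 + y ^ 2 / r ^ 2) = 2 * (r ^ 2 + y ^ 2) := by field_simp
    rw [this]
    nlinarith [sq_nonneg (r - y)]
  have h2 : 1 + y ^ 2 / r ^ 2 ≤ Real.exp (2 * Real.pi * y ^ 2 / r ^ 2) := by
    refine le_trans ?_ (Real.add_one_le_exp _)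
    have : 0 ≤ y ^ 2 / r ^ 2 := by positivity
    have hpi := Real.pi_gt_three
    have e : 2 * Real.pi * y ^ 2 / r ^ 2 = 2 * Real.pi * (y ^ 2 / r ^ 2) := by ring
    rw [e]
    nlinarith
  rw [Real.exp_neg, inv_mul_eq_div, div_le_iff₀ (Real.exp_pos _)]
  calc _ ≤ 2 * r ^ 2 * (1 + y ^ 2 / r ^ 2) := h1
    _ ≤ 2 * r ^ 2 * Real.exp (2 * Real.pi * y ^ 2 / r ^ 2) := by gcongr
    _ = _ := by ring

theorem enorm_thetaKernelPi_le_tent {d : ℕ} {s : ℝ} (hs : 0 < s) (t : ℝ) (m : Fin d → ℤ) :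
    ‖thetaKernelPi s t m‖ₑ ≤ 2 ^ d * tentKernelPi √s m := by
  have : ‖thetaKernelPi s t m‖ₑ = ∏ i, ‖thetaKernel s t (m i)‖ₑ := by
    simp_rw [thetaKernelPi, ← ofReal_norm, norm_prod]
    exact ENNReal.ofReal_prod_of_nonneg fun _ _ => norm_nonneg _
  rw [this]
  calc _ ≤ ∏ i, 2 * tentKernel √s (m i) :=
        Finset.prod_le_prod' fun i _ => norm_thetaKernel_le_tent hs t _
    _ = _ := by
        rw [Finset.prod_mul_distrib, Finset.prod_const, Finset.card_univ, Fintype.card_fin]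
        rfl

theorem norm_majorCoeff_sq_le (q : ℕ) [NeZero q] {a : ℤ} (ha : IsCoprime a (q : ℤ)) (u x : ℝ) :
    ‖majorCoeff q a u x‖ ^ 2 ≤ 2 * majorBound q u ^ 2 := by
  have h0 : ‖thetaFactor 0‖ ^ 2 = 1 / 2 := by rw [norm_thetaFactor_sq]; simp
  rw [majorCoeff, norm_div, div_pow, h0, norm_mul, norm_div, Complex.norm_natCast, majorBound]
  have := norm_quadGaussSum_le_sqrt q a ha (round (q * x) : ℤ)
  have h2 : (‖thetaFactor u‖ / q * ‖quadGaussSum q a (round (q * x) : ℤ)‖) ^ 2 ≤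
    (‖thetaFactor u‖ / q * √(2 * q)) ^ 2 := by gcongr
  linarith

/-! ### The maximal inequality on a single arc. -/

section Fourier

open UnitAddTorus

attribute [local instance] instMeasureSpaceUnitAddCircle
attribute [local instance] instIsProbabilityMeasureUnitAddCircleVolume

/-- The representative in `(0, 1]` of a point of the circle. -/
def circleRep (t : UnitAddCircle) : ℝ := (AddCircle.equivIoc 1 0 t : ℝ)

theorem measurable_circleRep : Measurable circleRep :=
  measurable_subtype_coe.comp (AddCircle.measurableEquivIoc 1 0).measurable

theorem coe_circleRep (t : UnitAddCircle) : (circleRep t : UnitAddCircle) = t :=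
  (AddCircle.equivIoc 1 0).symm_apply_apply t

theorem fourier_eq_exp (n : ℤ) (t : UnitAddCircle) :
    fourier n t = Complex.exp (2 * Real.pi * I * n * circleRep t) := by
  conv_lhs => rw [← coe_circleRep t]
  rw [fourier_coe_apply]
  simp

theorem tsum_thetaKernelPi_mul_mFourier {d : ℕ} {S : ℝ} (hS : 0 < S) (t : ℝ) (q : ℤ)
    (ξ : UnitAddTorus (Fin d)) :
    ∑' m, thetaKernelPi S t m * mFourier (q • m) ξ =
      ∏ i, thetaMultiplier S t (q * circleRep (ξ i)) := by
  have h := (hasSum_prod_fin (d := d) (f := fun i k => thetaKernel S t k *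
    Complex.exp (2 * Real.pi * I * k * (q * circleRep (ξ i) : ℝ))) fun i => by
      refine (summable_norm_thetaKernel hS t).congr fun m => ?_
      rw [norm_mul, norm_exp_two_pi_I_mul, mul_one]).2
  rw [show ∏ i, thetaMultiplier S t (q * circleRep (ξ i)) = _ from h.tsum_eq.symm]
  refine tsum_congr fun m => ?_
  rw [Finset.prod_mul_distrib]
  congr 1
  simp only [mFourier, ContinuousMap.coe_mk, fourier_eq_exp]
  refine Finset.prod_congr rfl fun i _ => ?_
  congr 1
  push_cast
  simp
  ring

theorem continuous_tsum_mFourier {d : ℕ} {k : (Fin d → ℤ) → ℂ} (hk : Summable fun m => ‖k m‖)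
    (q : ℤ) : Continuous fun ξ : UnitAddTorus (Fin d) => ∑' m, k m * mFourier (q • m) ξ :=
  continuous_tsum (fun m => by fun_prop) hk fun m ξ => by
    rw [norm_mul, norm_mFourier_apply, mul_one]

theorem measurable_majorCoeff (q : ℕ) [NeZero q] (a : ℤ) (u : ℝ) :
    Measurable (majorCoeff q a u) := by
  have : Measurable fun x : ℝ => (round (q * x) : ℤ) := by
    simp_rw [round_eq]
    fun_prop
  unfold majorCoeff
  exact ((measurable_from_top (f := fun n : ℤ => quadGaussSum q a n)).comp this).const_mul _
    |>.div_const _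

/-- The difference of the multipliers compared in `norm_prod_thetaMultiplier_sub_le`, on the torus. -/
theorem tsum_enorm_multiplier_sub_sq_le (d : ℕ) : ∃ C : ℝ≥0, ∀ (q : ℕ) [NeZero q] (a : ℤ),
    IsCoprime a (q : ℤ) → ∀ (u : ℝ) (x : Fin d → ℝ),
    ∑' j : {j : ℕ // (q : ℝ) ^ 2 * max 1 (u ^ 2) ≤ 4 ^ j},
      ‖∏ i, thetaMultiplier (4 ^ (j : ℕ)) (a / q + u / 4 ^ (j : ℕ)) (x i) -
      (∏ i, majorCoeff q a u (x i)) * ∏ i, thetaMultiplier (4 ^ (j : ℕ) / q ^ 2) 0 (q * x i)‖ₑ ^ 2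
    ≤ C * ENNReal.ofReal ((majorBound q u ^ 2) ^ d * (1 + u ^ 2)) := by
  -- `1536 = 128 * 12` comes from the approximation errors, and `96 = 32 * 3` from the difference of
  -- the two Gaussians.
  set K : ℝ := 1536 * (d * thetaConst ^ d * intInvSqSum) ^ 2 with hK
  have hK0 : 0 ≤ K := by positivity
  refine ⟨(K + 96).toNNReal, fun q _ a ha u x => ?_⟩
  have hq : (0 : ℝ) < q := by exact_mod_cast Nat.pos_of_ne_zero (NeZero.ne q)
  set B := (majorBound q u ^ 2) ^ d with hB
  have hB0 : 0 ≤ B := by positivity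
  set A : ℝ := 1 + u ^ 2 with hA
  have hA1 : 1 ≤ A := by nlinarith [sq_nonneg u]
  set ρ : ℝ := Real.pi / (2 * q ^ 2) / A with hρ
  set Y : ℝ := Real.pi / (2 * q ^ 2) * ∑ i, (round (q * x i) - q * x i) ^ 2 with hY
  have hY0 : 0 ≤ Y := mul_nonneg (by positivity) (Finset.sum_nonneg fun i _ => sq_nonneg _)
  set w : ℝ → ℕ → ℝ := fun c j => cayley (16 * (16 ^ j * c)) - cayley (16 ^ j * c) with hw
  have hw0 : ∀ c, 0 ≤ c → ∀ j, 0 ≤ w c j := fun c hc j => cayley_sub_nonneg (by positivity)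
  have h16 : ∀ j : ℕ, ((4 : ℝ) ^ j) ^ 2 = 16 ^ j := by
    intro j
    rw [← pow_mul, mul_comm, pow_mul]
    norm_num
  have key : ∀ j : {j : ℕ // (q : ℝ) ^ 2 * max 1 (u ^ 2) ≤ 4 ^ j},
      ‖∏ i, thetaMultiplier (4 ^ (j : ℕ)) (a / q + u / 4 ^ (j : ℕ)) (x i) -
      (∏ i, majorCoeff q a u (x i)) * ∏ i, thetaMultiplier (4 ^ (j : ℕ) / q ^ 2) 0 (q * x i)‖ ^ 2 ≤
      B * A * (K * w (ρ ^ 2) j + 96 * w (Y ^ 2 / A) j) := by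
    rintro ⟨j, hj⟩
    have h := norm_prod_thetaMultiplier_sub_le q a ha u (4 ^ j) hj x
    have hρj := pi_div_four_le hj
    have e1 : Real.pi * 4 ^ j / (2 * q ^ 2) / (1 + u ^ 2) = 4 ^ j * ρ := by rw [hρ, hA]; ring
    have e2 : Real.pi * 4 ^ j / (2 * q ^ 2) * ∑ i, (round (q * x i) - q * x i) ^ 2 = 4 ^ j * Y := by
      rw [hY]; ring
    rw [e1, e2] at h
    rw [e1] at hρj
    set R : ℝ := 4 ^ j * ρ with hR
    have hR0 : 0 < R := lt_of_lt_of_le (by positivity) hρj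
    have h1 : (1 / R) ^ 2 ≤ 12 * w (ρ ^ 2) j := by
      have := min_sq_le_cayley hR0.le one_pos
      rw [div_one, hR, mul_pow, h16, ← hR] at this
      -- Since `R ≥ π / 4`, the one-sided error `1/R` is comparable to a two-sided minimum and
      -- telescopes in the same way.
      have h2 : 1 / R ≤ 2 * min R (1 / R) := by
        rw [mul_min_of_nonneg _ _ (by norm_num : (0 : ℝ) ≤ 2), le_min_iff]
        constructor
        · rw [div_le_iff₀ hR0]
          nlinarith [Real.pi_gt_three]
        · have : 0 < 1 / R := by positivity
          linarith
      calc (1 / R) ^ 2 ≤ (2 * min R (1 / R)) ^ 2 := by gcongr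
        _ = 4 * min R (1 / R) ^ 2 := by ring
        _ ≤ 4 * (3 * 1 * w (ρ ^ 2) j) := by gcongr
        _ = _ := by ring
    have h2 : min (4 ^ j * Y) (A / (4 ^ j * Y)) ^ 2 ≤ 3 * A * w (Y ^ 2 / A) j := by
      have := min_sq_le_cayley (X := 4 ^ j * Y) (by positivity) (A := A) (by positivity)
      rwa [mul_pow, h16, mul_div_assoc] at this
    have hm0 : 0 ≤ min (4 ^ j * Y) (A / (4 ^ j * Y)) := by positivity
    generalize min (4 ^ j * Y) (A / (4 ^ j * Y)) = mm at h h2 hm0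
    have hw1 := hw0 (ρ ^ 2) (by positivity) j
    calc _ ≤ (majorBound q u ^ d * (2 * (d * thetaConst ^ d * (4 / R * intInvSqSum)) +
            4 * mm)) ^ 2 := by gcongr
      _ = B * (8 * (d * thetaConst ^ d * intInvSqSum) * (1 / R) + 4 * mm) ^ 2 := by
          rw [hB]; ring
      _ ≤ B * (2 * ((8 * (d * thetaConst ^ d * intInvSqSum) * (1 / R)) ^ 2 + (4 * mm) ^ 2)) := by
          gcongr
          exact add_sq_le
      _ = B * (128 * (d * thetaConst ^ d * intInvSqSum) ^ 2 * (1 / R) ^ 2 + 32 * mm ^ 2) := by ring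
      _ ≤ B * (128 * (d * thetaConst ^ d * intInvSqSum) ^ 2 * (12 * w (ρ ^ 2) j) +
            32 * (3 * A * w (Y ^ 2 / A) j)) := by gcongr
      _ = B * (K * w (ρ ^ 2) j + 96 * A * w (Y ^ 2 / A) j) := by rw [hK]; ring
      _ ≤ B * (A * (K * w (ρ ^ 2) j) + 96 * A * w (Y ^ 2 / A) j) := by
          exact mul_le_mul_of_nonneg_left
            (add_le_add (le_mul_of_one_le_left (mul_nonneg hK0 hw1) hA1) le_rfl) hB0
      _ = _ := by ring
  calc _ ≤ ∑' j : {j : ℕ // (q : ℝ) ^ 2 * max 1 (u ^ 2) ≤ 4 ^ j}, ENNReal.ofReal (B * A) *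
        (ENNReal.ofReal K * ENNReal.ofReal (w (ρ ^ 2) j) +
          96 * ENNReal.ofReal (w (Y ^ 2 / A) j)) := by
        refine ENNReal.tsum_le_tsum fun j => ?_
        rw [← ofReal_norm, ← ENNReal.ofReal_pow (norm_nonneg _),
          show (96 : ℝ≥0∞) = ENNReal.ofReal 96 by simp, ← ENNReal.ofReal_mul hK0,
          ← ENNReal.ofReal_mul (by norm_num), ← ENNReal.ofReal_add (by
            have := hw0 (ρ ^ 2) (by positivity) j
            positivity) (by
            have := hw0 (Y ^ 2 / A) (by positivity) j
            positivity), ← ENNReal.ofReal_mul (by positivity)]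
        exact ENNReal.ofReal_le_ofReal (key j)
    _ ≤ ∑' j : ℕ, ENNReal.ofReal (B * A) *
        (ENNReal.ofReal K * ENNReal.ofReal (w (ρ ^ 2) j) +
          96 * ENNReal.ofReal (w (Y ^ 2 / A) j)) :=
        ENNReal.tsum_comp_le_tsum_of_injective Subtype.val_injective _
    _ = ENNReal.ofReal (B * A) * (ENNReal.ofReal K * ∑' j, ENNReal.ofReal (w (ρ ^ 2) j) +
          96 * ∑' j, ENNReal.ofReal (w (Y ^ 2 / A) j)) := by
        rw [ENNReal.tsum_mul_left, ENNReal.tsum_add, ENNReal.tsum_mul_left, ENNReal.tsum_mul_left]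
    _ ≤ ENNReal.ofReal (B * A) * (ENNReal.ofReal K * 1 + 96 * 1) := by
        gcongr
        · exact tsum_cayley_le (by positivity)
        · exact tsum_cayley_le (by positivity)
    _ = _ := by
        rw [mul_one, mul_one, show (96 : ℝ≥0∞) = ENNReal.ofReal 96 by simp,
          ← ENNReal.ofReal_add hK0 (by norm_num), mul_comm]
        rfl

end Fourier

theorem ENNReal.add_sq_le_two_mul (a b : ℝ≥0∞) : (a + b) ^ 2 ≤ 2 * (a ^ 2 + b ^ 2) := by
  rcases eq_or_ne a ∞ with rfl | ha
  · simp
  rcases eq_or_ne b ∞ with rfl | hb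
  · simp
  lift a to ℝ≥0 using ha
  lift b to ℝ≥0 using hb
  have h : ((a : ℝ) + b) ^ 2 ≤ 2 * ((a : ℝ) ^ 2 + (b : ℝ) ^ 2) := add_sq_le
  exact_mod_cast h

section Fourier

open UnitAddTorus

attribute [local instance] instMeasureSpaceUnitAddCircle
attribute [local instance] instIsProbabilityMeasureUnitAddCircleVolume

theorem lintegral_enorm_mul_sq_le {d : ℕ} {g F : UnitAddTorus (Fin d) → ℂ} {C : ℝ≥0∞}
    (hg : ∀ ξ, ‖g ξ‖ₑ ^ 2 ≤ C) (hF : Measurable F) :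
    ∫⁻ ξ, ‖g ξ * F ξ‖ₑ ^ 2 ≤ C * ∫⁻ ξ, ‖F ξ‖ₑ ^ 2 := by
  rw [← lintegral_const_mul _ (by fun_prop)]
  refine lintegral_mono fun ξ => ?_
  rw [enorm_mul, mul_pow]
  exact mul_le_mul' (hg ξ) le_rfl

/-- The maximal inequality for the theta kernels near a fixed rational `a / q`. -/
theorem tsum_iSup_thetaKernelPi_sq_le (d : ℕ) : ∃ C : ℝ≥0, ∀ (q : ℕ) [NeZero q] (a : ℤ),
    IsCoprime a (q : ℤ) → ∀ (u : ℝ) (s : Finset (Fin d → ℤ)) (f : (Fin d → ℤ) → ℂ),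
    (∀ n ∉ s, f n = 0) →
    ∑' x, (⨆ j : {j : ℕ // (q : ℝ) ^ 2 * max 1 (u ^ 2) ≤ 4 ^ j},
      ‖∑' m, thetaKernelPi (4 ^ (j : ℕ)) (a / q + u / 4 ^ (j : ℕ)) m * f (x - m)‖ₑ) ^ 2
    ≤ C * ENNReal.ofReal ((majorBound q u ^ 2) ^ d * (1 + u ^ 2)) * ∑' x, ‖f x‖ₑ ^ 2 := by
  obtain ⟨C₁, hC₁⟩ := tsum_enorm_multiplier_sub_sq_le d
  refine ⟨2 * (C₁ + (2 ^ d) ^ 2 * (4 * ((2 * 96 ^ d) ^ 2 * 2 ^ d))), fun q _ a ha u s f hf => ?_⟩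
  have hq : (0 : ℝ) < q := by exact_mod_cast Nat.pos_of_ne_zero (NeZero.ne q)
  set B : ℝ := (majorBound q u ^ 2) ^ d with hB
  have hB0 : 0 ≤ B := by positivity
  set ι := {j : ℕ // (q : ℝ) ^ 2 * max 1 (u ^ 2) ≤ 4 ^ j} with hι
  set F : UnitAddTorus (Fin d) → ℂ := fun ξ => ∑ n ∈ s, f n * mFourier n ξ with hF
  have hFc : Continuous F := by fun_prop
  have hFm : Measurable F := hFc.measurable
  have hFb : ∀ ξ, ‖F ξ‖ ≤ ∑ n ∈ s, ‖f n‖ := fun ξ => (norm_sum_le _ _).trans_eq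
    (Finset.sum_congr rfl fun n _ => by rw [norm_mul, norm_mFourier_apply, mul_one])
  have hFcoeff : ∀ x, mFourierCoeff F x = f x := mFourierCoeff_sum s f hf
  have hFl2 : ∫⁻ ξ, ‖F ξ‖ₑ ^ 2 = ∑' x, ‖f x‖ₑ ^ 2 := by
    rw [← tsum_enorm_mFourierCoeff_sq hFm hFb]
    simp_rw [hFcoeff]
  have hbint : ∀ {g : UnitAddTorus (Fin d) → ℂ} {b : ℝ}, Measurable g → (∀ ξ, ‖g ξ‖ ≤ b) →
      Integrable g := fun hg hb =>
    Integrable.of_bound hg.aestronglyMeasurable _ (Filter.Eventually.of_forall hb)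
  -- the multiplier of the coefficients of the major arc
  set M : UnitAddTorus (Fin d) → ℂ := fun ξ => ∏ i, majorCoeff q a u (circleRep (ξ i)) with hM
  have hMm : Measurable M := by
    refine Finset.measurable_prod _ fun i _ => ?_
    exact (measurable_majorCoeff q a u).comp (measurable_circleRep.comp (measurable_pi_apply i))
  have hMsq : ∀ ξ, ‖M ξ‖ ^ 2 ≤ 2 ^ d * B := by
    intro ξ
    rw [hM]
    simp only
    rw [norm_prod, ← Finset.prod_pow]
    calc _ ≤ ∏ _i : Fin d, 2 * majorBound q u ^ 2 :=
          Finset.prod_le_prod (fun i _ => by positivity) fun i _ => norm_majorCoeff_sq_le q ha u _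
      _ = _ := by rw [Finset.prod_const, Finset.card_univ, Fintype.card_fin, mul_pow]
  have hMb : ∀ ξ, ‖M ξ‖ ≤ √(2 ^ d * B) := fun ξ => Real.le_sqrt_of_sq_le (hMsq ξ)
  have hMFm : Measurable fun ξ => M ξ * F ξ := hMm.mul hFm
  have hMFb : ∀ ξ, ‖M ξ * F ξ‖ ≤ √(2 ^ d * B) * ∑ n ∈ s, ‖f n‖ := fun ξ => by
    rw [norm_mul]
    exact mul_le_mul (hMb ξ) (hFb ξ) (norm_nonneg _) (Real.sqrt_nonneg _)
  -- The multiplier `M` does not depend on `j`, so it can be applied to `f` once, before the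
  -- supremum. Its `ℓ²` cost is the bound on `‖M‖²`.
  set G : (Fin d → ℤ) → ℂ := mFourierCoeff fun ξ => M ξ * F ξ with hG
  have hGl2 : ∑' x, ‖G x‖ₑ ^ 2 ≤ ENNReal.ofReal (2 ^ d * B) * ∑' x, ‖f x‖ₑ ^ 2 := by
    rw [hG, tsum_enorm_mFourierCoeff_sq hMFm hMFb, ← hFl2]
    refine lintegral_enorm_mul_sq_le (fun ξ => ?_) hFm
    rw [← ofReal_norm, ← ENNReal.ofReal_pow (norm_nonneg _)]
    exact ENNReal.ofReal_le_ofReal (hMsq ξ)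
  have hpos : ∀ j : ι, (0 : ℝ) < 4 ^ (j : ℕ) := fun j => by positivity
  have hpos' : ∀ j : ι, (0 : ℝ) < 4 ^ (j : ℕ) / q ^ 2 := fun j => by positivity
  set t : ι → ℝ := fun j => a / q + u / 4 ^ (j : ℕ) with ht
  set K : ι → UnitAddTorus (Fin d) → ℂ := fun j ξ =>
    ∑' m, thetaKernelPi (4 ^ (j : ℕ)) (t j) m * mFourier ((1 : ℤ) • m) ξ with hK
  set H : ι → UnitAddTorus (Fin d) → ℂ := fun j ξ =>
    ∑' m, thetaKernelPi (4 ^ (j : ℕ) / q ^ 2) 0 m * mFourier ((q : ℤ) • m) ξ with hH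
  have hKc : ∀ j, Continuous (K j) := fun j =>
    continuous_tsum_mFourier (summable_norm_thetaKernelPi (hpos j) _) 1
  have hHc : ∀ j, Continuous (H j) := fun j =>
    continuous_tsum_mFourier (summable_norm_thetaKernelPi (hpos' j) _) q
  have hbdd : ∀ {g : UnitAddTorus (Fin d) → ℂ}, Continuous g → ∃ b, ∀ ξ, ‖g ξ‖ ≤ b := fun hg => by
    obtain ⟨b, hb⟩ := isCompact_univ.exists_bound_of_continuousOn hg.continuousOn
    exact ⟨b, fun ξ => hb ξ (Set.mem_univ ξ)⟩
  set Δ : ι → UnitAddTorus (Fin d) → ℂ := fun j ξ => K j ξ - M ξ * H j ξ with hΔ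
  have hΔm : ∀ j, Measurable (Δ j) := fun j =>
    (hKc j).measurable.sub (hMm.mul (hHc j).measurable)
  have hΔsum : ∀ ξ, ∑' j, ‖Δ j ξ‖ₑ ^ 2 ≤ C₁ * ENNReal.ofReal (B * (1 + u ^ 2)) := by
    intro ξ
    refine le_trans (le_of_eq (tsum_congr fun j => ?_)) (hC₁ q a ha u fun i => circleRep (ξ i))
    rw [hΔ, hK, hH]
    simp only
    rw [tsum_thetaKernelPi_mul_mFourier (hpos j), tsum_thetaKernelPi_mul_mFourier (hpos' j)]
    simp [ht, hM]
  -- the decomposition of the convolution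
  have hdecomp : ∀ (j : ι) (x : Fin d → ℤ), ∑' m, thetaKernelPi (4 ^ (j : ℕ)) (t j) m * f (x - m) =
      mFourierCoeff (fun ξ => Δ j ξ * F ξ) x +
        ∑' m, thetaKernelPi (4 ^ (j : ℕ) / q ^ 2) 0 m * G (x - (q : ℤ) • m) := by
    intro j x
    have h1 := (hasSum_mul_mFourierCoeff (summable_norm_thetaKernelPi (d := d) (hpos j) (t j))
      (hbint hFm hFb) 1 x).tsum_eq
    have h2 := (hasSum_mul_mFourierCoeff (summable_norm_thetaKernelPi (d := d) (hpos' j) 0)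
      (hbint hMFm hMFb) q x).tsum_eq
    simp only [hFcoeff, one_smul] at h1
    rw [h1, h2]
    simp only [mFourierCoeff]
    rw [← integral_add]
    · refine integral_congr_ae (Filter.Eventually.of_forall fun ξ => ?_)
      simp only [hΔ, hK, hH, one_smul, smul_eq_mul]
      ring
    · obtain ⟨b₁, hb₁⟩ := hbdd (hKc j)
      obtain ⟨b₂, hb₂⟩ := hbdd (hHc j)
      refine hbint (b := (b₁ + √(2 ^ d * B) * b₂) * ∑ n ∈ s, ‖f n‖) (by fun_prop) fun ξ => ?_
      rw [norm_smul, norm_mFourier_apply, one_mul, norm_mul]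
      have hs0 : 0 ≤ √(2 ^ d * B) := Real.sqrt_nonneg _
      refine mul_le_mul ((norm_sub_le _ _).trans (add_le_add (hb₁ ξ) ?_)) (hFb ξ) (norm_nonneg _) ?_
      · rw [norm_mul]
        exact mul_le_mul (hMb ξ) (hb₂ ξ) (norm_nonneg _) hs0
      · have h3 := (norm_nonneg _).trans (hb₁ ξ)
        have h4 := (norm_nonneg _).trans (hb₂ ξ)
        positivity
    · obtain ⟨b₂, hb₂⟩ := hbdd (hHc j)
      have hm : Measurable (H j) := (hHc j).measurable
      refine hbint (b := b₂ * (√(2 ^ d * B) * ∑ n ∈ s, ‖f n‖)) (by fun_prop) fun ξ => ?_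
      rw [norm_smul, norm_mFourier_apply, one_mul, norm_mul]
      exact mul_le_mul (hb₂ ξ) (hMFb ξ) (norm_nonneg _) ((norm_nonneg _).trans (hb₂ ξ))
  set V : (Fin d → ℤ) → ℝ≥0∞ := fun x => ⨆ j : ι, ∑' m,
    tentKernelPi √(4 ^ (j : ℕ) / q ^ 2) m * ‖G (x - (q : ℤ) • m)‖ₑ with hV
  -- The tents must have width at least 1, that is `q² ≤ 4 ^ j`; the arc condition contains this.
  have hVl2 : ∑' x, V x ^ 2 ≤ 4 * ((2 * 96 ^ d) ^ 2 * ∑' y, ‖G y‖ₑ ^ 2) := by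
    refine tsum_iSup_tentKernelPi_smul_sq_le q (fun j => ?_) fun y => ‖G y‖ₑ
    rw [Real.one_le_sqrt, one_le_div (by positivity)]
    refine le_trans ?_ j.2
    exact le_mul_of_one_le_right (by positivity) (le_max_left _ _)
  -- The positive part keeps its supremum. The error `Δ j` has no positivity, and its supremum is
  -- replaced by the `ℓ²` sum over all scales.
  have hpt : ∀ x, (⨆ j : ι, ‖∑' m, thetaKernelPi (4 ^ (j : ℕ)) (t j) m * f (x - m)‖ₑ) ^ 2 ≤
      2 * ((∑' j, ‖mFourierCoeff (fun ξ => Δ j ξ * F ξ) x‖ₑ ^ 2) + (2 ^ d) ^ 2 * V x ^ 2) := by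
    intro x
    rw [ENNReal.iSup_pow_of_ne_zero two_ne_zero]
    refine iSup_le fun j => ?_
    rw [hdecomp]
    have h1 : ‖∑' m, thetaKernelPi (4 ^ (j : ℕ) / q ^ 2) 0 m * G (x - (q : ℤ) • m)‖ₑ ≤
        2 ^ d * V x := by
      refine enorm_tsum_le_tsum_enorm.trans ?_
      calc _ ≤ ∑' m, 2 ^ d * (tentKernelPi √(4 ^ (j : ℕ) / q ^ 2) m *
            ‖G (x - (q : ℤ) • m)‖ₑ) := by
            refine ENNReal.tsum_le_tsum fun m => ?_
            rw [enorm_mul, ← mul_assoc]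
            exact mul_le_mul' (enorm_thetaKernelPi_le_tent (hpos' j) _ _) le_rfl
        _ ≤ _ := by
            rw [ENNReal.tsum_mul_left]
            gcongr
            exact le_iSup (fun j : ι => ∑' m,
              tentKernelPi √(4 ^ (j : ℕ) / q ^ 2) m * ‖G (x - (q : ℤ) • m)‖ₑ) j
    calc _ ≤ (‖mFourierCoeff (fun ξ => Δ j ξ * F ξ) x‖ₑ + 2 ^ d * V x) ^ 2 := by
          gcongr
          exact (enorm_add_le _ _).trans (add_le_add le_rfl h1)
      _ ≤ 2 * (‖mFourierCoeff (fun ξ => Δ j ξ * F ξ) x‖ₑ ^ 2 + (2 ^ d * V x) ^ 2) :=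
          ENNReal.add_sq_le_two_mul _ _
      _ ≤ _ := by
          rw [mul_pow]
          gcongr
          exact ENNReal.le_tsum (f := fun j => ‖mFourierCoeff (fun ξ => Δ j ξ * F ξ) x‖ₑ ^ 2) j
  have hΔl2 : ∑' x, ∑' j, ‖mFourierCoeff (fun ξ => Δ j ξ * F ξ) x‖ₑ ^ 2 ≤
      C₁ * ENNReal.ofReal (B * (1 + u ^ 2)) * ∑' x, ‖f x‖ₑ ^ 2 := by
    rw [ENNReal.tsum_comm]
    have h1 : ∀ j, ∑' x, ‖mFourierCoeff (fun ξ => Δ j ξ * F ξ) x‖ₑ ^ 2 =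
        ∫⁻ ξ, ‖Δ j ξ * F ξ‖ₑ ^ 2 := by
      intro j
      obtain ⟨b₁, hb₁⟩ := hbdd (hKc j)
      obtain ⟨b₂, hb₂⟩ := hbdd (hHc j)
      refine tsum_enorm_mFourierCoeff_sq (B := (b₁ + √(2 ^ d * B) * b₂) * ∑ n ∈ s, ‖f n‖)
        ((hΔm j).mul hFm) fun ξ => ?_
      have hs0 : 0 ≤ √(2 ^ d * B) := Real.sqrt_nonneg _
      rw [norm_mul]
      refine mul_le_mul ((norm_sub_le _ _).trans (add_le_add (hb₁ ξ) ?_)) (hFb ξ) (norm_nonneg _) ?_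
      · rw [norm_mul]
        exact mul_le_mul (hMb ξ) (hb₂ ξ) (norm_nonneg _) hs0
      · have h3 := (norm_nonneg _).trans (hb₁ ξ)
        have h4 := (norm_nonneg _).trans (hb₂ ξ)
        positivity
    simp_rw [h1]
    rw [← lintegral_tsum fun j => by
      have := hΔm j
      fun_prop, ← hFl2, ← lintegral_const_mul _ (by fun_prop)]
    refine lintegral_mono fun ξ => ?_
    simp_rw [enorm_mul, mul_pow]
    rw [ENNReal.tsum_mul_right]
    exact mul_le_mul' (hΔsum ξ) le_rfl
  calc _ ≤ ∑' x, 2 * ((∑' j, ‖mFourierCoeff (fun ξ => Δ j ξ * F ξ) x‖ₑ ^ 2) +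
          (2 ^ d) ^ 2 * V x ^ 2) := ENNReal.tsum_le_tsum hpt
    _ = 2 * ((∑' x, ∑' j, ‖mFourierCoeff (fun ξ => Δ j ξ * F ξ) x‖ₑ ^ 2) +
          (2 ^ d) ^ 2 * ∑' x, V x ^ 2) := by
        rw [ENNReal.tsum_mul_left, ENNReal.tsum_add, ENNReal.tsum_mul_left]
    _ ≤ 2 * (C₁ * ENNReal.ofReal (B * (1 + u ^ 2)) * ∑' x, ‖f x‖ₑ ^ 2 +
          (2 ^ d) ^ 2 * (4 * ((2 * 96 ^ d) ^ 2 *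
            (2 ^ d * ENNReal.ofReal (B * (1 + u ^ 2)) * ∑' x, ‖f x‖ₑ ^ 2)))) := by
        gcongr
        refine hVl2.trans ?_
        gcongr
        refine hGl2.trans ?_
        gcongr
        rw [ENNReal.ofReal_mul (by positivity), ENNReal.ofReal_pow (by norm_num),
          ENNReal.ofReal_ofNat]
        gcongr
        exact le_mul_of_one_le_right hB0 (by nlinarith [sq_nonneg u])
    _ = _ := by
        push_cast
        ring

end Fourier

/-! ### Dirichlet arcs and summation over all of them. -/

theorem lintegral_comp_add_div {g : ℝ → ℝ≥0∞} (hg : Measurable g) (r : ℝ) {S : ℝ} (hS : 0 < S) :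
    ∫⁻ u, g (r + u / S) = ENNReal.ofReal S * ∫⁻ t, g t := by
  have h1 : ∫⁻ u, g (r + u / S) =
      ∫⁻ t, g (r + t) ∂(Measure.map (fun x => S⁻¹ * x) volume) := by
    rw [lintegral_map (by fun_prop) (by fun_prop)]
    simp_rw [div_eq_inv_mul]
  rw [h1, Real.map_volume_mul_left (inv_ne_zero hS.ne'), lintegral_smul_measure,
    lintegral_add_left_eq_self (fun t => g t) r, inv_inv, abs_of_pos hS]
  rfl

/-- Dirichlet's theorem with bound `⌊√S⌋` on the denominator `q` gives `q ≤ √S` and `|t - r| ≤ 1 /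
(√S q)`, which are the two halves of the maximum. Moreover `|t| ≤ 1` and `|t - r| ≤ 1/(2q)` force
the numerator below `q + 1` in absolute value, hence `|r| ≤ 1`. -/
theorem exists_rat_den_sq_mul_le {S : ℝ} (hS : 1 ≤ S) {t : ℝ} (ht : t ∈ Set.Icc (-1 : ℝ) 1) :
    ∃ r : ℚ, |r| ≤ 1 ∧ (r.den : ℝ) ^ 2 * max 1 ((S * (t - r)) ^ 2) ≤ S := by
  have hsq : 1 ≤ √S := Real.one_le_sqrt.2 hS
  have hsq2 : √S ^ 2 = S := Real.sq_sqrt (by linarith)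
  have hN : 0 < ⌊√S⌋₊ := Nat.floor_pos.2 hsq
  obtain ⟨r, hr, hden⟩ := Real.exists_rat_abs_sub_le_and_den_le t hN
  have hdpos : (0 : ℝ) < r.den := by exact_mod_cast r.pos
  have hden' : (r.den : ℝ) ≤ √S := (Nat.cast_le.2 hden).trans (Nat.floor_le (by linarith))
  have hfl : √S ≤ (⌊√S⌋₊ : ℝ) + 1 := (Nat.lt_floor_add_one _).le
  have hN1 : (1 : ℝ) ≤ ⌊√S⌋₊ := by exact_mod_cast hN
  refine ⟨r, ?_, ?_⟩
  · have h1 : |t - r| ≤ 1 / (2 * r.den) := by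
      refine hr.trans (one_div_le_one_div_of_le (by positivity) ?_)
      gcongr
      linarith
    have h2 : |(r : ℝ)| ≤ 1 + 1 / (2 * r.den) := by
      have h3 : |t| ≤ 1 := abs_le.2 ht
      have h4 : |(r : ℝ)| ≤ |t| + |t - r| := by
        have := abs_sub t (t - r)
        rwa [sub_sub_cancel] at this
      linarith
    have h5 : |(r : ℝ)| * r.den = (r.num.natAbs : ℝ) := by
      have : (r : ℝ) * r.den = r.num := by exact_mod_cast Rat.mul_den_eq_num r
      rw [← abs_of_pos hdpos, ← abs_mul, this, Nat.cast_natAbs, Int.cast_abs]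
    have h6 : (r.num.natAbs : ℝ) < r.den + 1 := by
      rw [← h5]
      have := mul_le_mul_of_nonneg_right h2 hdpos.le
      have e : (1 + 1 / (2 * (r.den : ℝ))) * r.den = r.den + 1 / 2 := by field_simp
      linarith
    have h7 : r.num.natAbs ≤ r.den := by
      have : r.num.natAbs < r.den + 1 := by exact_mod_cast h6
      omega
    have h8 : |(r : ℝ)| ≤ 1 := by
      have : (r.num.natAbs : ℝ) ≤ r.den := by exact_mod_cast h7
      rw [← h5] at this
      nlinarith
    exact_mod_cast h8
  · rw [mul_max_of_nonneg _ _ (by positivity), max_le_iff]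
    constructor
    · rw [mul_one]
      nlinarith
    · have h1 : |t - r| * (√S * r.den) ≤ 1 := by
        have := hr.trans (one_div_le_one_div_of_le (b := (⌊√S⌋₊ + 1) * (r.den : ℝ))
          (a := √S * r.den) (by positivity) (by gcongr))
        rwa [le_div_iff₀ (by positivity)] at this
      have h2 : (|t - r| * (√S * r.den)) ^ 2 ≤ 1 := by
        have : 0 ≤ |t - r| * (√S * r.den) := by positivity
        nlinarith
      rw [mul_pow, mul_pow, sq_abs, hsq2] at h2
      calc (r.den : ℝ) ^ 2 * (S * (t - r)) ^ 2 = S * ((t - r) ^ 2 * (S * r.den ^ 2)) := by ring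
        _ ≤ S * 1 := by gcongr
        _ = S := mul_one S

/-- Covering of the circle by arcs around rationals, by Dirichlet's approximation theorem. -/
theorem lintegral_le_tsum_arcs {S : ℝ} (hS : 1 ≤ S) {φ : ℝ → ℝ≥0∞} (hφ : Measurable φ) :
    ENNReal.ofReal S * ∫⁻ t in Set.Icc (-1 : ℝ) 1, φ t ≤
      ∑' r : ℚ, ∫⁻ u, {u : ℝ | |r| ≤ 1 ∧ (r.den : ℝ) ^ 2 * max 1 (u ^ 2) ≤ S}.indicator
        (fun u => φ (r + u / S)) u := by
  have hS0 : 0 < S := by linarith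
  set E : ℚ → Set ℝ := fun r => {u : ℝ | |r| ≤ 1 ∧ (r.den : ℝ) ^ 2 * max 1 (u ^ 2) ≤ S} with hE
  have hEm : ∀ r, MeasurableSet (E r) := fun r =>
    (MeasurableSet.const (|r| ≤ 1)).inter (measurableSet_le
      (f := fun u : ℝ => (r.den : ℝ) ^ 2 * max 1 (u ^ 2)) (by fun_prop) measurable_const)
  set g : ℚ → ℝ → ℝ≥0∞ := fun r t => (E r).indicator 1 (S * (t - r)) * φ t with hg
  have hgm : ∀ r, Measurable (g r) := fun r =>
    ((measurable_const.indicator (hEm r)).comp (by fun_prop)).mul hφ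
  have h1 : ∀ r : ℚ, ∫⁻ u, (E r).indicator (fun u => φ (r + u / S)) u =
      ENNReal.ofReal S * ∫⁻ t, g r t := by
    intro r
    rw [← lintegral_comp_add_div (hgm r) r hS0]
    refine lintegral_congr fun u => ?_
    have : S * ((r + u / S) - r) = u := by field_simp; ring
    change _ = (E r).indicator 1 (S * ((r + u / S) - r)) * φ (r + u / S)
    rw [this]
    by_cases hu : u ∈ E r <;> simp [hu]
  rw [tsum_congr h1, ENNReal.tsum_mul_left]
  gcongr
  rw [← lintegral_tsum fun r => (hgm r).aemeasurable, ← lintegral_indicator measurableSet_Icc]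
  refine lintegral_mono fun t => ?_
  by_cases ht : t ∈ Set.Icc (-1 : ℝ) 1
  -- The arcs may overlap: with nonnegative integrands it is enough that each point lies in one of
  -- them.
  · obtain ⟨r, hr⟩ := exists_rat_den_sq_mul_le hS ht
    rw [Set.indicator_of_mem ht]
    refine le_trans ?_ (ENNReal.le_tsum r)
    have : S * (t - r) ∈ E r := hr
    rw [hg]
    simp [this]
  · rw [Set.indicator_of_notMem ht]
    exact zero_le

/-- A square root of the weight of the arc around the rational `r`, in terms of the rescaled
distance `u` to `r`. -/
def arcWeightSqrt (r : ℚ) (u : ℝ) : ℝ :=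
  (r.den : ℝ) ^ (-(5 / 4) : ℝ) * (1 + u ^ 2) ^ (-(3 / 8) : ℝ)

theorem arcWeightSqrt_pos (r : ℚ) (u : ℝ) : 0 < arcWeightSqrt r u := by
  have : (0 : ℝ) < r.den := by exact_mod_cast r.pos
  rw [arcWeightSqrt]
  positivity

theorem measurable_arcWeightSqrt (r : ℚ) : Measurable (arcWeightSqrt r) := by
  unfold arcWeightSqrt
  fun_prop

theorem arcWeightSqrt_sq (r : ℚ) (u : ℝ) : arcWeightSqrt r u ^ 2 =
    (r.den : ℝ) ^ (-(5 / 2) : ℝ) * (1 + u ^ 2) ^ (-(3 / 4) : ℝ) := by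
  have h1 : (0 : ℝ) < r.den := by exact_mod_cast r.pos
  rw [arcWeightSqrt, mul_pow, ← Real.rpow_natCast, ← Real.rpow_natCast, ← Real.rpow_mul h1.le,
    ← Real.rpow_mul (by positivity)]
  norm_num

/-- The exponents of `arcWeightSqrt` are chosen so that its fourth power is the squared operator
bound on the arc when `d = 5`. Its square is then both the operator bound and a weight of finite
total mass. -/
theorem arcWeightSqrt_pow_four (r : ℚ) (u : ℝ) : arcWeightSqrt r u ^ 4 =
    ((r.den * √(1 + u ^ 2)) ^ 5)⁻¹ * (1 + u ^ 2) := by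
  have h1 : (0 : ℝ) < r.den := by exact_mod_cast r.pos
  have h2 : (0 : ℝ) < 1 + u ^ 2 := by positivity
  have h3 : (1 + u ^ 2) ^ (-(3 / 2) : ℝ) = (√(1 + u ^ 2) ^ 5)⁻¹ * (1 + u ^ 2) := by
    generalize 1 + u ^ 2 = y at h2
    rw [Real.sqrt_eq_rpow, ← Real.rpow_natCast, ← Real.rpow_mul h2.le, ← Real.rpow_neg h2.le]
    nth_rw 3 [← Real.rpow_one y]
    rw [← Real.rpow_add h2]
    norm_num
  rw [arcWeightSqrt, mul_pow, ← Real.rpow_natCast, ← Real.rpow_natCast, ← Real.rpow_mul h1.le,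
    ← Real.rpow_mul h2.le, mul_pow, mul_inv, mul_assoc,
    show -(3 / 8) * ((4 : ℕ) : ℝ) = -(3 / 2) by norm_num, h3,
    show -(5 / 4) * ((4 : ℕ) : ℝ) = -((5 : ℕ) : ℝ) by norm_num, Real.rpow_neg h1.le,
    Real.rpow_natCast]

theorem summable_two_mul_add_one_rpow :
    Summable fun q : ℕ => (2 * q + 1 : ℝ) * (q : ℝ) ^ (-(5 / 2) : ℝ) := by
  have h : Summable fun q : ℕ => 3 * (q : ℝ) ^ (-(3 / 2) : ℝ) :=
    (Real.summable_nat_rpow.2 (by norm_num)).mul_left 3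
  refine Summable.of_nonneg_of_le (fun q => by positivity) (fun q => ?_) h
  rcases Nat.eq_zero_or_pos q with rfl | hq
  · norm_num [Real.zero_rpow]
  · have hq1 : (1 : ℝ) ≤ q := by exact_mod_cast hq
    have : (q : ℝ) ^ (-(3 / 2) : ℝ) = q * (q : ℝ) ^ (-(5 / 2) : ℝ) := by
      nth_rw 2 [← Real.rpow_one (q : ℝ)]
      rw [← Real.rpow_add (by linarith)]
      norm_num
    rw [this, ← mul_assoc]
    gcongr
    linarith

/-- At most `2 q + 1` fractions in `[-1, 1]` have denominator `q`, and the sum of `(2 q + 1) q ^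
(-5/2)` converges. The pairs `(q, a)` need not be coprime for an upper bound. -/
theorem tsum_rat_den_rpow_ne_top :
    ∑' r : ℚ, (if |r| ≤ 1 then ENNReal.ofReal ((r.den : ℝ) ^ (-(5 / 2) : ℝ)) else 0) ≠ ∞ := by
  set F : ℕ × ℤ → ℝ≥0∞ := fun p =>
    if |p.2| ≤ p.1 then ENNReal.ofReal ((p.1 : ℝ) ^ (-(5 / 2) : ℝ)) else 0 with hF
  have hinj : Function.Injective fun r : ℚ => (r.den, r.num) := fun r s h => by
    simp only [Prod.mk.injEq] at h
    exact Rat.ext h.2 h.1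
  have h1 : ∑' r : ℚ, (if |r| ≤ 1 then ENNReal.ofReal ((r.den : ℝ) ^ (-(5 / 2) : ℝ)) else 0) ≤
      ∑' p, F p := by
    refine le_trans (ENNReal.tsum_le_tsum fun r => ?_)
      (ENNReal.tsum_comp_le_tsum_of_injective hinj F)
    split_ifs with hr
    · have : |r.num| ≤ r.den := by
        have h2 : (0 : ℚ) < r.den := by exact_mod_cast r.pos
        have h3 : |r| * r.den ≤ 1 * r.den := by gcongr
        have h4 : |r| * r.den = |(r.num : ℚ)| := by
          rw [← Rat.mul_den_eq_num r, abs_mul, abs_of_pos h2]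
        rw [h4, one_mul] at h3
        exact_mod_cast h3
      rw [hF]
      simp [this]
    · exact zero_le
  refine ne_top_of_le_ne_top ?_ h1
  rw [ENNReal.tsum_prod']
  have h2 : ∀ q : ℕ, ∑' a : ℤ, F (q, a) = ENNReal.ofReal ((2 * q + 1 : ℝ) * (q : ℝ) ^ (-(5 / 2) : ℝ)) := by
    intro q
    rw [tsum_eq_sum (s := Finset.Icc (-(q : ℤ)) q)]
    · rw [Finset.sum_congr rfl (g := fun _ => ENNReal.ofReal ((q : ℝ) ^ (-(5 / 2) : ℝ)))]
      · rw [Finset.sum_const, Int.card_Icc, nsmul_eq_mul, ENNReal.ofReal_mul (by positivity)]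
        congr 1
        rw [show ((q : ℤ) + 1 - -(q : ℤ)).toNat = 2 * q + 1 by omega,
          ← ENNReal.ofReal_natCast]
        push_cast
        rfl
      · intro a ha
        rw [Finset.mem_Icc] at ha
        rw [hF]
        simp [abs_le.2 ha]
    · intro a ha
      rw [Finset.mem_Icc, ← abs_le] at ha
      rw [hF]
      simp [ha]
  simp_rw [h2]
  rw [← ENNReal.ofReal_tsum_of_nonneg (fun q => by positivity) summable_two_mul_add_one_rpow]
  exact ENNReal.ofReal_ne_top

theorem lintegral_one_add_sq_rpow_ne_top :
    ∫⁻ u : ℝ, ENNReal.ofReal ((1 + u ^ 2) ^ (-(3 / 4) : ℝ)) ≠ ∞ := by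
  have h := integrable_rpow_neg_one_add_norm_sq (E := ℝ) (μ := volume) (r := 3 / 2) (by simp; norm_num)
  have h2 : Integrable (fun u : ℝ => (1 + u ^ 2) ^ (-(3 / 4) : ℝ)) := by
    refine h.congr (Filter.Eventually.of_forall fun u => ?_)
    simp only [Real.norm_eq_abs, sq_abs]
    norm_num
  exact h2.lintegral_lt_top.ne

/-- The total weight of all arcs. -/
def arcMass : ℝ≥0∞ :=
  ∑' r : ℚ, ∫⁻ u, if |r| ≤ 1 then ENNReal.ofReal (arcWeightSqrt r u) ^ 2 else 0

theorem arcMass_ne_top : arcMass ≠ ∞ := by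
  have : ∀ r : ℚ, (∫⁻ u, if |r| ≤ 1 then ENNReal.ofReal (arcWeightSqrt r u) ^ 2 else 0) =
      (if |r| ≤ 1 then ENNReal.ofReal ((r.den : ℝ) ^ (-(5 / 2) : ℝ)) else 0) *
        ∫⁻ u : ℝ, ENNReal.ofReal ((1 + u ^ 2) ^ (-(3 / 4) : ℝ)) := by
    intro r
    rw [← lintegral_const_mul _ (by fun_prop)]
    refine lintegral_congr fun u => ?_
    split_ifs
    · rw [← ENNReal.ofReal_pow (arcWeightSqrt_pos r u).le, arcWeightSqrt_sq,
        ENNReal.ofReal_mul (by positivity)]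
    · simp
  rw [arcMass]
  simp_rw [this]
  rw [ENNReal.tsum_mul_right]
  exact ENNReal.mul_ne_top tsum_rat_den_rpow_ne_top lintegral_one_add_sq_rpow_ne_top

instance Rat.neZero_den (r : ℚ) : NeZero r.den := ⟨r.den_nz⟩

theorem tsum_mul_sub_eq_sum {d : ℕ} (k : (Fin d → ℤ) → ℂ) {s : Finset (Fin d → ℤ)}
    {f : (Fin d → ℤ) → ℂ} (hf : ∀ n ∉ s, f n = 0) (x : Fin d → ℤ) :
    ∑' m, k m * f (x - m) = ∑ y ∈ s, k (x - y) * f y := by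
  rw [← (Equiv.subLeft x).tsum_eq, tsum_eq_sum (s := s)]
  · simp
  · intro y hy
    simp [hf y hy]

theorem continuous_thetaKernelPi {d : ℕ} (S : ℝ) (m : Fin d → ℤ) :
    Continuous fun t => thetaKernelPi S t m := by
  unfold thetaKernelPi thetaKernel
  fun_prop

/-- The maximal function of the theta kernels near the rational `r`. -/
def arcMaximal {d : ℕ} (f : (Fin d → ℤ) → ℂ) (r : ℚ) (u : ℝ) (x : Fin d → ℤ) : ℝ≥0∞ :=
  ⨆ j : {j : ℕ // (r.den : ℝ) ^ 2 * max 1 (u ^ 2) ≤ 4 ^ j},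
    ‖∑' m, thetaKernelPi (4 ^ (j : ℕ)) (r.num / r.den + u / 4 ^ (j : ℕ)) m * f (x - m)‖ₑ

/-- The sum of the maximal functions of all arcs. -/
def circleMaximal {d : ℕ} (f : (Fin d → ℤ) → ℂ) (x : Fin d → ℤ) : ℝ≥0∞ :=
  ∑' r : ℚ, ∫⁻ u, if |r| ≤ 1 then arcMaximal f r u x else 0

/-- Finite support turns the convolution into a finite sum of functions continuous in `u`, leaving a
countable supremum. -/
theorem measurable_arcMaximal {d : ℕ} {s : Finset (Fin d → ℤ)} {f : (Fin d → ℤ) → ℂ}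
    (hf : ∀ n ∉ s, f n = 0) (r : ℚ) (x : Fin d → ℤ) :
    Measurable fun u => arcMaximal f r u x := by
  have : (fun u => arcMaximal f r u x) = fun u => ⨆ j : ℕ,
      {u : ℝ | (r.den : ℝ) ^ 2 * max 1 (u ^ 2) ≤ 4 ^ j}.indicator
        (fun u => ‖∑ y ∈ s, thetaKernelPi (4 ^ j) (r.num / r.den + u / 4 ^ j) (x - y) * f y‖ₑ) u := by
    ext u
    simp only [arcMaximal, tsum_mul_sub_eq_sum _ hf]
    rw [iSup_subtype]
    refine iSup_congr fun j => ?_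
    by_cases h : (r.den : ℝ) ^ 2 * max 1 (u ^ 2) ≤ 4 ^ j <;> simp [h]
  rw [this]
  refine Measurable.iSup fun j => Measurable.indicator ?_
    (measurableSet_le (f := fun u : ℝ => (r.den : ℝ) ^ 2 * max 1 (u ^ 2)) (by fun_prop)
      measurable_const)
  refine (Continuous.measurable ?_).enorm
  refine continuous_finsetSum _ fun y _ => ?_
  exact ((continuous_thetaKernelPi (4 ^ j) (x - y)).comp (by fun_prop)).mul continuous_const

/-- Minkowski's inequality in Cauchy–Schwarz form: `arcMaximal` is multiplied and divided by the
square root of its own operator bound. The two resulting factors each cost one copy of `arcMass`. -/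
theorem tsum_circleMaximal_sq_le {d : ℕ} (hd : 5 ≤ d) : ∃ C : ℝ≥0, ∀ (s : Finset (Fin d → ℤ))
    (f : (Fin d → ℤ) → ℂ), (∀ n ∉ s, f n = 0) →
    ∑' x, circleMaximal f x ^ 2 ≤ C * ∑' x, ‖f x‖ₑ ^ 2 := by
  obtain ⟨C, hC⟩ := tsum_iSup_thetaKernelPi_sq_le d
  refine ⟨(arcMass * (C * arcMass)).toNNReal, fun s f hf => ?_⟩
  rw [ENNReal.coe_toNNReal (ENNReal.mul_ne_top arcMass_ne_top
    (ENNReal.mul_ne_top ENNReal.coe_ne_top arcMass_ne_top))]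
  -- Here `d ≥ 5` enters: `(q √(1+u²))⁻¹ ≤ 1`, so its `d`-th power is at most its fifth.
  have hkey : ∀ (r : ℚ) (u : ℝ), ∑' x, arcMaximal f r u x ^ 2 ≤
      C * ENNReal.ofReal (arcWeightSqrt r u) ^ 4 * ∑' x, ‖f x‖ₑ ^ 2 := by
    intro r u
    refine (hC r.den r.num r.isCoprime_num_den u s f hf).trans ?_
    gcongr
    rw [← ENNReal.ofReal_pow (arcWeightSqrt_pos r u).le]
    apply ENNReal.ofReal_le_ofReal
    rw [arcWeightSqrt_pow_four, majorBound_sq, inv_pow]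
    have h1 : (1 : ℝ) ≤ r.den := by exact_mod_cast r.pos
    have h2 : 1 ≤ √(1 + u ^ 2) := by
      rw [Real.one_le_sqrt]
      nlinarith [sq_nonneg u]
    have h3 : (1 : ℝ) ≤ r.den * √(1 + u ^ 2) := one_le_mul_of_one_le_of_one_le h1 h2
    gcongr
  set μ : Measure (ℚ × ℝ) := (Measure.count : Measure ℚ).prod volume with hμ
  have hμint : ∀ g : ℚ → ℝ → ℝ≥0∞, (∀ r, Measurable (g r)) →
      ∫⁻ p, g p.1 p.2 ∂μ = ∑' r, ∫⁻ u, g r u := by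
    intro g hg
    rw [hμ, lintegral_prod _ (measurable_from_prod_countable_right fun r => hg r).aemeasurable,
      lintegral_count]
  set α : ℚ → ℝ → ℝ≥0∞ := fun r u =>
    if |r| ≤ 1 then ENNReal.ofReal (arcWeightSqrt r u) else 0 with hα
  have hαm : ∀ r, Measurable (α r) := fun r =>
    Measurable.ite (MeasurableSet.const _) (measurable_arcWeightSqrt r).ennreal_ofReal
      measurable_const
  have hαmass : ∑' r, ∫⁻ u, α r u ^ 2 = arcMass := by
    refine tsum_congr fun r => lintegral_congr fun u => ?_
    simp only [hα]
    split_ifs <;> simp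
  set β : (Fin d → ℤ) → ℚ → ℝ → ℝ≥0∞ := fun x r u =>
    if |r| ≤ 1 then (ENNReal.ofReal (arcWeightSqrt r u))⁻¹ * arcMaximal f r u x else 0 with hβ
  have hβm : ∀ x r, Measurable (β x r) := fun x r =>
    Measurable.ite (MeasurableSet.const _)
      ((measurable_arcWeightSqrt r).ennreal_ofReal.inv.mul (measurable_arcMaximal hf r x))
      measurable_const
  have hpos : ∀ r u, ENNReal.ofReal (arcWeightSqrt r u) ≠ 0 := fun r u => by
    rw [Ne, ENNReal.ofReal_eq_zero, not_le]
    exact arcWeightSqrt_pos r u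
  have hpt : ∀ x, circleMaximal f x ^ 2 ≤ arcMass * ∑' r, ∫⁻ u, β x r u ^ 2 := by
    intro x
    have h1 : circleMaximal f x = ∫⁻ p, α p.1 p.2 * β x p.1 p.2 ∂μ := by
      rw [hμint (fun r u => α r u * β x r u) fun r => (hαm r).mul (hβm x r)]
      refine tsum_congr fun r => lintegral_congr fun u => ?_
      simp only [hα, hβ]
      split_ifs
      · rw [← mul_assoc, ENNReal.mul_inv_cancel (hpos r u) ENNReal.ofReal_ne_top, one_mul]
      · simp
    rw [h1, ← hαmass, ← hμint (fun r u => α r u ^ 2) fun r => (hαm r).pow_const 2,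
      ← hμint (fun r u => β x r u ^ 2) fun r => (hβm x r).pow_const 2]
    exact ENNReal.lintegral_mul_sq_le μ
      (measurable_from_prod_countable_right fun r => hαm r).aemeasurable
      (measurable_from_prod_countable_right fun r => hβm x r).aemeasurable
  calc _ ≤ ∑' x, arcMass * ∑' r, ∫⁻ u, β x r u ^ 2 := ENNReal.tsum_le_tsum hpt
    _ = arcMass * ∑' r, ∫⁻ u, ∑' x, β x r u ^ 2 := by
        rw [ENNReal.tsum_mul_left, ENNReal.tsum_comm]
        congr 1
        refine tsum_congr fun r => ?_
        rw [lintegral_tsum fun x => ((hβm x r).pow_const 2).aemeasurable]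
    _ ≤ arcMass * ∑' r, ∫⁻ u, C * α r u ^ 2 * ∑' x, ‖f x‖ₑ ^ 2 := by
        gcongr with r u
        simp only [hβ, hα]
        split_ifs
        · simp_rw [mul_pow]
          rw [ENNReal.tsum_mul_left]
          calc _ ≤ ((ENNReal.ofReal (arcWeightSqrt r u))⁻¹) ^ 2 *
                (C * ENNReal.ofReal (arcWeightSqrt r u) ^ 4 * ∑' x, ‖f x‖ₑ ^ 2) := by
                gcongr
                exact hkey r u
            _ = (ENNReal.ofReal (arcWeightSqrt r u) * (ENNReal.ofReal (arcWeightSqrt r u))⁻¹) ^ 2 *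
                (C * ENNReal.ofReal (arcWeightSqrt r u) ^ 2 * ∑' x, ‖f x‖ₑ ^ 2) := by ring
            _ = _ := by
                rw [ENNReal.mul_inv_cancel (hpos r u) ENNReal.ofReal_ne_top, one_pow, one_mul]
        · simp
    _ = arcMass * (C * arcMass * ∑' x, ‖f x‖ₑ ^ 2) := by
        rw [← hαmass]
        congr 1
        have : ∀ r, ∫⁻ u, C * α r u ^ 2 * ∑' x, ‖f x‖ₑ ^ 2 =
            C * (∑' x, ‖f x‖ₑ ^ 2) * ∫⁻ u, α r u ^ 2 := fun r => by
          rw [← lintegral_const_mul _ ((hαm r).pow_const 2)]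
          exact lintegral_congr fun u => by ring
        rw [tsum_congr this, ENNReal.tsum_mul_left]
        ring
    _ = _ := by ring

/-! ### Spheres as integrals of theta kernels. -/

theorem thetaKernelPi_eq {d : ℕ} (S t : ℝ) (m : Fin d → ℤ) :
    thetaKernelPi S t m = (((√S)⁻¹ : ℝ) : ℂ) ^ d *
      Complex.exp (2 * Real.pi * I * (∑ i, m i ^ 2 : ℤ) * (t + I / S)) := by
  simp only [thetaKernelPi, thetaKernel]
  rw [Finset.prod_mul_distrib, Finset.prod_const, Finset.card_univ, Fintype.card_fin,
    ← Complex.exp_sum]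
  congr 2
  push_cast
  rw [Finset.mul_sum, Finset.sum_mul]

theorem intervalIntegral_exp_two_pi_I_mul (k : ℤ) :
    ∫ t in (0 : ℝ)..1, Complex.exp (2 * Real.pi * I * k * t) = if k = 0 then 1 else 0 := by
  split_ifs with h
  · simp [h]
  · have hc : (2 * Real.pi * I * k : ℂ) ≠ 0 := by
      have : (k : ℂ) ≠ 0 := by exact_mod_cast h
      have h2 : (Real.pi : ℂ) ≠ 0 := by exact_mod_cast Real.pi_ne_zero
      simp [this, h2]
    rw [integral_exp_mul_complex hc]
    have : Complex.exp (2 * Real.pi * I * k * (1 : ℝ)) = 1 := by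
      rw [Complex.exp_eq_one_iff]
      exact ⟨k, by push_cast; ring⟩
    rw [this]
    simp

theorem mem_discreteSphereFinset {d n : ℕ} (m : Fin d → ℤ) :
    m ∈ discreteSphereFinset d √n ↔ ∑ i, m i ^ 2 = n := by
  rw [discreteSphereFinset, Set.Finite.mem_toFinset, discreteSphere, Set.mem_ofPred_eq,
    Real.sqrt_inj (Finset.sum_nonneg fun i _ => sq_nonneg _) (by positivity)]
  constructor
  · intro h
    exact_mod_cast h
  · intro h
    exact_mod_cast h

/-- Integration over a full period isolates `|m|² = n`, where the Gaussian factor is the constant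
`exp (-2πn/S)`. -/
theorem integral_exp_mul_thetaKernelPi {d : ℕ} (S : ℝ) (n : ℕ) (m : Fin d → ℤ) :
    ∫ t in (0 : ℝ)..1, Complex.exp (-(2 * Real.pi * I * n * t)) * thetaKernelPi S t m =
      if ∑ i, m i ^ 2 = (n : ℤ) then
        (((√S)⁻¹ : ℝ) : ℂ) ^ d * (Real.exp (-(2 * Real.pi * n / S)) : ℝ) else 0 := by
  have h : ∀ t : ℝ, Complex.exp (-(2 * Real.pi * I * n * t)) * thetaKernelPi S t m =
      ((((√S)⁻¹ : ℝ) : ℂ) ^ d * (Real.exp (-(2 * Real.pi * (∑ i, m i ^ 2 : ℤ) / S)) : ℝ)) *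
        Complex.exp (2 * Real.pi * I * (∑ i, m i ^ 2 - n : ℤ) * t) := by
    intro t
    rw [thetaKernelPi_eq, mul_left_comm, mul_assoc ((((√S)⁻¹ : ℝ) : ℂ) ^ d),
      ← Complex.exp_add, Complex.ofReal_exp,
      ← Complex.exp_add]
    congr 2
    push_cast
    linear_combination (2 * Real.pi * (∑ i, (m i : ℂ) ^ 2) / S) * Complex.I_sq
  simp_rw [h]
  rw [intervalIntegral.integral_const_mul, intervalIntegral_exp_two_pi_I_mul]
  by_cases hm : ∑ i, m i ^ 2 = (n : ℤ)
  · rw [if_pos (by rw [hm, sub_self]), if_pos hm, mul_one, hm]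
    push_cast
    rfl
  · rw [if_neg (fun h0 => hm (by linarith)), if_neg hm, mul_zero]

/-- Sums over spheres are controlled by the circle method. -/
theorem enorm_sum_sphere_le {d : ℕ} {s : Finset (Fin d → ℤ)} {f : (Fin d → ℤ) → ℂ}
    (hf : ∀ n ∉ s, f n = 0) {n j : ℕ} (hn : n < 4 ^ (j + 1)) (x : Fin d → ℤ) :
    ‖∑ m ∈ discreteSphereFinset d √n, f (x - m)‖ₑ * ENNReal.ofReal (4 ^ j) ≤
      ENNReal.ofReal (Real.exp (8 * Real.pi) * √(4 ^ j) ^ d) * circleMaximal f x := by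
  set S : ℝ := 4 ^ j with hS
  have hS1 : 1 ≤ S := one_le_pow₀ (by norm_num)
  have hS0 : 0 < S := by linarith
  set T : ℝ → ℂ := fun t => ∑ y ∈ s, thetaKernelPi S t (x - y) * f y with hT
  have hTc : Continuous T :=
    continuous_finsetSum _ fun y _ => (continuous_thetaKernelPi S (x - y)).mul continuous_const
  set c : ℝ := (√S)⁻¹ ^ d * Real.exp (-(2 * Real.pi * n / S)) with hc
  have hc0 : 0 < c := by
    have : 0 < √S := Real.sqrt_pos.2 hS0
    positivity
  have h1 : ∫ t in (0 : ℝ)..1, Complex.exp (-(2 * Real.pi * I * n * t)) * T t =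
      c * ∑ m ∈ discreteSphereFinset d √n, f (x - m) := by
    simp only [hT, Finset.mul_sum, ← mul_assoc]
    rw [intervalIntegral.integral_finsetSum]
    · simp_rw [intervalIntegral.integral_mul_const, integral_exp_mul_thetaKernelPi]
      have e1 : ∑ m ∈ discreteSphereFinset d √n, (c : ℂ) * f (x - m) =
          ∑' m, (if m ∈ discreteSphereFinset d √n then (c : ℂ) else 0) * f (x - m) := by
        rw [tsum_eq_sum (s := discreteSphereFinset d √n)]
        · exact Finset.sum_congr rfl fun m hm => by rw [if_pos hm]
        · intro m hm
          rw [if_neg hm, zero_mul]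
      rw [e1, tsum_mul_sub_eq_sum _ hf]
      refine Finset.sum_congr rfl fun y _ => ?_
      simp only [mem_discreteSphereFinset, hc]
      push_cast
      rfl
    · intro y _
      refine Continuous.intervalIntegrable ?_ _ _
      have := continuous_thetaKernelPi S (x - y)
      fun_prop
  have h2 : ‖∑ m ∈ discreteSphereFinset d √n, f (x - m)‖ₑ * ENNReal.ofReal c ≤
      ∫⁻ t in Set.Icc (-1 : ℝ) 1, ‖T t‖ₑ := by
    have e : ‖∑ m ∈ discreteSphereFinset d √n, f (x - m)‖ₑ * ENNReal.ofReal c =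
        ‖∫ t in (0 : ℝ)..1, Complex.exp (-(2 * Real.pi * I * n * t)) * T t‖ₑ := by
      rw [h1, enorm_mul, mul_comm]
      congr 1
      rw [← ofReal_norm, Complex.norm_real, Real.norm_of_nonneg hc0.le]
    rw [e, intervalIntegral.integral_of_le zero_le_one]
    refine (enorm_integral_le_lintegral_enorm _).trans ?_
    calc _ = ∫⁻ t in Set.Ioc (0 : ℝ) 1, ‖T t‖ₑ := by
          refine lintegral_congr fun t => ?_
          rw [enorm_mul]
          have : ‖Complex.exp (-(2 * Real.pi * I * n * t))‖ₑ = 1 := by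
            have h := norm_exp_two_pi_I_mul (-(n : ℤ)) t
            rw [← ofReal_norm, ← ENNReal.ofReal_one, ← h]
            congr 3
            push_cast
            ring
          rw [this, one_mul]
      _ ≤ _ := by
          refine lintegral_mono_set fun t ht => ⟨?_, ht.2⟩
          linarith [ht.1]
  have h3 := lintegral_le_tsum_arcs hS1 (φ := fun t => ‖T t‖ₑ) hTc.measurable.enorm
  have h4 : ∑' r : ℚ, ∫⁻ u, {u : ℝ | |r| ≤ 1 ∧ (r.den : ℝ) ^ 2 * max 1 (u ^ 2) ≤ S}.indicator
        (fun u => ‖T (r + u / S)‖ₑ) u ≤ circleMaximal f x := by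
    refine ENNReal.tsum_le_tsum fun r => lintegral_mono fun u => ?_
    by_cases hu : |r| ≤ 1 ∧ (r.den : ℝ) ^ 2 * max 1 (u ^ 2) ≤ S
    · rw [Set.indicator_of_mem (by exact hu), if_pos hu.1]
      refine le_trans (le_of_eq ?_) (le_iSup (fun j : {j : ℕ // (r.den : ℝ) ^ 2 * max 1 (u ^ 2) ≤ 4 ^ j} =>
        ‖∑' m, thetaKernelPi (4 ^ (j : ℕ)) (r.num / r.den + u / 4 ^ (j : ℕ)) m * f (x - m)‖ₑ)
        ⟨j, hu.2⟩)
      simp only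
      rw [tsum_mul_sub_eq_sum _ hf, hT, ← hS, Rat.cast_def]
    · rw [Set.indicator_of_notMem (by exact hu)]
      exact zero_le
  -- `n < 4 S` keeps the Gaussian factor above `exp (-8π)`; this is the source of that constant.
  have h5 : 1 ≤ Real.exp (8 * Real.pi) * √S ^ d * c := by
    have hs : 0 < √S := Real.sqrt_pos.2 hS0
    have : Real.exp (8 * Real.pi) * √S ^ d * c =
        Real.exp (8 * Real.pi + -(2 * Real.pi * n / S)) := by
      rw [hc, Real.exp_add, inv_pow]
      field_simp
    rw [this, Real.one_le_exp_iff]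
    have h6 : (n : ℝ) ≤ 4 * S := by
      rw [hS, ← pow_succ']
      exact_mod_cast hn.le
    have h7 : 2 * Real.pi * n / S ≤ 8 * Real.pi := by
      rw [div_le_iff₀ hS0]
      nlinarith [Real.pi_pos]
    linarith
  calc ‖∑ m ∈ discreteSphereFinset d √n, f (x - m)‖ₑ * ENNReal.ofReal S
      ≤ ‖∑ m ∈ discreteSphereFinset d √n, f (x - m)‖ₑ * ENNReal.ofReal S *
        ENNReal.ofReal (Real.exp (8 * Real.pi) * √S ^ d * c) :=
        le_mul_of_one_le_right zero_le (ENNReal.one_le_ofReal.2 h5)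
    _ = ENNReal.ofReal (Real.exp (8 * Real.pi) * √S ^ d) * (ENNReal.ofReal S *
        (‖∑ m ∈ discreteSphereFinset d √n, f (x - m)‖ₑ * ENNReal.ofReal c)) := by
        rw [ENNReal.ofReal_mul (q := c) (by positivity)]
        ring
    _ ≤ ENNReal.ofReal (Real.exp (8 * Real.pi) * √S ^ d) * circleMaximal f x := by
        gcongr
        exact (mul_le_mul' le_rfl h2).trans (h3.trans h4)

/-! ### Lower bounds for local densities. -/

/-- The density of solutions of `x₁² + ⋯ + x_d² = n` modulo `Q`. -/
def localDensity (d Q : ℕ) [NeZero Q] (n : ℕ) : ℝ :=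
  Fintype.card {x : Fin d → ZMod Q // ∑ i, x i ^ 2 = (n : ZMod Q)} * (Q : ℝ) / Q ^ d

theorem localDensity_eq_sum (d Q : ℕ) [NeZero Q] (n : ℕ) :
    (localDensity d Q n : ℂ) =
      ∑ b : ZMod Q, ZMod.stdAddChar (-(b * (n : ZMod Q))) * (quadGaussSum Q b 0 / Q) ^ d := by
  have hQ : (Q : ℂ) ≠ 0 := by exact_mod_cast NeZero.ne Q
  have h1 : ∀ b : ZMod Q, ZMod.stdAddChar (-(b * (n : ZMod Q))) * (quadGaussSum Q b 0 / Q) ^ d =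
      (∑ x : Fin d → ZMod Q, ZMod.stdAddChar (b * (∑ i, x i ^ 2 - (n : ZMod Q)))) / Q ^ d := by
    intro b
    rw [div_pow, quadGaussSum, Fintype.sum_pow, ← mul_div_assoc, Finset.mul_sum]
    congr 1
    refine Finset.sum_congr rfl fun x _ => ?_
    have : ∏ i, (ZMod.stdAddChar (b * x i ^ 2 + 0 * x i) : ℂ) =
        ZMod.stdAddChar (b * ∑ i, x i ^ 2) := by
      rw [Finset.mul_sum]
      induction (Finset.univ : Finset (Fin d)) using Finset.cons_induction with
      | empty => simp
      | cons i s hi ih =>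
        rw [Finset.prod_cons, Finset.sum_cons, ih, zero_mul, add_zero, ← AddChar.map_add_eq_mul]
    rw [this, ← AddChar.map_add_eq_mul]
    congr 1
    ring
  simp_rw [h1]
  rw [← Finset.sum_div, Finset.sum_comm]
  have h2 : ∀ x : Fin d → ZMod Q, ∑ b : ZMod Q, (ZMod.stdAddChar (b * (∑ i, x i ^ 2 - (n : ZMod Q))) : ℂ) =
      if ∑ i, x i ^ 2 = (n : ZMod Q) then (Q : ℂ) else 0 := by
    intro x
    rw [AddChar.sum_mulShift _ (ZMod.isPrimitive_stdAddChar Q), ZMod.card]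
    simp only [sub_eq_zero]
    split_ifs <;> simp
  simp_rw [h2]
  rw [← Finset.sum_filter, Finset.sum_const, nsmul_eq_mul, localDensity, Fintype.card_subtype]
  push_cast
  rfl

/-- The Chinese remainder theorem. It allows the prime 2, where the Gauss sum bound loses a factor,
to be treated separately. -/
theorem localDensity_mul (d : ℕ) {Q R : ℕ} [NeZero Q] [NeZero R] (h : Nat.Coprime Q R) (n : ℕ) :
    localDensity d (Q * R) n = localDensity d Q n * localDensity d R n := by
  let E : (Fin d → ZMod (Q * R)) ≃ (Fin d → ZMod Q) × (Fin d → ZMod R) :=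
    (Equiv.piCongrRight fun _ => (ZMod.chineseRemainder h).toEquiv).trans
      (Equiv.arrowProdEquivProdArrow (Fin d) (fun _ => ZMod Q) fun _ => ZMod R)
  have hE : ∀ x : Fin d → ZMod (Q * R), ∑ i, x i ^ 2 = (n : ZMod (Q * R)) ↔
      (∑ i, (E x).1 i ^ 2 = (n : ZMod Q)) ∧ (∑ i, (E x).2 i ^ 2 = (n : ZMod R)) := by
    intro x
    rw [← (ZMod.chineseRemainder h).injective.eq_iff, map_sum, map_natCast, Prod.ext_iff]
    simp [E, Prod.fst_sum, Prod.snd_sum, Equiv.arrowProdEquivProdArrow]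
  have hcard : Fintype.card {x : Fin d → ZMod (Q * R) // ∑ i, x i ^ 2 = (n : ZMod (Q * R))} =
      Fintype.card {x : Fin d → ZMod Q // ∑ i, x i ^ 2 = (n : ZMod Q)} *
      Fintype.card {x : Fin d → ZMod R // ∑ i, x i ^ 2 = (n : ZMod R)} := by
    rw [← Fintype.card_prod]
    refine Fintype.card_congr ((Equiv.subtypeEquiv E hE).trans
      (Equiv.subtypeProdEquivProd (p := fun x : Fin d → ZMod Q => ∑ i, x i ^ 2 = (n : ZMod Q))
        (q := fun x : Fin d → ZMod R => ∑ i, x i ^ 2 = (n : ZMod R))))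
  rw [localDensity, localDensity, localDensity, hcard]
  push_cast
  ring

theorem norm_quadGaussSum_div_pow_le {d : ℕ} (hd : 5 ≤ d) (Q : ℕ) [NeZero Q] (b : ZMod Q) :
    ‖quadGaussSum Q b 0 / Q‖ ^ d ≤ ‖quadGaussSum Q b 0 / Q‖ ^ 5 := by
  refine pow_le_pow_of_le_one (norm_nonneg _) ?_ hd
  have hQ : (0 : ℝ) < Q := by exact_mod_cast Nat.pos_of_ne_zero (NeZero.ne Q)
  rw [norm_div, Complex.norm_natCast, div_le_one hQ]
  exact norm_quadGaussSum_le Q b 0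

/-- A lower bound for the local density from bounds of the Gauss sums according to the reduced
denominator `Q / gcd Q b`. -/
theorem le_localDensity {d : ℕ} (hd : 5 ≤ d) (Q : ℕ) [NeZero Q] (n : ℕ) (g : ℕ → ℝ)
    (hg : ∀ b < Q, b ≠ 0 → ‖quadGaussSum Q (b : ZMod Q) 0 / Q‖ ^ 5 ≤ g (Q / Q.gcd b)) :
    1 - ∑ q ∈ Q.divisors.erase 1, q.totient * g q ≤ localDensity d Q n := by
  have hQ0 : 0 < Q := Nat.pos_of_ne_zero (NeZero.ne Q)
  have hQC : (Q : ℂ) ≠ 0 := by exact_mod_cast NeZero.ne Q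
  -- The frequency `b = 0` contributes exactly 1; all others are treated as error.
  have h1 : (localDensity d Q n : ℂ) - 1 = ∑ b ∈ Finset.univ.erase (0 : ZMod Q),
      ZMod.stdAddChar (-(b * (n : ZMod Q))) * (quadGaussSum Q b 0 / Q) ^ d := by
    rw [localDensity_eq_sum, ← Finset.add_sum_erase _ _ (Finset.mem_univ (0 : ZMod Q))]
    have : quadGaussSum Q 0 0 = Q := by simp [quadGaussSum, ZMod.card]
    rw [this]
    simp [hQC]
  have h2 : |localDensity d Q n - 1| ≤
      ∑ b ∈ Finset.univ.erase (0 : ZMod Q), ‖quadGaussSum Q b 0 / Q‖ ^ 5 := by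
    rw [← Real.norm_eq_abs, ← Complex.norm_real, Complex.ofReal_sub, Complex.ofReal_one, h1]
    refine (norm_sum_le _ _).trans (Finset.sum_le_sum fun b _ => ?_)
    rw [norm_mul, norm_pow, ZMod.stdAddChar_apply, Circle.norm_coe, one_mul]
    exact norm_quadGaussSum_div_pow_le hd Q b
  have h3 : ∑ b ∈ Finset.univ.erase (0 : ZMod Q), ‖quadGaussSum Q b 0 / Q‖ ^ 5 ≤
      ∑ b ∈ (Finset.range Q).erase 0, g (Q / Q.gcd b) := by
    have : ∑ b ∈ Finset.univ.erase (0 : ZMod Q), ‖quadGaussSum Q b 0 / Q‖ ^ 5 =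
        ∑ b ∈ (Finset.range Q).erase 0, ‖quadGaussSum Q (b : ZMod Q) 0 / Q‖ ^ 5 := by
      refine Finset.sum_nbij' ZMod.val Nat.cast ?_ ?_ ?_ ?_ ?_
      · intro b hb
        simp only [Finset.mem_erase, Finset.mem_univ, and_true, Finset.mem_range, ne_eq,
          ZMod.val_eq_zero] at hb ⊢
        exact ⟨hb, ZMod.val_lt b⟩
      · intro b hb
        simp only [Finset.mem_erase, Finset.mem_univ, and_true, Finset.mem_range] at hb ⊢
        rw [Ne, ZMod.natCast_eq_zero_iff]
        exact fun h => hb.1 (Nat.eq_zero_of_dvd_of_lt h hb.2)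
      · exact fun b _ => ZMod.natCast_zmod_val b
      · intro b hb
        rw [Finset.mem_erase, Finset.mem_range] at hb
        exact ZMod.val_cast_of_lt hb.2
      · intro b _
        rw [ZMod.natCast_zmod_val]
    rw [this]
    refine Finset.sum_le_sum fun b hb => ?_
    rw [Finset.mem_erase, Finset.mem_range] at hb
    exact hg b hb.2 hb.1
  -- Grouping `b` by the reduced denominator `q` of `b / Q`, each value being taken `φ(q)` times.
  have h4 : ∑ b ∈ (Finset.range Q).erase 0, g (Q / Q.gcd b) =
      ∑ q ∈ Q.divisors.erase 1, q.totient * g q := by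
    have hmaps : ∀ b ∈ (Finset.range Q).erase 0, Q / Q.gcd b ∈ Q.divisors.erase 1 := by
      intro b hb
      rw [Finset.mem_erase, Finset.mem_range] at hb
      rw [Finset.mem_erase, Nat.mem_divisors]
      refine ⟨fun h => ?_, Nat.div_dvd_of_dvd (Nat.gcd_dvd_left Q b), hQ0.ne'⟩
      have h5 := Nat.div_mul_cancel (Nat.gcd_dvd_left Q b)
      rw [h, one_mul] at h5
      have h6 := Nat.gcd_dvd_right Q b
      rw [h5] at h6
      exact hb.1 (Nat.eq_zero_of_dvd_of_lt h6 hb.2)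
    rw [← Finset.sum_fiberwise_of_maps_to hmaps]
    refine Finset.sum_congr rfl fun q hq => ?_
    rw [Finset.mem_erase, Nat.mem_divisors] at hq
    obtain ⟨e, rfl⟩ := hq.2.1
    have hq0 : 0 < q := Nat.pos_of_mul_pos_right hQ0
    have he0 : 0 < e := Nat.pos_of_mul_pos_left hQ0
    have hset : ((Finset.range (q * e)).erase 0).filter (fun b => q * e / (q * e).gcd b = q) =
        (Finset.range (q * e)).filter (fun b => (q * e).gcd b = e) := by
      ext b
      simp only [Finset.mem_filter, Finset.mem_erase, Finset.mem_range]
      constructor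
      · rintro ⟨⟨_, hb⟩, h⟩
        refine ⟨hb, ?_⟩
        have h5 := Nat.div_mul_cancel (Nat.gcd_dvd_left (q * e) b)
        rw [h] at h5
        exact Nat.eq_of_mul_eq_mul_left hq0 h5
      · rintro ⟨hb, h⟩
        refine ⟨⟨?_, hb⟩, by rw [h, Nat.mul_div_cancel _ he0]⟩
        rintro rfl
        rw [Nat.gcd_zero_right] at h
        exact hq.1 (Nat.eq_of_mul_eq_mul_right he0 (by rw [h, one_mul]))
    have hcard := Nat.totient_div_of_dvd (Nat.dvd_mul_left e q)
    rw [Nat.mul_div_cancel _ he0] at hcard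
    rw [Finset.sum_congr rfl (g := fun _ => g q) fun b hb => by rw [(Finset.mem_filter.1 hb).2],
      Finset.sum_const, hset, ← hcard, nsmul_eq_mul]
  have := (abs_le.1 (h2.trans (h3.trans_eq h4))).1
  linarith

/-- Here `q` is real so that it can be the reduced denominator when `Q` is odd and half of it when
`Q` is a power of two. -/
theorem norm_quadGaussSum_div_pow_five_le (Q : ℕ) [NeZero Q] (b : ℕ) {q : ℝ} (hq : 0 < q)
    (h : ((2 * b).gcd Q : ℝ) ≤ Q / q) :
    ‖quadGaussSum Q (b : ZMod Q) 0 / Q‖ ^ 5 ≤ (√q ^ 5)⁻¹ := by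
  have hQ : (0 : ℝ) < Q := by exact_mod_cast Nat.pos_of_ne_zero (NeZero.ne Q)
  rw [← inv_pow]
  gcongr
  rw [norm_div, Complex.norm_natCast, div_le_iff₀ hQ, ← Real.sqrt_inv]
  have h1 := norm_quadGaussSum_sq_le Q b 0
  have h2 : ‖quadGaussSum Q (b : ZMod Q) 0‖ ^ 2 ≤ q⁻¹ * Q ^ 2 := by
    refine h1.trans ?_
    calc (Q : ℝ) * ((2 * b).gcd Q : ℕ) ≤ Q * (Q / q) := by gcongr
      _ = _ := by field_simp
  have h3 : √(q⁻¹) * Q = √(q⁻¹ * Q ^ 2) := by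
    rw [Real.sqrt_mul (by positivity), Real.sqrt_sq hQ.le]
  rw [h3]
  exact Real.le_sqrt_of_sq_le h2

/-- The terms are `m ^ (-3/2)` over odd `m ≥ 3`. Each is at most `1/√(m-1) - 1/√(m+1)`, and the
telescoped sum is below `1/√2 < 3/4`. -/
theorem sum_odd_inv_rpow_le (K : ℕ) :
    ∑ k ∈ Finset.range K, (2 * k + 3 : ℝ) * (√(2 * k + 3) ^ 5)⁻¹ ≤ 3 / 4 := by
  have h : ∀ k : ℕ, (2 * k + 3 : ℝ) * (√(2 * k + 3) ^ 5)⁻¹ ≤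
      (√(2 * k + 2))⁻¹ - (√(2 * (k + 1 : ℕ) + 2))⁻¹ := by
    intro k
    have e1 : (2 * (k + 1 : ℕ) + 2 : ℝ) = 2 * k + 4 := by push_cast; ring
    rw [e1]
    have hn : (2 * k + 3 : ℝ) = √(2 * k + 3) ^ 2 := (Real.sq_sqrt (by positivity)).symm
    have ha := Real.sq_sqrt (by positivity : (0 : ℝ) ≤ 2 * k + 2)
    have hc := Real.sq_sqrt (by positivity : (0 : ℝ) ≤ 2 * k + 4)
    have hb0 : 0 < √(2 * k + 3 : ℝ) := Real.sqrt_pos.2 (by positivity)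
    have ha0 : 0 < √(2 * k + 2 : ℝ) := Real.sqrt_pos.2 (by positivity)
    have hc0 : 0 < √(2 * k + 4 : ℝ) := Real.sqrt_pos.2 (by positivity)
    set a := √(2 * k + 2 : ℝ)
    set c := √(2 * k + 4 : ℝ)
    set b := √(2 * k + 3 : ℝ)
    have e2 : (2 * k + 3 : ℝ) * (b ^ 5)⁻¹ = (b ^ 3)⁻¹ := by
      rw [hn]
      field_simp
    have hac : a * c ≤ b ^ 2 := by nlinarith [sq_nonneg (a - c)]
    have hsum : a + c ≤ 2 * b := by nlinarith [sq_nonneg (a - c)]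
    have e3 : a⁻¹ - c⁻¹ = 2 / (a * c * (a + c)) := by
      field_simp
      nlinarith
    rw [e2, e3, inv_eq_one_div, div_le_div_iff₀ (by positivity) (by positivity)]
    have := mul_le_mul hac hsum (by positivity) (by positivity)
    nlinarith
  refine (Finset.sum_le_sum fun k _ => h k).trans ?_
  rw [Finset.sum_range_sub' (fun k : ℕ => (√(2 * k + 2 : ℝ))⁻¹)]
  have h1 : 0 ≤ (√(2 * K + 2 : ℝ))⁻¹ := by positivity
  have h2 : (√(2 * (0 : ℕ) + 2 : ℝ))⁻¹ ≤ 3 / 4 := by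
    norm_num
    rw [inv_le_comm₀ (by positivity) (by norm_num)]
    exact Real.le_sqrt_of_sq_le (by norm_num)
  linarith

theorem quarter_le_localDensity_odd {d : ℕ} (hd : 5 ≤ d) (Q : ℕ) [NeZero Q] (hQ : Odd Q) (n : ℕ) :
    1 / 4 ≤ localDensity d Q n := by
  have hQ0 : 0 < Q := Nat.pos_of_ne_zero (NeZero.ne Q)
  refine le_trans ?_ (le_localDensity hd Q n (fun q => (√q ^ 5)⁻¹) fun b _ _ => ?_)
  · have h1 : ∑ q ∈ Q.divisors.erase 1, (q.totient : ℝ) * (√q ^ 5)⁻¹ ≤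
        ∑ q ∈ (Finset.range Q).image (fun k : ℕ => 2 * k + 3), ((q : ℕ) : ℝ) * (√((q : ℕ) : ℝ) ^ 5)⁻¹ := by
      refine (Finset.sum_le_sum fun q _ => ?_).trans
        (Finset.sum_le_sum_of_subset_of_nonneg ?_ fun q _ _ => by positivity)
      · gcongr
        exact Nat.totient_le q
      · intro q hq
        rw [Finset.mem_erase, Nat.mem_divisors] at hq
        obtain ⟨k, hk⟩ := Odd.of_dvd_nat hQ hq.2.1
        have := Nat.le_of_dvd hQ0 hq.2.1
        rw [Finset.mem_image]
        exact ⟨k - 1, by rw [Finset.mem_range]; omega, by omega⟩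
    rw [Finset.sum_image fun a _ b _ h => by omega] at h1
    have h2 := sum_odd_inv_rpow_le Q
    push_cast at h1
    linarith
  · have hg : 0 < Q.gcd b := Nat.gcd_pos_of_pos_left b hQ0
    have hd1 : 0 < Q / Q.gcd b := Nat.div_pos (Nat.gcd_le_left b hQ0) hg
    refine norm_quadGaussSum_div_pow_five_le Q b (by exact_mod_cast hd1) ?_
    rw [Nat.cast_div (Nat.gcd_dvd_left Q b) (by exact_mod_cast hg.ne')]
    have : (2 * b).gcd Q = Q.gcd b := by
      rw [Nat.gcd_comm, Nat.Coprime.gcd_mul_left_cancel_right]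
      exact Nat.coprime_two_left.2 hQ
    rw [this, div_div_cancel₀]
    exact_mod_cast hQ0.ne'

/-- When `2 b = 0`, the shift `x ↦ x + 1` multiplies the sum by the character value at `b`, which is
not 1. -/
theorem quadGaussSum_eq_zero (Q : ℕ) [NeZero Q] {b : ZMod Q} (hb : b ≠ 0) (h2 : 2 * b = 0) :
    quadGaussSum Q b 0 = 0 := by
  have h : quadGaussSum Q b 0 = ZMod.stdAddChar b * quadGaussSum Q b 0 := by
    conv_lhs => rw [quadGaussSum, ← Equiv.sum_comp (Equiv.addRight (1 : ZMod Q))]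
    rw [quadGaussSum, Finset.mul_sum]
    refine Finset.sum_congr rfl fun x _ => ?_
    rw [← AddChar.map_add_eq_mul]
    congr 1
    simp only [Equiv.coe_addRight]
    linear_combination x * h2
  have hne : (ZMod.stdAddChar b : ℂ) ≠ 1 := by
    rw [Ne, (ZMod.isPrimitive_stdAddChar Q).zmod_char_eq_one_iff]
    exact hb
  have : (1 - (ZMod.stdAddChar b : ℂ)) * quadGaussSum Q b 0 = 0 := by
    rw [sub_mul, one_mul, ← h, sub_self]
  exact (mul_eq_zero.1 this).resolve_left (sub_ne_zero.2 hne.symm)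

/-- The terms with `j ≥ 1` are `2 ^ (-3j/2) ≤ (2/5) ^ j`, of sum at most `2/3`. -/
theorem sum_two_pow_inv_le (k : ℕ) :
    ∑ j ∈ Finset.range k, (2 ^ j : ℝ) * (if j = 0 then 0 else (√(2 ^ j) ^ 5)⁻¹) ≤ 3 / 4 := by
  have h : ∀ j : ℕ, (2 ^ j : ℝ) * (√(2 ^ j) ^ 5)⁻¹ ≤ (2 / 5) ^ j := by
    intro j
    have h0 : √(2 ^ j : ℝ) = √2 ^ j := by
      rw [Real.sqrt_eq_iff_mul_self_eq_of_pos (by positivity), ← mul_pow,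
        Real.mul_self_sqrt (by norm_num)]
    have h2 : (2 : ℝ) * (√2 ^ 5)⁻¹ ≤ 2 / 5 := by
      have hs : (√2 : ℝ) ^ 2 = 2 := Real.sq_sqrt (by norm_num)
      have h5 : (√2 : ℝ) ^ 5 = 4 * √2 := by
        calc (√2 : ℝ) ^ 5 = (√2 ^ 2) ^ 2 * √2 := by ring
          _ = _ := by rw [hs]; ring
      have h6 : (5 / 4 : ℝ) ≤ √2 := Real.le_sqrt_of_sq_le (by norm_num)
      rw [h5, ← div_eq_mul_inv, div_le_div_iff₀ (by positivity) (by norm_num)]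
      linarith
    calc (2 ^ j : ℝ) * (√(2 ^ j) ^ 5)⁻¹ = (2 * (√2 ^ 5)⁻¹) ^ j := by
          rw [h0, mul_pow, inv_pow, ← pow_mul, ← pow_mul, mul_comm j]
      _ ≤ _ := by gcongr
  have key : ∀ k : ℕ, ∑ j ∈ Finset.range (k + 1),
      (2 ^ j : ℝ) * (if j = 0 then 0 else (√(2 ^ j) ^ 5)⁻¹) ≤ 2 / 3 - 2 / 3 * (2 / 5) ^ k := by
    intro k
    induction k with
    | zero => simp
    | succ k ih =>
      rw [Finset.sum_range_succ, if_neg k.succ_ne_zero]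
      have := h (k + 1)
      rw [pow_succ (2 / 5 : ℝ)] at this ⊢
      linarith
  rcases k with _ | k
  · norm_num
  · have := key k
    have h0 : (0 : ℝ) < (2 / 5) ^ k := by positivity
    linarith

theorem quarter_le_localDensity_two_pow {d : ℕ} (hd : 5 ≤ d) (k n : ℕ) :
    1 / 4 ≤ localDensity d (2 ^ k) n := by
  -- Denominator 2 is given weight 0 because the Gauss sum vanishes there. Without this gain the
  -- total error, with the factor 2 lost in `gcd (2 b) Q`, would not stay below 1.
  refine le_trans ?_ (le_localDensity hd (2 ^ k) n
    (fun q => if q = 2 then 0 else (√(q / 2) ^ 5)⁻¹) fun b hb hb0 => ?_)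
  · have h1 : (2 ^ k).divisors.erase 1 = (Finset.range k).image fun j => 2 ^ (j + 1) := by
      ext q
      rw [Finset.mem_erase, Nat.mem_divisors_prime_pow Nat.prime_two, Finset.mem_image]
      constructor
      · rintro ⟨h, j, hj, rfl⟩
        rcases j with _ | j
        · exact absurd (pow_zero 2) h
        · exact ⟨j, Finset.mem_range.2 hj, rfl⟩
      · rintro ⟨j, hj, rfl⟩
        exact ⟨(Nat.one_lt_two_pow j.succ_ne_zero).ne', j + 1, Finset.mem_range.1 hj, rfl⟩
    have h2 := sum_two_pow_inv_le k
    rw [h1, Finset.sum_image fun a _ b _ h => by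
      simpa using Nat.pow_right_injective le_rfl h]
    have h3 : ∀ j ∈ Finset.range k, (((2 ^ (j + 1)).totient : ℕ) : ℝ) *
        (if 2 ^ (j + 1) = 2 then 0 else (√(((2 ^ (j + 1) : ℕ) : ℝ) / 2) ^ 5)⁻¹) =
        (2 ^ j : ℝ) * (if j = 0 then 0 else (√(2 ^ j) ^ 5)⁻¹) := by
      intro j _
      rw [Nat.totient_prime_pow_succ Nat.prime_two]
      have h4 : (2 ^ (j + 1) = 2) ↔ j = 0 := by
        constructor
        · intro h
          have := Nat.pow_right_injective le_rfl (h.trans (pow_one 2).symm)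
          simpa using this
        · rintro rfl; rfl
      have h5 : ((2 ^ (j + 1) : ℕ) : ℝ) / 2 = 2 ^ j := by
        push_cast
        rw [pow_succ]
        ring
      simp only [h4, h5]
      norm_num
    rw [Finset.sum_congr rfl h3]
    linarith
  · obtain ⟨j, hj, hgcd⟩ := (Nat.dvd_prime_pow Nat.prime_two).1 (Nat.gcd_dvd_left (2 ^ k) b)
    have hjk : j < k := by
      refine lt_of_le_of_ne hj ?_
      rintro rfl
      have := Nat.gcd_dvd_right (2 ^ j) b
      rw [hgcd] at this
      exact hb0 (Nat.eq_zero_of_dvd_of_lt this hb)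
    obtain ⟨i, rfl⟩ := Nat.exists_eq_add_of_lt hjk
    have hQ : 2 ^ (j + i + 1) / (2 ^ (j + i + 1)).gcd b = 2 ^ (i + 1) := by
      rw [hgcd, add_assoc, pow_add, Nat.mul_div_cancel_left _ (by positivity)]
    rw [hQ]
    split_ifs with h2
    · have hi : i = 0 := by
        have := Nat.pow_right_injective le_rfl (h2.trans (pow_one 2).symm)
        simpa using this
      subst hi
      rw [quadGaussSum_eq_zero]
      · simp
      · rw [Ne, ZMod.natCast_eq_zero_iff]
        exact fun h => hb0 (Nat.eq_zero_of_dvd_of_lt h hb)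
      · have : ((2 * b : ℕ) : ZMod (2 ^ (j + 0 + 1))) = 0 := by
          rw [ZMod.natCast_eq_zero_iff, add_zero, pow_succ, mul_comm]
          refine Nat.mul_dvd_mul_left 2 ?_
          have := Nat.gcd_dvd_right (2 ^ (j + 0 + 1)) b
          rwa [hgcd] at this
        exact_mod_cast this
    · refine norm_quadGaussSum_div_pow_five_le _ b (by positivity) ?_
      have hg : (2 * b).gcd (2 ^ (j + i + 1)) ∣ 2 * 2 ^ j := by
        rw [← hgcd, ← Nat.gcd_mul_left, Nat.gcd_comm (2 * b)]
        exact Nat.gcd_dvd_gcd_of_dvd_left _ (Nat.dvd_mul_left _ _)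
      have := Nat.le_of_dvd (by positivity) hg
      calc (((2 * b).gcd (2 ^ (j + i + 1)) : ℕ) : ℝ) ≤ ((2 * 2 ^ j : ℕ) : ℝ) := by exact_mod_cast this
        _ = _ := by
          push_cast
          rw [pow_add, pow_add, pow_add]
          field_simp

theorem localDensity_lower_bound {d : ℕ} (hd : 5 ≤ d) (Q : ℕ) [NeZero Q] (n : ℕ) :
    1 / 16 ≤ localDensity d Q n := by
  obtain ⟨k, R, hR, rfl⟩ := Nat.exists_eq_two_pow_mul_odd (NeZero.ne Q)
  have : NeZero R := ⟨hR.pos.ne'⟩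
  rw [localDensity_mul d (Nat.Coprime.pow_left k (Nat.coprime_two_left.2 hR))]
  have h1 := quarter_le_localDensity_two_pow hd k n
  have h2 := quarter_le_localDensity_odd hd R hR n
  nlinarith

/-! ### The singular integral. -/

theorem integrableOn_rpow_mul_exp_neg_mul_Ioi {s b : ℝ} (hs : -1 < s) (hb : 0 < b) :
    IntegrableOn (fun x : ℝ => x ^ s * Real.exp (-(b * x))) (Set.Ioi 0) := by
  have h := integrableOn_rpow_mul_exp_neg_mul_rpow hs one_pos hb
  simpa only [Real.rpow_one, neg_mul] using h

theorem norm_rpow_mul_cexp {s x : ℝ} (hx : 0 < x) (z : ℂ) :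
    ‖((x ^ s : ℝ) : ℂ) * Complex.exp (-(z * x))‖ = x ^ s * Real.exp (-(z.re * x)) := by
  rw [norm_mul, Complex.norm_real, Real.norm_of_nonneg (Real.rpow_nonneg hx.le s),
    Complex.norm_exp]
  simp

theorem integrableOn_rpow_mul_cexp {s : ℝ} (hs : -1 < s) {z : ℂ} (hz : 0 < z.re) :
    IntegrableOn (fun x : ℝ => ((x ^ s : ℝ) : ℂ) * Complex.exp (-(z * x))) (Set.Ioi 0) := by
  refine (integrableOn_rpow_mul_exp_neg_mul_Ioi hs hz).mono'
    (Measurable.aestronglyMeasurable (by fun_prop)) ?_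
  filter_upwards [ae_restrict_mem measurableSet_Ioi] with x hx
  exact (norm_rpow_mul_cexp hx z).le

theorem differentiableAt_integral_rpow_mul_cexp {s : ℝ} (hs : -1 < s) {z : ℂ} (hz : 0 < z.re) :
    DifferentiableAt ℂ
      (fun z : ℂ => ∫ x in Set.Ioi (0 : ℝ), ((x ^ s : ℝ) : ℂ) * Complex.exp (-(z * x))) z := by
  have hs' : {w : ℂ | z.re / 2 < w.re} ∈ nhds z :=
    (isOpen_lt continuous_const Complex.continuous_re).mem_nhds
      (show z.re / 2 < z.re by linarith)
  refine (hasDerivAt_integral_of_dominated_loc_of_deriv_le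
    (μ := volume.restrict (Set.Ioi (0 : ℝ)))
    (F := fun (w : ℂ) (x : ℝ) => ((x ^ s : ℝ) : ℂ) * Complex.exp (-(w * x)))
    (F' := fun (w : ℂ) (x : ℝ) => ((x ^ s : ℝ) : ℂ) * (Complex.exp (-(w * x)) * (-x)))
    (bound := fun x : ℝ => x ^ (s + 1) * Real.exp (-(z.re / 2 * x))) hs'
    (Filter.Eventually.of_forall fun w => Measurable.aestronglyMeasurable (by fun_prop))
    (integrableOn_rpow_mul_cexp hs hz) (Measurable.aestronglyMeasurable (by fun_prop)) ?_
    (integrableOn_rpow_mul_exp_neg_mul_Ioi (by linarith) (by linarith)) ?_).2.differentiableAt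
  · filter_upwards [ae_restrict_mem measurableSet_Ioi] with x hx w hw
    have hx0 : (0 : ℝ) < x := hx
    rw [← mul_assoc, norm_mul, norm_rpow_mul_cexp hx w, norm_neg, Complex.norm_real,
      Real.norm_of_nonneg hx0.le, Real.rpow_add_one hx0.ne']
    have : Real.exp (-(w.re * x)) ≤ Real.exp (-(z.re / 2 * x)) := by
      rw [Real.exp_le_exp]
      have : z.re / 2 < w.re := hw
      nlinarith
    calc x ^ s * Real.exp (-(w.re * x)) * x = x ^ s * x * Real.exp (-(w.re * x)) := by ring
      _ ≤ _ := by gcongr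
  · refine Filter.Eventually.of_forall fun x w _ => ?_
    refine HasDerivAt.const_mul _ (HasDerivAt.cexp ?_)
    exact (by simpa using (hasDerivAt_id w).mul_const (x : ℂ) :
      HasDerivAt (fun w : ℂ => w * x) (x : ℂ) w).neg

/-- The Laplace transform of a power function at a complex argument. -/
theorem integral_rpow_mul_cexp {a : ℝ} (ha : 0 < a) {z : ℂ} (hz : 0 < z.re) :
    ∫ x in Set.Ioi (0 : ℝ), ((x ^ (a - 1) : ℝ) : ℂ) * Complex.exp (-(2 * Real.pi * z * x)) =
      (Real.Gamma a / Real.pi ^ a : ℝ) * ((2 * z) ^ (a : ℂ))⁻¹ := by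
  set U : Set ℂ := {w : ℂ | 0 < w.re} with hU
  have hUo : IsOpen U := isOpen_lt continuous_const Complex.continuous_re
  have hf : AnalyticOnNhd ℂ (fun z : ℂ =>
      ∫ x in Set.Ioi (0 : ℝ), ((x ^ (a - 1) : ℝ) : ℂ) * Complex.exp (-(2 * Real.pi * z * x))) U := by
    refine DifferentiableOn.analyticOnNhd (fun w hw => ?_) hUo
    have hw0 : 0 < w.re := hw
    have h1 : 0 < (2 * Real.pi * w : ℂ).re := by
      have : (2 * Real.pi * w : ℂ) = ((2 * Real.pi : ℝ) : ℂ) * w := by push_cast; ring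
      rw [this, Complex.re_ofReal_mul]
      positivity
    exact ((differentiableAt_integral_rpow_mul_cexp (s := a - 1) (by linarith) h1).comp w
      (g := fun z : ℂ => ∫ x in Set.Ioi (0 : ℝ), ((x ^ (a - 1) : ℝ) : ℂ) * Complex.exp (-(z * x)))
      (f := fun z : ℂ => 2 * Real.pi * z) (by fun_prop)).differentiableWithinAt
  have hg : AnalyticOnNhd ℂ (fun z : ℂ =>
      (Real.Gamma a / Real.pi ^ a : ℝ) * ((2 * z) ^ (a : ℂ))⁻¹) U := by
    refine DifferentiableOn.analyticOnNhd (fun w hw => ?_) hUo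
    have hw0 : 0 < (2 * w).re := by
      have : 0 < w.re := hw
      simpa using this
    have hs : 2 * w ∈ Complex.slitPlane := Or.inl hw0
    have hne : (2 * w) ^ (a : ℂ) ≠ 0 := by
      rw [Complex.cpow_ne_zero_iff]
      exact Or.inl (Complex.slitPlane_ne_zero hs)
    refine DifferentiableAt.differentiableWithinAt ?_
    have hp : DifferentiableAt ℂ (fun z : ℂ => (2 * z) ^ (a : ℂ)) w :=
      DifferentiableAt.cpow (by fun_prop) (by fun_prop) hs
    exact (hp.inv hne).const_mul _
  have h1 : (1 : ℂ) ∈ U := by simp [hU]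
  -- Identity theorem on the right half-plane: both sides are analytic, and on the positive reals
  -- near 1 the formula is the real Gamma integral.
  refine hf.eqOn_of_preconnected_of_frequently_eq hg (convex_halfSpace_re_gt 0).isPreconnected h1
    ?_ hz
  have hreal : ∀ r : ℝ, 0 < r →
      ∫ x in Set.Ioi (0 : ℝ), ((x ^ (a - 1) : ℝ) : ℂ) * Complex.exp (-(2 * Real.pi * r * x)) =
        (Real.Gamma a / Real.pi ^ a : ℝ) * ((2 * r : ℂ) ^ (a : ℂ))⁻¹ := by
    intro r hr
    have h2 := Real.integral_rpow_mul_exp_neg_mul_Ioi ha (r := 2 * Real.pi * r) (by positivity)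
    have h3 : ∀ x : ℝ, ((x ^ (a - 1) : ℝ) : ℂ) * Complex.exp (-(2 * Real.pi * r * x)) =
        ((x ^ (a - 1) * Real.exp (-(2 * Real.pi * r * x)) : ℝ) : ℂ) := by
      intro x
      push_cast
      rfl
    simp_rw [h3]
    rw [integral_complex_ofReal, h2]
    have h4 : ((2 * r : ℂ) ^ (a : ℂ)) = (((2 * r) ^ a : ℝ) : ℂ) := by
      rw [Complex.ofReal_cpow (by positivity)]
      push_cast
      rfl
    rw [h4, ← Complex.ofReal_inv, ← Complex.ofReal_mul]
    congr 1
    have h5 : (2 * Real.pi * r) = Real.pi * (2 * r) := by ring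
    rw [h5, one_div, Real.inv_rpow (by positivity), Real.mul_rpow (by positivity) (by positivity),
      mul_inv]
    ring
  have ht : Filter.Tendsto (fun r : ℝ => (r : ℂ)) (nhdsWithin 1 {1}ᶜ) (nhdsWithin 1 {1}ᶜ) := by
    refine tendsto_nhdsWithin_iff.2 ⟨?_, ?_⟩
    · exact (Complex.continuous_ofReal.tendsto' 1 1 (by simp)).mono_left nhdsWithin_le_nhds
    · filter_upwards [self_mem_nhdsWithin] with r hr
      simpa using hr
  refine ht.frequently (Filter.Eventually.frequently ?_)
  filter_upwards [nhdsWithin_le_nhds (lt_mem_nhds (zero_lt_one' ℝ))] with r hr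
  exact hreal r hr

theorem continuous_thetaFactor : Continuous thetaFactor := by
  have h : ∀ u : ℝ, (2 * (1 - u * I)) ∈ Complex.slitPlane := fun u => Or.inl (by simp)
  refine Continuous.inv₀ (continuous_iff_continuousAt.2 fun u => ?_) fun u => ?_
  · exact ContinuousAt.cpow (by fun_prop) continuousAt_const (h u)
  · rw [Complex.cpow_ne_zero_iff]
    exact Or.inl (Complex.slitPlane_ne_zero (h u))

theorem norm_thetaFactor_pow_four_le (u : ℝ) : ‖thetaFactor u‖ ^ 4 ≤ (1 + u ^ 2)⁻¹ := by
  have h : ‖thetaFactor u‖ ^ 4 = (4 * (1 + u ^ 2))⁻¹ := by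
    calc ‖thetaFactor u‖ ^ 4 = (‖thetaFactor u‖ ^ 2) ^ 2 := by ring
      _ = _ := by
        rw [norm_thetaFactor_sq, inv_pow, mul_pow, Real.sq_sqrt (by positivity)]
        norm_num
  rw [h]
  gcongr
  nlinarith [sq_nonneg u]

theorem norm_thetaFactor_le_one (u : ℝ) : ‖thetaFactor u‖ ≤ 1 := by
  refine (pow_le_one_iff_of_nonneg (norm_nonneg _) four_ne_zero).1
    ((norm_thetaFactor_pow_four_le u).trans (inv_le_one_of_one_le₀ ?_))
  nlinarith [sq_nonneg u]

theorem integrable_thetaFactor_pow {d : ℕ} (hd : 5 ≤ d) :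
    Integrable fun u : ℝ => thetaFactor u ^ d := by
  refine integrable_inv_one_add_sq.mono' (continuous_thetaFactor.pow d).aestronglyMeasurable
    (Filter.Eventually.of_forall fun u => ?_)
  rw [norm_pow]
  exact (pow_le_pow_of_le_one (norm_nonneg _) (norm_thetaFactor_le_one u) (by omega)).trans
    (norm_thetaFactor_pow_four_le u)

/-- The singular integral. -/
def singularIntegral (d : ℕ) : ℝ :=
  Real.pi ^ (d / 2 : ℝ) / Real.Gamma (d / 2) * Real.exp (-(2 * Real.pi))

theorem singularIntegral_pos {d : ℕ} (hd : 5 ≤ d) : 0 < singularIntegral d := by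
  have : (0 : ℝ) < d / 2 := by
    have : (5 : ℝ) ≤ d := by exact_mod_cast hd
    linarith
  have := Real.Gamma_pos_of_pos this
  rw [singularIntegral]
  positivity

-- Up to a constant, `thetaFactor (-w) ^ d` is the Fourier transform of `x ^ (d/2 - 1) * exp (-2πx)`
-- on `x > 0`. Fourier inversion at `x = 1` evaluates the integral; it applies since `thetaFactor ^
-- d` is integrable.
open scoped FourierTransform in
theorem integral_thetaFactor_pow {d : ℕ} (hd : 5 ≤ d) :
    ∫ u : ℝ, Complex.exp (-(2 * Real.pi * I * u)) * thetaFactor u ^ d = singularIntegral d := by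
  have hd5 : (5 : ℝ) ≤ d := by exact_mod_cast hd
  have ha : (0 : ℝ) < d / 2 := by linarith
  set a : ℝ := d / 2 with had
  set g : ℝ → ℂ := (Set.Ioi (0 : ℝ)).indicator
    (fun x => ((x ^ (a - 1) : ℝ) : ℂ) * Complex.exp (-((2 * Real.pi : ℝ) * x))) with hg
  have hgi : Integrable g := by
    rw [hg, integrable_indicator_iff measurableSet_Ioi]
    refine integrableOn_rpow_mul_cexp (by linarith) ?_
    rw [Complex.ofReal_re]
    positivity
  set K : ℝ := Real.Gamma a / Real.pi ^ a with hK
  have hΓ := Real.Gamma_pos_of_pos ha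
  have hF : ∀ w : ℝ, 𝓕 g w = K * thetaFactor (-w) ^ d := by
    intro w
    rw [Real.fourier_eq', thetaFactor_pow]
    have h1 := integral_rpow_mul_cexp ha (z := 1 - (-w : ℝ) * I) (by simp)
    have h2 : (a : ℂ) = d / 2 := by rw [had]; push_cast; rfl
    rw [h2] at h1
    rw [← h1, ← integral_indicator measurableSet_Ioi]
    refine integral_congr_ae (Filter.Eventually.of_forall fun x => ?_)
    simp only [hg, Set.indicator_apply]
    split_ifs
    · rw [smul_eq_mul, mul_left_comm, ← Complex.exp_add]
      congr 2
      simp only [RCLike.inner_apply, conj_trivial]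
      push_cast
      ring
    · simp
  have hFi : Integrable (𝓕 g) := by
    have : 𝓕 g = fun w => (K : ℂ) * thetaFactor (-w) ^ d := funext hF
    rw [this]
    exact ((integrable_thetaFactor_pow hd).comp_neg).const_mul _
  have hc : ContinuousAt g 1 := by
    have h1 : ContinuousAt
        (fun x : ℝ => ((x ^ (a - 1) : ℝ) : ℂ) * Complex.exp (-((2 * Real.pi : ℝ) * x))) 1 := by
      refine ContinuousAt.mul ?_ (by fun_prop)
      exact Complex.continuous_ofReal.continuousAt.comp
        (Real.continuousAt_rpow_const 1 _ (Or.inl one_ne_zero))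
    refine h1.congr ?_
    filter_upwards [lt_mem_nhds (zero_lt_one' ℝ)] with x hx
    rw [hg, Set.indicator_of_mem (by exact hx)]
  have h := hgi.fourierInv_fourier_eq hFi hc
  have hg1 : g 1 = (Real.exp (-(2 * Real.pi)) : ℝ) := by
    rw [hg, Set.indicator_of_mem (by simp)]
    push_cast
    simp
  rw [Real.fourierInv_eq', hg1] at h
  have h3 : ∫ u : ℝ, Complex.exp (-(2 * Real.pi * I * u)) * thetaFactor u ^ d =
      (K : ℂ)⁻¹ * ∫ v : ℝ, Complex.exp ((2 * Real.pi * inner ℝ v 1 : ℝ) * I) • 𝓕 g v := by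
    rw [← integral_const_mul, ← integral_neg_eq_self]
    refine integral_congr_ae (Filter.Eventually.of_forall fun v => ?_)
    simp only [hF, RCLike.inner_apply, conj_trivial, smul_eq_mul]
    have hK0 : (K : ℂ) ≠ 0 := by
      have : 0 < K := by positivity
      exact_mod_cast this.ne'
    rw [mul_left_comm, ← mul_assoc ((K : ℂ)⁻¹), inv_mul_cancel₀ hK0, one_mul, one_mul]
    congr 2
    push_cast
    ring
  rw [h3, h, ← Complex.ofReal_inv, ← Complex.ofReal_mul, singularIntegral, hK, inv_div]

/-! ### The circle method for the number of lattice points. -/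

theorem thetaMultiplier_zero (S t : ℝ) : thetaMultiplier S t 0 = ∑' m : ℤ, thetaKernel S t m := by
  rw [thetaMultiplier]
  simp

theorem continuous_thetaKernel (S : ℝ) (m : ℤ) : Continuous fun t => thetaKernel S t m := by
  unfold thetaKernel
  fun_prop

theorem continuous_thetaMultiplier_zero {S : ℝ} (hS : 0 < S) :
    Continuous fun t => thetaMultiplier S t 0 := by
  simp_rw [thetaMultiplier_zero]
  refine continuous_tsum (continuous_thetaKernel S) (summable_norm_thetaKernel hS 0) fun m t => ?_
  rw [norm_thetaKernel, norm_thetaKernel]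

theorem thetaKernel_add_one (S t : ℝ) (m : ℤ) : thetaKernel S (t + 1) m = thetaKernel S t m := by
  rw [thetaKernel, thetaKernel]
  congr 1
  rw [Complex.exp_eq_exp_iff_exists_int]
  exact ⟨m ^ 2, by push_cast; ring⟩

theorem norm_thetaKernelPi_eq {d : ℕ} (S t : ℝ) (m : Fin d → ℤ) :
    ‖thetaKernelPi S t m‖ = ‖thetaKernelPi S 0 m‖ := by
  simp only [thetaKernelPi, norm_prod, norm_thetaKernel]

theorem hasSum_thetaKernelPi {d : ℕ} {S : ℝ} (hS : 0 < S) (t : ℝ) :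
    HasSum (fun m : Fin d → ℤ => thetaKernelPi S t m) (thetaMultiplier S t 0 ^ d) := by
  have h := (hasSum_prod_fin (d := d) (f := fun _ => thetaKernel S t)
    fun _ => summable_norm_thetaKernel hS t).2
  rw [Finset.prod_const, Finset.card_univ, Fintype.card_fin] at h
  rwa [thetaMultiplier_zero]

theorem norm_exp_neg_two_pi_I_mul (n : ℕ) (t : ℝ) :
    ‖Complex.exp (-(2 * Real.pi * I * n * t))‖ = 1 := by
  rw [← norm_exp_two_pi_I_mul (-(n : ℤ)) t]
  congr 2
  push_cast
  ring

/-- The integrand of the circle method for the number of representations of `n` as a sum of `d`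
squares. -/
def circleIntegrand (d n : ℕ) (t : ℝ) : ℂ :=
  Complex.exp (-(2 * Real.pi * I * n * t)) * thetaMultiplier n t 0 ^ d

theorem continuous_circleIntegrand (d : ℕ) {n : ℕ} (hn : 0 < n) :
    Continuous (circleIntegrand d n) := by
  have := continuous_thetaMultiplier_zero (S := n) (by exact_mod_cast hn)
  unfold circleIntegrand
  fun_prop

theorem norm_circleIntegrand (d n : ℕ) (t : ℝ) :
    ‖circleIntegrand d n t‖ = ‖thetaMultiplier n t 0‖ ^ d := by
  rw [circleIntegrand, norm_mul, norm_exp_neg_two_pi_I_mul, one_mul, norm_pow]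

theorem periodic_circleIntegrand (d n : ℕ) : Function.Periodic (circleIntegrand d n) 1 := by
  intro t
  rw [circleIntegrand, circleIntegrand, thetaMultiplier_zero, thetaMultiplier_zero]
  congr 1
  · rw [Complex.exp_eq_exp_iff_exists_int]
    exact ⟨-n, by push_cast; ring⟩
  · simp_rw [thetaKernel_add_one]

/-- With `S = n` the Gaussian factor on the sphere is `exp (-2π)`. By periodicity any interval of
length 1 may be used, which leaves room to place the major arcs. -/
theorem integral_circleIntegrand {d n : ℕ} (hn : 0 < n) (a : ℝ) :
    ∫ t in a..a + 1, circleIntegrand d n t =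
      ((discreteSphereFinset d √n).card * ((√n)⁻¹ ^ d * Real.exp (-(2 * Real.pi))) : ℝ) := by
  have hn0 : (0 : ℝ) < n := by exact_mod_cast hn
  rw [(periodic_circleIntegrand d n).intervalIntegral_add_eq a 0, zero_add]
  set F : (Fin d → ℤ) → ℝ → ℂ := fun m t =>
    Complex.exp (-(2 * Real.pi * I * n * t)) * thetaKernelPi n t m with hF
  have hFc : ∀ m, Continuous (F m) := by
    intro m
    have := continuous_thetaKernelPi n m (d := d)
    fun_prop
  have h1 : ∀ t : ℝ, circleIntegrand d n t = ∑' m, F m t := by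
    intro t
    rw [circleIntegrand, ← (hasSum_thetaKernelPi hn0 t).tsum_eq, tsum_mul_left]
  have h2 := hasSum_integral_of_summable_integral_norm (μ := volume.restrict (Set.Ioc (0 : ℝ) 1))
    (F := F) (fun m => ((hFc m).integrableOn_Icc (a := 0) (b := 1)).mono_set Set.Ioc_subset_Icc_self)
    (by
      refine (summable_norm_thetaKernelPi hn0 0).congr fun m => ?_
      have : ∀ t : ℝ, ‖F m t‖ = ‖thetaKernelPi n 0 m‖ := by
        intro t
        rw [hF, norm_mul, norm_exp_neg_two_pi_I_mul, one_mul, norm_thetaKernelPi_eq]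
      simp_rw [this]
      simp)
  rw [intervalIntegral.integral_of_le zero_le_one]
  simp_rw [h1]
  rw [← h2.tsum_eq]
  have h3 : ∀ m : Fin d → ℤ, ∫ t in Set.Ioc (0 : ℝ) 1, F m t =
      if m ∈ discreteSphereFinset d √n then
        (((√n)⁻¹ ^ d * Real.exp (-(2 * Real.pi)) : ℝ) : ℂ) else 0 := by
    intro m
    rw [← intervalIntegral.integral_of_le zero_le_one, hF, integral_exp_mul_thetaKernelPi]
    simp only [mem_discreteSphereFinset]
    congr 1
    rw [mul_div_assoc, div_self hn0.ne', mul_one]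
    push_cast
    rfl
  simp_rw [h3]
  rw [tsum_eq_sum (s := discreteSphereFinset d √n) fun m hm => if_neg hm,
    Finset.sum_congr rfl fun m hm => if_pos hm, Finset.sum_const, nsmul_eq_mul]
  push_cast
  rfl

theorem norm_thetaMultiplier_le {q : ℕ} [NeZero q] {a : ℤ} (ha : IsCoprime a (q : ℤ)) {u S : ℝ}
    (hS : q ^ 2 * max 1 (u ^ 2) ≤ S) :
    ‖thetaMultiplier S (a / q + u / S) 0‖ ≤ thetaConst * majorBound q u := by
  have hS0 : 0 < S := pos_of_sq_mul_max_le hS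
  have hρ := pi_div_four_le hS
  have h := norm_thetaMultiplier_sub_le hS0 q a u 0 (norm_quadGaussSum_le_sqrt q a ha)
  simp only [mul_zero, round_zero, Int.cast_zero, Complex.ofReal_zero, sub_self, ne_eq,
    OfNat.ofNat_ne_zero, not_false_eq_true, zero_pow, Complex.exp_zero, mul_one] at h
  have h1 : ‖thetaFactor u / q * quadGaussSum q a 0‖ ≤ majorBound q u := by
    rw [norm_mul, norm_div, Complex.norm_natCast, majorBound]
    gcongr
    exact norm_quadGaussSum_le_sqrt q a ha 0
  have h2 : 4 / (Real.pi * S / (2 * q ^ 2) / (1 + u ^ 2)) ≤ 16 / Real.pi := by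
    calc _ ≤ 4 / (Real.pi / 4) := div_le_div_of_nonneg_left (by norm_num) (by positivity) hρ
      _ = _ := by field_simp; norm_num
  have h3 := norm_le_norm_add_norm_sub' (thetaMultiplier S (a / q + u / S) 0)
    (thetaFactor u / q * quadGaussSum q a 0)
  have hZ := intInvSqSum_nonneg
  have hB := majorBound_nonneg q u
  calc _ ≤ _ := h3
    _ ≤ majorBound q u + ‖thetaFactor u‖ / q * (√(2 * q) *
        (4 / (Real.pi * S / (2 * q ^ 2) / (1 + u ^ 2))) * intInvSqSum) := add_le_add h1 h
    _ = majorBound q u + majorBound q u *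
        ((4 / (Real.pi * S / (2 * q ^ 2) / (1 + u ^ 2))) * intInvSqSum) := by
        rw [majorBound]; ring
    _ ≤ majorBound q u + majorBound q u * (16 / Real.pi * intInvSqSum) := by gcongr
    _ = _ := by rw [thetaConst]; ring

/-- The fifth power is `q ^ (-5/2) * (1 + u²) ^ (-5/4)`, and the exponent `-5/4` is relaxed to
`-3/4`. The weight of the maximal theorem thus also dominates the minor arcs. -/
theorem majorBound_pow_le {d : ℕ} (hd : 5 ≤ d) (r : ℚ) (u : ℝ) :
    majorBound r.den u ^ d ≤ arcWeightSqrt r u ^ 2 := by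
  have hq : (1 : ℝ) ≤ r.den := by exact_mod_cast r.den_pos
  have hu : 1 ≤ 1 + u ^ 2 := by nlinarith [sq_nonneg u]
  have hB := majorBound_nonneg r.den u
  have hsq := majorBound_sq r.den u
  have hs : 1 ≤ √(1 + u ^ 2) := Real.one_le_sqrt.2 hu
  have hB1 : majorBound r.den u ≤ 1 := by
    refine (pow_le_one_iff_of_nonneg hB two_ne_zero).1 ?_
    rw [hsq]
    exact inv_le_one_of_one_le₀ (by nlinarith)
  refine (pow_le_pow_of_le_one hB hB1 hd).trans ?_
  have h5 : majorBound r.den u ^ 5 = (majorBound r.den u ^ 2) ^ (5 / 2 : ℝ) := by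
    rw [← Real.rpow_natCast, ← Real.rpow_natCast, ← Real.rpow_mul hB]
    norm_num
  rw [h5, hsq, arcWeightSqrt_sq, Real.inv_rpow (by positivity),
    Real.mul_rpow (by positivity) (by positivity), mul_inv, Real.rpow_neg (by positivity)]
  gcongr
  rw [Real.sqrt_eq_rpow, ← Real.rpow_mul (by positivity), ← Real.rpow_neg (by positivity)]
  exact Real.rpow_le_rpow_of_exponent_le hu (by norm_num)

/-- The weight of the arcs away from the centers of bounded height. -/
def arcTail (M : ℕ) : ℝ≥0∞ :=
  ∑' r : ℚ, ∫⁻ u, if |r| ≤ 1 ∧ (M < r.den ∨ (M : ℝ) < |u|) then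
    ENNReal.ofReal (arcWeightSqrt r u) ^ 2 else 0

/-- Dominated convergence, once in `u` and once in `r`, against the finite `arcMass`: each fixed
`(r, u)` is excluded once `M` is at least `r.den` and `|u|`. -/
theorem tendsto_arcTail : Filter.Tendsto arcTail Filter.atTop (nhds 0) := by
  set b : ℚ → ℝ → ℝ≥0∞ := fun r u =>
    if |r| ≤ 1 then ENNReal.ofReal (arcWeightSqrt r u) ^ 2 else 0 with hb
  set F : ℕ → ℚ → ℝ → ℝ≥0∞ := fun M r u => if |r| ≤ 1 ∧ (M < r.den ∨ (M : ℝ) < |u|) then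
    ENNReal.ofReal (arcWeightSqrt r u) ^ 2 else 0 with hF
  have hFb : ∀ M r u, F M r u ≤ b r u := by
    intro M r u
    simp only [hF, hb]
    split_ifs with h1 h2 h2
    · exact le_rfl
    · exact absurd h1.1 h2
    · exact zero_le
    · exact zero_le
  have hbfin : ∑' r, ∫⁻ u, b r u ≠ ∞ := arcMass_ne_top
  have hF0 : ∀ r u, Filter.Tendsto (fun M => F M r u) Filter.atTop (nhds 0) := by
    intro r u
    refine tendsto_const_nhds.congr' ?_
    filter_upwards [Filter.eventually_ge_atTop (max r.den ⌈|u|⌉₊)] with M hM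
    simp only [hF]
    rw [if_neg]
    rintro ⟨_, h | h⟩
    · exact absurd ((le_max_left _ _).trans hM) (not_le.2 h)
    · have := Nat.ceil_le.1 ((le_max_right _ _).trans hM)
      exact absurd this (not_le.2 h)
  have h1 : ∀ r, Filter.Tendsto (fun M => ∫⁻ u, F M r u) Filter.atTop (nhds 0) := by
    intro r
    have := tendsto_lintegral_of_dominated_convergence (μ := volume) (F := fun M => F M r)
      (f := fun _ => 0) (b r) (fun M => ?_) (fun M => Filter.Eventually.of_forall (hFb M r))
      (ENNReal.ne_top_of_tsum_ne_top hbfin r) (Filter.Eventually.of_forall (hF0 r))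
    · simpa using this
    · have hm := measurable_arcWeightSqrt r
      refine Measurable.ite ?_ (by fun_prop) measurable_const
      by_cases hr : |r| ≤ 1 <;> by_cases hM : M < r.den <;> simp only [hr, hM, true_and, false_and,
        true_or, false_or, Set.ofPred_true, Set.ofPred_false, MeasurableSet.univ, MeasurableSet.empty]
      exact measurableSet_lt (f := fun _ : ℝ => (M : ℝ)) measurable_const (by fun_prop)
  have h2 := tendsto_lintegral_of_dominated_convergence (μ := (Measure.count : Measure ℚ))
    (F := fun M r => ∫⁻ u, F M r u) (f := fun _ => 0) (fun r => ∫⁻ u, b r u)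
    (fun M => measurable_of_countable _)
    (fun M => Filter.Eventually.of_forall fun r => lintegral_mono (hFb M r))
    (by rwa [lintegral_count]) (Filter.Eventually.of_forall h1)
  simp only [lintegral_count, tsum_zero] at h2
  exact h2

/-- The minor arc contribution. -/
theorem lintegral_minorArcs_le {d : ℕ} (hd : 5 ≤ d) {n M Q : ℕ} (hn : 0 < n) (hQ : Q ≠ 0)
    (hM : ∀ q : ℕ, 0 < q → q ≤ M → q ∣ Q) {V : Set ℝ} (hV : MeasurableSet V)
    (hV1 : V ⊆ Set.Icc (-1) 1) (hVQ : ∀ t ∈ V, ∀ b : ℤ, (M : ℝ) / n < |t - b / Q|) :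
    ENNReal.ofReal n * ∫⁻ t in V, ‖circleIntegrand d n t‖ₑ ≤
      ENNReal.ofReal (thetaConst ^ d) * arcTail M := by
  have hn1 : (1 : ℝ) ≤ n := by exact_mod_cast hn
  have hn0 : (0 : ℝ) < n := by linarith
  have h1 : ∫⁻ t in V, ‖circleIntegrand d n t‖ₑ =
      ∫⁻ t in Set.Icc (-1 : ℝ) 1, V.indicator (fun t => ‖circleIntegrand d n t‖ₑ) t := by
    rw [setLIntegral_indicator hV, Set.inter_eq_left.2 hV1]
  rw [h1]
  refine (lintegral_le_tsum_arcs hn1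
    ((continuous_circleIntegrand d hn).measurable.enorm.indicator hV)).trans ?_
  rw [arcTail, ← ENNReal.tsum_mul_left]
  refine ENNReal.tsum_le_tsum fun r => ?_
  rw [← lintegral_const_mul' _ _ ENNReal.ofReal_ne_top]
  refine lintegral_mono fun u => ?_
  by_cases hu : |r| ≤ 1 ∧ (r.den : ℝ) ^ 2 * max 1 (u ^ 2) ≤ n
  swap
  · rw [Set.indicator_of_notMem (by exact hu)]
    exact zero_le
  rw [Set.indicator_of_mem (by exact hu)]
  simp only
  by_cases ht : (r + u / n : ℝ) ∈ V
  swap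
  · rw [Set.indicator_of_notMem ht]
    exact zero_le
  -- A denominator at most `M` divides `Q`, so `r` is some `b / Q`. Then `|u| ≤ M` would place `t`
  -- within `M / n` of `b / Q`.
  have hfar : M < r.den ∨ (M : ℝ) < |u| := by
    by_contra hcon
    push Not at hcon
    obtain ⟨k, hk⟩ := hM r.den r.den_pos hcon.1
    have hq0 : (r.den : ℝ) ≠ 0 := by exact_mod_cast r.den_ne_zero
    have hQ0 : (Q : ℝ) ≠ 0 := by exact_mod_cast hQ
    have hk0 : (k : ℝ) ≠ 0 := by
      rintro h
      rw [Nat.cast_eq_zero] at h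
      rw [h, mul_zero] at hk
      exact hQ hk
    have h3 := hVQ _ ht (r.num * k)
    have h4 : (r : ℝ) = ((r.num * k : ℤ) : ℝ) / Q := by
      rw [hk, Rat.cast_def]
      push_cast
      field_simp
    rw [← h4, add_sub_cancel_left, abs_div, abs_of_pos hn0, div_lt_div_iff_of_pos_right hn0] at h3
    linarith [hcon.2]
  rw [Set.indicator_of_mem ht, if_pos ⟨hu.1, hfar⟩, ← ofReal_norm,
    ← ENNReal.ofReal_pow (arcWeightSqrt_pos r u).le, ← ENNReal.ofReal_mul (by
      have := one_le_thetaConst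
      positivity), norm_circleIntegrand]
  refine ENNReal.ofReal_le_ofReal ?_
  have hcop : IsCoprime r.num (r.den : ℤ) := by
    rw [Int.isCoprime_iff_gcd_eq_one]
    exact r.reduced
  have h5 := norm_thetaMultiplier_le hcop hu.2
  rw [← Rat.cast_def] at h5
  have := one_le_thetaConst
  calc _ ≤ (thetaConst * majorBound r.den u) ^ d := by gcongr
    _ = thetaConst ^ d * majorBound r.den u ^ d := mul_pow _ _ _
    _ ≤ _ := by
      gcongr
      exact majorBound_pow_le hd r u

theorem ZMod.sum_eq_sum_range {Q : ℕ} [NeZero Q] (f : ZMod Q → ℂ) :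
    ∑ b, f b = ∑ b ∈ Finset.range Q, f (b : ZMod Q) := by
  refine Finset.sum_nbij' ZMod.val Nat.cast ?_ ?_ ?_ ?_ ?_
  · exact fun b _ => Finset.mem_range.2 (ZMod.val_lt b)
  · exact fun b _ => Finset.mem_univ _
  · exact fun b _ => ZMod.natCast_zmod_val b
  · exact fun b hb => ZMod.val_cast_of_lt (Finset.mem_range.1 hb)
  · intro b _
    rw [ZMod.natCast_zmod_val]

theorem arcTail_ne_top (M : ℕ) : arcTail M ≠ ∞ := by
  refine ne_top_of_le_ne_top arcMass_ne_top
    (ENNReal.tsum_le_tsum fun r => lintegral_mono fun u => ?_)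
  simp only
  split_ifs with h1 h2 h2
  · exact le_rfl
  · exact absurd h1.1 h2
  · exact zero_le
  · exact zero_le

/-- The truncated singular integral. -/
def truncatedIntegral (d M : ℕ) : ℂ :=
  ∫ u in -(M : ℝ)..M, Complex.exp (-(2 * Real.pi * I * u)) * thetaFactor u ^ d

theorem tendsto_truncatedIntegral {d : ℕ} (hd : 5 ≤ d) :
    Filter.Tendsto (truncatedIntegral d) Filter.atTop (nhds (singularIntegral d)) := by
  rw [← integral_thetaFactor_pow hd]
  refine intervalIntegral_tendsto_integral ?_
    (Filter.tendsto_neg_atTop_atBot.comp tendsto_natCast_atTop_atTop) tendsto_natCast_atTop_atTop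
  refine (integrable_thetaFactor_pow hd).bdd_mul (c := 1)
    (Continuous.aestronglyMeasurable (by fun_prop)) (Filter.Eventually.of_forall fun u => ?_)
  have := norm_exp_neg_two_pi_I_mul 1 u
  rw [Nat.cast_one, mul_one] at this
  exact this.le

/-- The circle integrand on a major arc. -/
theorem norm_circleIntegrand_sub_le (d M Q : ℕ) [NeZero Q] :
    ∃ K : ℝ, 0 ≤ K ∧ ∀ n : ℕ, 0 < n → ∀ b : ℕ, ∀ u : ℝ, |u| ≤ M →
      ‖circleIntegrand d n (b / Q + u / n) -
        (ZMod.stdAddChar (-((b : ZMod Q) * (n : ZMod Q))) * (quadGaussSum Q (b : ZMod Q) 0 / Q) ^ d) *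
        (Complex.exp (-(2 * Real.pi * I * u)) * thetaFactor u ^ d)‖ ≤ K / n := by
  have hQ : (0 : ℝ) < Q := by exact_mod_cast Nat.pos_of_ne_zero (NeZero.ne Q)
  have hZ := intInvSqSum_nonneg
  set E : ℝ := 8 * Q ^ 2 * (1 + M ^ 2) / Real.pi * intInvSqSum with hE
  have hE0 : 0 ≤ E := by positivity
  refine ⟨d * (1 + E) ^ d * E, by positivity, fun n hn b u hu => ?_⟩
  have hn1 : (1 : ℝ) ≤ n := by exact_mod_cast hn
  have hn0 : (0 : ℝ) < n := by linarith
  set α := thetaMultiplier n (b / Q + u / n) 0 with hα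
  set β := thetaFactor u / Q * quadGaussSum Q (b : ZMod Q) 0 with hβ
  have hβ1 : ‖β‖ ≤ 1 := by
    rw [hβ, norm_mul, norm_div, Complex.norm_natCast, div_mul_eq_mul_div, div_le_one hQ]
    calc _ ≤ 1 * (Q : ℝ) := mul_le_mul (norm_thetaFactor_le_one u) (norm_quadGaussSum_le Q _ 0)
          (norm_nonneg _) zero_le_one
      _ = Q := one_mul _
  have hαβ : ‖α - β‖ ≤ E / n := by
    -- Here `b / Q` need not be in lowest terms, so only the trivial bound on the Gauss sum is
    -- available. The loss goes into `K`, which may depend on `Q` and `M` but not on `n`.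
    have h := norm_thetaMultiplier_sub_le hn0 Q (b : ℤ) u 0 (norm_quadGaussSum_le Q _)
    simp only [mul_zero, round_zero, Int.cast_zero, Complex.ofReal_zero, sub_self, ne_eq,
      OfNat.ofNat_ne_zero, not_false_eq_true, zero_pow, Complex.exp_zero, mul_one,
      Int.cast_natCast] at h
    refine h.trans ?_
    have hu2 : u ^ 2 ≤ M ^ 2 := sq_le_sq' (abs_le.1 hu).1 (abs_le.1 hu).2
    calc _ ≤ 1 / Q * (Q * (4 / (Real.pi * n / (2 * Q ^ 2) / (1 + M ^ 2))) * intInvSqSum) := by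
          gcongr
          exact norm_thetaFactor_le_one u
      _ = E / n := by
          rw [hE]
          field_simp
          ring
  have hEn : E / n ≤ E := div_le_self hE0 hn1
  have hpow : ‖α ^ d - β ^ d‖ ≤ d * (1 + E) ^ d * (E / n) := by
    have h := norm_prod_sub_prod_le (d := d) (a := fun _ => α) (b := fun _ => β) (R := 1 + E)
      (ε := E / n) (by positivity) (fun _ => ?_) (fun _ => by linarith) (fun _ => ?_)
    · simpa using h
    · have := norm_le_norm_add_norm_sub' α β
      linarith
    · refine hαβ.trans (le_mul_of_one_le_left (by positivity) (by linarith))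
  have hexp : Complex.exp (-(2 * Real.pi * I * n * (b / Q + u / n : ℝ))) =
      ZMod.stdAddChar (-((b : ZMod Q) * (n : ZMod Q))) * Complex.exp (-(2 * Real.pi * I * u)) := by
    have h1 : (-((b : ZMod Q) * (n : ZMod Q))) = ((-(b * n) : ℤ) : ZMod Q) := by push_cast; ring
    rw [h1, ZMod.stdAddChar_coe, ← Complex.exp_add]
    congr 1
    have : (n : ℂ) ≠ 0 := by exact_mod_cast hn.ne'
    push_cast
    field_simp
    ring
  rw [circleIntegrand, hexp, ← hα]
  have e : ZMod.stdAddChar (-((b : ZMod Q) * (n : ZMod Q))) * Complex.exp (-(2 * Real.pi * I * u)) *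
      α ^ d - (ZMod.stdAddChar (-((b : ZMod Q) * (n : ZMod Q))) *
        (quadGaussSum Q (b : ZMod Q) 0 / Q) ^ d) *
        (Complex.exp (-(2 * Real.pi * I * u)) * thetaFactor u ^ d) =
      ZMod.stdAddChar (-((b : ZMod Q) * (n : ZMod Q))) * Complex.exp (-(2 * Real.pi * I * u)) *
        (α ^ d - β ^ d) := by
    rw [hβ, mul_pow, div_pow, div_pow]
    ring
  have h1 := norm_exp_neg_two_pi_I_mul 1 u
  rw [Nat.cast_one, mul_one] at h1
  rw [e, norm_mul, norm_mul, h1, ZMod.stdAddChar_apply, Circle.norm_coe, one_mul, one_mul]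
  exact hpow.trans_eq (by ring)

/-- The contribution of the major arcs. -/
theorem norm_sum_majorArcs_sub_le (d M Q : ℕ) [NeZero Q] :
    ∃ K : ℝ, 0 ≤ K ∧ ∀ n : ℕ, 0 < n →
      ‖n * (∑ b ∈ Finset.range Q, ∫ t in (b / Q + -(M : ℝ) / n)..(b / Q + (M : ℝ) / n),
        circleIntegrand d n t) - localDensity d Q n * truncatedIntegral d M‖ ≤ K / n := by
  obtain ⟨K, hK0, hK⟩ := norm_circleIntegrand_sub_le d M Q
  refine ⟨Q * (K * (2 * M)), by positivity, fun n hn => ?_⟩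
  have hn0 : (0 : ℝ) < n := by exact_mod_cast hn
  rw [localDensity_eq_sum, ZMod.sum_eq_sum_range, Finset.mul_sum, Finset.sum_mul,
    ← Finset.sum_sub_distrib]
  have hM : -(M : ℝ) ≤ M := by
    have : (0 : ℝ) ≤ M := by positivity
    linarith
  have hcont := continuous_circleIntegrand d hn
  have hb : ∀ b ∈ Finset.range Q,
      ‖n * (∫ t in (b / Q + -(M : ℝ) / n)..(b / Q + (M : ℝ) / n), circleIntegrand d n t) -
      (ZMod.stdAddChar (-((b : ZMod Q) * (n : ZMod Q))) * (quadGaussSum Q (b : ZMod Q) 0 / Q) ^ d) *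
        truncatedIntegral d M‖ ≤ K / n * (2 * M) := by
    intro b _
    have h1 := intervalIntegral.integral_comp_add_div (a := -(M : ℝ)) (b := M)
      (circleIntegrand d n) hn0.ne' (b / Q)
    have h2 : (n : ℂ) * (∫ t in (b / Q + -(M : ℝ) / n)..(b / Q + (M : ℝ) / n),
        circleIntegrand d n t) = ∫ u in -(M : ℝ)..M, circleIntegrand d n (b / Q + u / n) := by
      rw [h1, Complex.real_smul]
      push_cast
      rfl
    rw [h2, truncatedIntegral, ← intervalIntegral.integral_const_mul,
      ← intervalIntegral.integral_sub]
    · have h3 := intervalIntegral.norm_integral_le_of_norm_le_const (a := -(M : ℝ)) (b := M)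
        (C := K / n) (f := fun u : ℝ => circleIntegrand d n (b / Q + u / n) -
          (ZMod.stdAddChar (-((b : ZMod Q) * (n : ZMod Q))) *
            (quadGaussSum Q (b : ZMod Q) 0 / Q) ^ d) *
          (Complex.exp (-(2 * Real.pi * I * u)) * thetaFactor u ^ d)) fun u hu => by
        rw [Set.uIoc_of_le hM] at hu
        exact hK n hn b u (abs_le.2 ⟨hu.1.le, hu.2⟩)
      refine h3.trans_eq ?_
      rw [sub_neg_eq_add, ← two_mul, abs_of_nonneg (by positivity)]
    · refine Continuous.intervalIntegrable ?_ _ _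
      fun_prop
    · refine Continuous.intervalIntegrable ?_ _ _
      have := continuous_thetaFactor
      fun_prop
  refine (norm_sum_le_of_le _ hb).trans_eq ?_
  rw [Finset.sum_const, Finset.card_range, nsmul_eq_mul]
  ring

/-- The circle method: splitting into major and minor arcs. -/
theorem norm_integral_circleIntegrand_sub_le {d : ℕ} (hd : 5 ≤ d) {n M Q : ℕ} (hn : 0 < n)
    (hQ : Q ≠ 0) (hM : ∀ q : ℕ, 0 < q → q ≤ M → q ∣ Q) (hMn : Q * ((M : ℝ) / n) < 1 / 2) :
    ‖n * (∫ t in (-(1 / (2 * Q)) : ℝ)..-(1 / (2 * Q)) + 1, circleIntegrand d n t) -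
      n * (∑ b ∈ Finset.range Q, ∫ t in (b / Q + -(M : ℝ) / n)..(b / Q + (M : ℝ) / n),
        circleIntegrand d n t)‖ ≤ thetaConst ^ d * (arcTail M).toReal := by
  have hQ0 : (0 : ℝ) < Q := by exact_mod_cast Nat.pos_of_ne_zero hQ
  have hn0 : (0 : ℝ) < n := by exact_mod_cast hn
  have hQ1 : (1 : ℝ) ≤ Q := by exact_mod_cast Nat.pos_of_ne_zero hQ
  have hx0 : 0 ≤ (M : ℝ) / n := by positivity
  set x : ℝ := (M : ℝ) / n with hx
  set F := circleIntegrand d n with hF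
  have hFc : Continuous F := continuous_circleIntegrand d hn
  -- The period starts at `-1/(2Q)`, so the arcs around `b / Q` with `0 ≤ b < Q` fit inside without
  -- wrapping. Their half-width below `1/(2Q)` also makes them disjoint.
  set W : Set ℝ := Set.Ioc (-(1 / (2 * Q))) (-(1 / (2 * Q)) + 1) with hW
  set A : ℕ → Set ℝ := fun b => Set.Icc (b / Q - x) (b / Q + x) with hA
  have hAiff : ∀ (b : ℤ) (t : ℝ), |t - b / Q| ≤ x ↔ |Q * t - b| ≤ Q * x := by
    intro b t
    have : Q * t - b = Q * (t - b / Q) := by field_simp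
    rw [this, abs_mul, abs_of_pos hQ0, mul_le_mul_iff_right₀ hQ0]
  have hAmem : ∀ (b : ℕ) (t : ℝ), t ∈ A b ↔ |Q * t - b| ≤ Q * x := by
    intro b t
    have := hAiff b t
    rw [Int.cast_natCast] at this
    rw [← this, hA, Set.mem_Icc, abs_le]
    constructor <;> rintro ⟨h1, h2⟩ <;> constructor <;> linarith
  have hWmem : ∀ t : ℝ, t ∈ W ↔ -(1 / 2) < Q * t ∧ Q * t ≤ Q - 1 / 2 := by
    intro t
    have e1 : (-(1 / (2 * Q)) : ℝ) = -(1 / 2) / Q := by field_simp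
    have e2 : (-(1 / 2) / Q + 1 : ℝ) = (Q - 1 / 2) / Q := by field_simp; ring
    rw [hW, Set.mem_Ioc, e1, e2, div_lt_iff₀ hQ0, le_div_iff₀ hQ0, mul_comm t]
  have hAW : ∀ b ∈ Finset.range Q, A b ⊆ W := by
    intro b hb t ht
    rw [hAmem, abs_le] at ht
    rw [hWmem]
    have h1 : (b : ℝ) + 1 ≤ Q := by exact_mod_cast Finset.mem_range.1 hb
    have h2 : (0 : ℝ) ≤ b := by positivity
    constructor <;> linarith [ht.1, ht.2]
  have hdisj : Set.Pairwise (Finset.range Q : Set ℕ) (Function.onFun Disjoint A) := by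
    intro b _ b' _ hne
    rw [Function.onFun, Set.disjoint_left]
    intro t h1 h2
    rw [hAmem, abs_le] at h1 h2
    rcases lt_or_gt_of_ne hne with h | h
    · have : (b : ℝ) + 1 ≤ b' := by exact_mod_cast h
      linarith [h1.1, h1.2, h2.1, h2.2]
    · have : (b' : ℝ) + 1 ≤ b := by exact_mod_cast h
      linarith [h1.1, h1.2, h2.1, h2.2]
  set U : Set ℝ := ⋃ b ∈ Finset.range Q, A b with hU
  have hUm : MeasurableSet U :=
    Finset.measurableSet_biUnion _ fun b _ => measurableSet_Icc
  have hUW : U ⊆ W := Set.iUnion₂_subset hAW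
  have h_int : IntegrableOn F W := hFc.integrableOn_Icc.mono_set Set.Ioc_subset_Icc_self
  have hUint : ∫ t in U, F t = ∑ b ∈ Finset.range Q,
      ∫ t in (b / Q + -(M : ℝ) / n)..(b / Q + (M : ℝ) / n), F t := by
    rw [hU, integral_biUnion_finset _ (fun b _ => measurableSet_Icc) hdisj
      fun b _ => hFc.integrableOn_Icc]
    refine Finset.sum_congr rfl fun b _ => ?_
    rw [neg_div, ← sub_eq_add_neg, ← hx, intervalIntegral.integral_of_le (by linarith),
      integral_Icc_eq_integral_Ioc]
  have hsplit : ∫ t in (-(1 / (2 * Q)) : ℝ)..-(1 / (2 * Q)) + 1, F t =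
      (∫ t in U, F t) + ∫ t in W \ U, F t := by
    rw [intervalIntegral.integral_of_le (by linarith), ← hW,
      ← integral_inter_add_sdiff hUm h_int, Set.inter_eq_right.2 hUW]
  rw [hsplit, hUint, ← mul_sub, add_sub_cancel_left]
  have hminor := lintegral_minorArcs_le hd hn hQ hM (V := W \ U) (measurableSet_Ioc.diff hUm)
    (fun t ht => by
      have h1 := (hWmem t).1 ht.1
      constructor
      · by_contra h
        push Not at h
        nlinarith
      · by_contra h
        push Not at h
        nlinarith)
    (fun t ht b => by
      by_contra h
      push Not at h
      rw [← hx, hAiff] at h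
      have h1 := (hWmem t).1 ht.1
      have h2 := abs_le.1 h
      have hb0 : (-1 : ℝ) < b := by linarith
      have hb1 : (b : ℝ) < Q := by linarith
      have hb0' : 0 ≤ b := by
        have : (-1 : ℤ) < b := by exact_mod_cast hb0
        omega
      lift b to ℕ using hb0'
      rw [Int.cast_natCast] at h hb1
      refine ht.2 (Set.mem_iUnion₂.2 ⟨b, Finset.mem_range.2 (by exact_mod_cast hb1), ?_⟩)
      rwa [hAmem])
  have hD := one_le_thetaConst
  have h1 : ‖(n : ℂ) * ∫ t in W \ U, F t‖ₑ ≤ ENNReal.ofReal (thetaConst ^ d) * arcTail M := by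
    refine le_trans ?_ hminor
    rw [enorm_mul]
    have : ‖(n : ℂ)‖ₑ = ENNReal.ofReal n := by rw [← ofReal_norm, Complex.norm_natCast]
    rw [this]
    gcongr
    exact enorm_integral_le_lintegral_enorm _
  rw [← toReal_enorm]
  refine (ENNReal.toReal_mono (ENNReal.mul_ne_top ENNReal.ofReal_ne_top (arcTail_ne_top M))
    h1).trans_eq ?_
  rw [ENNReal.toReal_mul, ENNReal.toReal_ofReal (by positivity)]

/-- The number of lattice points on the sphere of radius `√n` is at least a multiple of
`n ^ (d / 2 - 1)` for large `n`. -/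
theorem card_discreteSphereFinset_lower_bound {d : ℕ} (hd : 5 ≤ d) :
    ∃ c : ℝ, 0 < c ∧ ∃ n₀ : ℕ, ∀ n ≥ n₀, c * √n ^ d ≤ n * (discreteSphereFinset d √n).card := by
  have hJ := singularIntegral_pos hd
  set J := singularIntegral d with hJdef
  have hD := one_le_thetaConst
  have hD0 : 0 < thetaConst ^ d := by positivity
  have h1 : ∀ᶠ M in Filter.atTop, ‖truncatedIntegral d M - J‖ < J / 4 := by
    have := (tendsto_truncatedIntegral hd).eventually (Metric.ball_mem_nhds _ (by positivity : 0 < J / 4))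
    simpa only [Metric.mem_ball, dist_eq_norm] using this
  have h2 : ∀ᶠ M in Filter.atTop, thetaConst ^ d * (arcTail M).toReal < J / 128 := by
    have h3 := (ENNReal.tendsto_toReal ENNReal.zero_ne_top).comp tendsto_arcTail
    have h4 := h3.const_mul (thetaConst ^ d)
    rw [ENNReal.toReal_zero, mul_zero] at h4
    exact h4.eventually_lt_const (by positivity)
  -- `M` is fixed first, from the singular integral and the minor arcs alone; `Q = M!` and the
  -- threshold for `n` follow. This works because the lower bound on the local density is uniform in
  -- `Q` and `n`.
  obtain ⟨M, hM1, hM2⟩ := (h1.and h2).exists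
  have hQ : M.factorial ≠ 0 := Nat.factorial_ne_zero M
  set Q := M.factorial with hQdef
  have : NeZero Q := ⟨hQ⟩
  obtain ⟨K, hK0, hK⟩ := norm_sum_majorArcs_sub_le d M Q
  obtain ⟨n₁, hn₁⟩ := exists_nat_gt (K / (J / 128))
  obtain ⟨n₂, hn₂⟩ := exists_nat_gt (2 * (Q * M : ℝ))
  refine ⟨J / 32 * Real.exp (2 * Real.pi), by positivity, max (max n₁ n₂) 1, fun n hn => ?_⟩
  have hnpos : 0 < n := lt_of_lt_of_le one_pos ((le_max_right _ _).trans hn)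
  have hn0 : (0 : ℝ) < n := by exact_mod_cast hnpos
  have hn1' : (n₁ : ℝ) ≤ n := by exact_mod_cast (le_max_left _ _).trans ((le_max_left _ _).trans hn)
  have hn2' : (n₂ : ℝ) ≤ n := by exact_mod_cast (le_max_right _ _).trans ((le_max_left _ _).trans hn)
  have hKn : K / n ≤ J / 128 := by
    rw [div_lt_iff₀ (by positivity)] at hn₁
    rw [div_le_iff₀ hn0]
    nlinarith
  have hMn : Q * ((M : ℝ) / n) < 1 / 2 := by
    rw [← mul_div_assoc, div_lt_div_iff₀ hn0 two_pos]
    linarith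
  have e1 := norm_integral_circleIntegrand_sub_le hd hnpos hQ
    (fun q hq hqM => Nat.dvd_factorial hq hqM) hMn
  have e2 := hK n hnpos
  rw [integral_circleIntegrand hnpos] at e1
  have hL := localDensity_lower_bound hd Q n
  set L := localDensity d Q n with hLdef
  set X : ℝ := n * ((discreteSphereFinset d √n).card *
    ((√n)⁻¹ ^ d * Real.exp (-(2 * Real.pi)))) with hX
  have e3 : ‖((X - L * J : ℝ) : ℂ)‖ ≤ J / 128 + J / 128 + L * (J / 4) := by
    have e4 : ‖(L : ℂ) * (truncatedIntegral d M - J)‖ ≤ L * (J / 4) := by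
      rw [norm_mul, Complex.norm_real, Real.norm_of_nonneg (by linarith)]
      gcongr
    refine le_trans (le_of_eq ?_) ((norm_add₃_le).trans
      (add_le_add (add_le_add (e1.trans hM2.le) (e2.trans hKn)) e4))
    congr 1
    rw [hX]
    push_cast
    ring
  rw [Complex.norm_real, Real.norm_eq_abs] at e3
  have e5 := (abs_le.1 e3).1
  -- `X ≥ (3/4) L J - J/64` and `L ≥ 1/16` give `3J/64 - J/64`.
  have e6 : J / 32 ≤ X := by nlinarith
  have hs : 0 < √(n : ℝ) := Real.sqrt_pos.2 hn0
  have e7 : X * (√n ^ d * Real.exp (2 * Real.pi)) = n * (discreteSphereFinset d √n).card := by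
    rw [hX, Real.exp_neg, inv_pow]
    field_simp
  rw [← e7]
  calc _ = J / 32 * (√n ^ d * Real.exp (2 * Real.pi)) := by ring
    _ ≤ _ := by gcongr

theorem exists_le_card_discreteSphereFinset {d : ℕ} (hd : 5 ≤ d) :
    ∃ c : ℝ, 0 < c ∧ ∀ n : ℕ, 0 < n → (discreteSphereFinset d √n).card ≠ 0 →
      c * √n ^ d ≤ n * (discreteSphereFinset d √n).card := by
  obtain ⟨c, hc, n₀, h⟩ := card_discreteSphereFinset_lower_bound hd
  -- The finitely many small `n` are covered by the trivial bound `N ≥ 1`.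
  refine ⟨min c (√n₀ ^ d + 1)⁻¹, lt_min hc (by positivity), fun n hn hN => ?_⟩
  rcases le_or_gt n₀ n with hle | hlt
  · exact (mul_le_mul_of_nonneg_right (min_le_left _ _) (by positivity)).trans (h n hle)
  · have h1 : √(n : ℝ) ^ d ≤ √n₀ ^ d + 1 := by
      have : √(n : ℝ) ^ d ≤ √n₀ ^ d := by gcongr
      linarith
    have h2 : (1 : ℝ) ≤ n * (discreteSphereFinset d √n).card := by
      exact_mod_cast Nat.mul_pos hn (Nat.pos_of_ne_zero hN)
    refine le_trans ?_ h2
    calc _ ≤ (√n₀ ^ d + 1)⁻¹ * √n ^ d := by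
          gcongr
          exact min_le_right _ _
      _ ≤ (√n₀ ^ d + 1)⁻¹ * (√n₀ ^ d + 1) := by gcongr
      _ = 1 := inv_mul_cancel₀ (by positivity)

/-! ### From sums to averages, and from finite support to all functions. -/

theorem ofReal_abs_sphericalAverage {d : ℕ} (lam : ℝ) (f : (Fin d → ℤ) → ℝ) (x : Fin d → ℤ) :
    ENNReal.ofReal |sphericalAverage lam f x| =
      ENNReal.ofReal ((discreteSphereFinset d lam).card : ℝ)⁻¹ *
        ‖∑ m ∈ discreteSphereFinset d lam, (f (x - m) : ℂ)‖ₑ := by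
  rw [sphericalAverage, abs_mul, abs_of_nonneg (by positivity),
    ENNReal.ofReal_mul (by positivity), ← Complex.ofReal_sum, ← ofReal_norm, Complex.norm_real,
    Real.norm_eq_abs]

theorem sphericalAverage_zero {d : ℕ} (f : (Fin d → ℤ) → ℝ) (x : Fin d → ℤ) :
    sphericalAverage 0 f x = f x := by
  have h : discreteSphereFinset d 0 = {0} := by
    ext m
    have := mem_discreteSphereFinset (n := 0) m
    rw [Nat.cast_zero, Real.sqrt_zero] at this
    rw [this, Finset.mem_singleton, Nat.cast_zero,
      Finset.sum_eq_zero_iff_of_nonneg fun i _ => sq_nonneg _]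
    simp [funext_iff]
  rw [sphericalAverage, h]
  simp

theorem exists_sphericalAverage_le {d : ℕ} (hd : 5 ≤ d) :
    ∃ C : ℝ≥0, ∀ (s : Finset (Fin d → ℤ)) (f : (Fin d → ℤ) → ℝ), (∀ n ∉ s, f n = 0) →
      ∀ (n : ℕ), 0 < n → ∀ x, ENNReal.ofReal |sphericalAverage √n f x| ≤
        C * circleMaximal (fun y => (f y : ℂ)) x := by
  obtain ⟨c, hc, h⟩ := exists_le_card_discreteSphereFinset hd
  refine ⟨(4 * Real.exp (8 * Real.pi) / c).toNNReal, fun s f hf n hn x => ?_⟩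
  rw [ofReal_abs_sphericalAverage]
  set N := (discreteSphereFinset d √n).card with hN
  rcases eq_or_ne N 0 with hN0 | hN0
  · rw [hN0]
    simp
  have hNpos : (0 : ℝ) < N := by exact_mod_cast Nat.pos_of_ne_zero hN0
  have hlow := h n hn hN0
  -- The block with `4 ^ j ≤ n < 4 ^ (j + 1)`: the upper end feeds `enorm_sum_sphere_le`, and both
  -- ends make `4 ^ j` comparable to `n` in the count.
  set j := Nat.log 4 n with hj
  have hj1 : 4 ^ j ≤ n := Nat.pow_log_le_self 4 hn.ne'
  have hj2 : n < 4 ^ (j + 1) := Nat.lt_pow_succ_log_self (by norm_num) n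
  have hup := enorm_sum_sphere_le (f := fun y => (f y : ℂ)) (s := s)
    (fun y hy => by rw [hf y hy, Complex.ofReal_zero]) hj2 x
  have hj1' : (4 : ℝ) ^ j ≤ n := by exact_mod_cast hj1
  have hj2' : (n : ℝ) ≤ 4 * 4 ^ j := by
    rw [← pow_succ']
    exact_mod_cast hj2.le
  have h4 : (0 : ℝ) < 4 ^ j := by positivity
  have hbound : (N : ℝ)⁻¹ * (4 ^ j)⁻¹ * (Real.exp (8 * Real.pi) * √(4 ^ j) ^ d) ≤
      4 * Real.exp (8 * Real.pi) / c := by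
    have h5 : c * √(4 ^ j : ℝ) ^ d ≤ 4 * 4 ^ j * N := by
      calc _ ≤ c * √n ^ d := by gcongr
        _ ≤ n * N := hlow
        _ ≤ _ := by gcongr
    rw [le_div_iff₀ hc, ← mul_inv, inv_mul_eq_div, div_mul_eq_mul_div,
      div_le_iff₀ (by positivity)]
    have := Real.exp_pos (8 * Real.pi)
    nlinarith
  calc ENNReal.ofReal (N : ℝ)⁻¹ * ‖∑ m ∈ discreteSphereFinset d √n, (f (x - m) : ℂ)‖ₑ
      = ENNReal.ofReal ((N : ℝ)⁻¹ * (4 ^ j)⁻¹) *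
        (‖∑ m ∈ discreteSphereFinset d √n, (f (x - m) : ℂ)‖ₑ * ENNReal.ofReal (4 ^ j)) := by
        rw [mul_comm ‖_‖ₑ, ← mul_assoc, ← ENNReal.ofReal_mul (by positivity),
          inv_mul_cancel_right₀ h4.ne']
    _ ≤ ENNReal.ofReal ((N : ℝ)⁻¹ * (4 ^ j)⁻¹) *
        (ENNReal.ofReal (Real.exp (8 * Real.pi) * √(4 ^ j) ^ d) *
          circleMaximal (fun y => (f y : ℂ)) x) := by gcongr
    _ = ENNReal.ofReal ((N : ℝ)⁻¹ * (4 ^ j)⁻¹ * (Real.exp (8 * Real.pi) * √(4 ^ j) ^ d)) *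
          circleMaximal (fun y => (f y : ℂ)) x := by
        rw [← mul_assoc, ← ENNReal.ofReal_mul (by positivity)]
    _ ≤ _ := by
        gcongr
        exact ENNReal.ofReal_le_ofReal hbound

theorem eq_sqrt_of_mem_admissibleRadii {lam : ℝ} (h : lam ∈ admissibleRadii) :
    ∃ k : ℕ, lam = √k := by
  obtain ⟨h0, k, hk⟩ := h
  exact ⟨k, by rw [← hk, Real.sqrt_sq h0]⟩

theorem exists_tsum_sphericalMaximal_sq_le {d : ℕ} (hd : 5 ≤ d) :
    ∃ C : ℝ≥0, ∀ (s : Finset (Fin d → ℤ)) (f : (Fin d → ℤ) → ℝ), (∀ n ∉ s, f n = 0) →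
      ∑' x, sphericalMaximal f x ^ 2 ≤ C * ∑' x, ‖f x‖ₑ ^ 2 := by
  obtain ⟨C₁, h₁⟩ := exists_sphericalAverage_le hd
  obtain ⟨C₂, h₂⟩ := tsum_circleMaximal_sq_le hd
  refine ⟨2 * (1 + C₁ ^ 2 * C₂), fun s f hf => ?_⟩
  set g : (Fin d → ℤ) → ℂ := fun y => (f y : ℂ) with hg
  have hpt : ∀ x, sphericalMaximal f x ≤ ‖f x‖ₑ + C₁ * circleMaximal g x := by
    intro x
    refine iSup₂_le fun lam hlam => ?_
    obtain ⟨k, rfl⟩ := eq_sqrt_of_mem_admissibleRadii hlam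
    rcases Nat.eq_zero_or_pos k with rfl | hk
    · rw [Nat.cast_zero, Real.sqrt_zero, sphericalAverage_zero, ← Real.norm_eq_abs, ofReal_norm]
      exact le_self_add
    · exact (h₁ s f hf k hk x).trans le_add_self
  have hgf : ∀ x, ‖g x‖ₑ = ‖f x‖ₑ := by
    intro x
    rw [← ofReal_norm, ← ofReal_norm, hg, Complex.norm_real]
  have hcirc := h₂ s g fun y hy => by rw [hg]; simp [hf y hy]
  simp_rw [hgf] at hcirc
  calc ∑' x, sphericalMaximal f x ^ 2
      ≤ ∑' x, 2 * (‖f x‖ₑ ^ 2 + C₁ ^ 2 * circleMaximal g x ^ 2) := by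
        refine ENNReal.tsum_le_tsum fun x => ?_
        rw [← mul_pow]
        exact (pow_le_pow_left' (hpt x) 2).trans (ENNReal.add_sq_le_two_mul _ _)
    _ = 2 * (∑' x, ‖f x‖ₑ ^ 2 + C₁ ^ 2 * ∑' x, circleMaximal g x ^ 2) := by
        rw [ENNReal.tsum_mul_left, ENNReal.tsum_add, ENNReal.tsum_mul_left]
    _ ≤ 2 * (∑' x, ‖f x‖ₑ ^ 2 + C₁ ^ 2 * (C₂ * ∑' x, ‖f x‖ₑ ^ 2)) := by gcongr
    _ = _ := by
        push_cast
        ring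

theorem abs_sphericalAverage_le_of_abs_le {d : ℕ} {lam : ℝ} {f g : (Fin d → ℤ) → ℝ}
    {x : Fin d → ℤ} (h : ∀ m ∈ discreteSphereFinset d lam, |f (x - m)| ≤ g (x - m)) :
    |sphericalAverage lam f x| ≤ |sphericalAverage lam g x| := by
  rw [sphericalAverage, sphericalAverage, abs_mul, abs_mul]
  refine mul_le_mul_of_nonneg_left ?_ (abs_nonneg _)
  exact (Finset.abs_sum_le_sum_abs _ _).trans ((Finset.sum_le_sum h).trans (le_abs_self _))

/-- The restriction of `|f|` to the box `[-k, k] ^ d`. -/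
def boxTruncation {d : ℕ} (f : (Fin d → ℤ) → ℝ) (k : ℕ) (x : Fin d → ℤ) : ℝ :=
  if x ∈ Finset.Icc (fun _ : Fin d => -(k : ℤ)) (fun _ => (k : ℤ)) then |f x| else 0

theorem abs_boxTruncation_le {d : ℕ} (f : (Fin d → ℤ) → ℝ) {k l : ℕ} (hkl : k ≤ l)
    (x : Fin d → ℤ) : |boxTruncation f k x| ≤ boxTruncation f l x := by
  rw [boxTruncation, boxTruncation]
  have hkl' : (k : ℤ) ≤ l := by exact_mod_cast hkl
  split_ifs with h1 h2 h2
  · rw [abs_abs]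
  · rw [Finset.mem_Icc] at h1 h2
    exact absurd ⟨fun i => (neg_le_neg hkl').trans (h1.1 i), fun i => (h1.2 i).trans hkl'⟩ h2
  · rw [abs_zero]
    exact abs_nonneg _
  · rw [abs_zero]

theorem monotone_sphericalMaximal_boxTruncation {d : ℕ} (f : (Fin d → ℤ) → ℝ) :
    Monotone fun k => sphericalMaximal (boxTruncation f k) := by
  intro k l hkl x
  refine iSup₂_mono fun lam _ => ENNReal.ofReal_le_ofReal ?_
  exact abs_sphericalAverage_le_of_abs_le fun m _ => abs_boxTruncation_le f hkl _

theorem sphericalMaximal_le_iSup {d : ℕ} (f : (Fin d → ℤ) → ℝ) (x : Fin d → ℤ) :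
    sphericalMaximal f x ≤ ⨆ k, sphericalMaximal (boxTruncation f k) x := by
  refine iSup₂_le fun lam hlam => ?_
  -- A box around the origin large enough to contain every `x - m` with `m` on the sphere, so the
  -- truncation does not affect this average.
  set k := (discreteSphereFinset d lam).sup fun m => ∑ i, ((x - m) i).natAbs with hk
  refine le_iSup_of_le k (le_iSup₂_of_le lam hlam (ENNReal.ofReal_le_ofReal ?_))
  refine abs_sphericalAverage_le_of_abs_le fun m hm => ?_
  have h1 : ∀ i, ((x - m) i).natAbs ≤ k := fun i =>
    (Finset.single_le_sum (f := fun i => ((x - m) i).natAbs) (fun _ _ => Nat.zero_le _)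
      (Finset.mem_univ i)).trans
      (Finset.le_sup (f := fun m => ∑ i, ((x - m) i).natAbs) hm)
  rw [boxTruncation, if_pos]
  rw [Finset.mem_Icc]
  constructor <;> intro i <;> have := h1 i <;> simp only <;> omega

/-- Monotone convergence for the counting measure. Truncating `|f|` instead of `f` is what makes the
maximal functions increase with the box. -/
theorem tsum_sphericalMaximal_sq_le_iSup {d : ℕ} (f : (Fin d → ℤ) → ℝ) :
    ∑' x, sphericalMaximal f x ^ 2 ≤ ⨆ k, ∑' x, sphericalMaximal (boxTruncation f k) x ^ 2 := by
  calc ∑' x, sphericalMaximal f x ^ 2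
      ≤ ∑' x, ⨆ k, sphericalMaximal (boxTruncation f k) x ^ 2 := by
        refine ENNReal.tsum_le_tsum fun x => ?_
        rw [← ENNReal.iSup_pow]
        exact pow_le_pow_left' (sphericalMaximal_le_iSup f x) 2
    _ = ⨆ k, ∑' x, sphericalMaximal (boxTruncation f k) x ^ 2 := by
        simp_rw [← lintegral_count]
        refine lintegral_iSup (fun k => measurable_of_countable _) fun k l hkl x => ?_
        exact pow_le_pow_left' (monotone_sphericalMaximal_boxTruncation f hkl x) 2

theorem eLpNorm_two_count_sq {α ε : Type*} [MeasurableSpace α] [MeasurableSingletonClass α]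
    [ENorm ε] (f : α → ε) : eLpNorm f 2 Measure.count ^ 2 = ∑' x, ‖f x‖ₑ ^ 2 := by
  have h := eLpNorm_nnreal_pow_eq_lintegral (f := f) (μ := Measure.count) (p := 2) two_ne_zero
  rw [lintegral_count] at h
  simpa using h

end

theorem theorem1 (d : ℕ) (hd : 5 ≤ d) :
    ∃ C : ℝ≥0, ∀ f : (Fin d → ℤ) → ℝ,
      eLpNorm (sphericalMaximal f) 2 Measure.count ≤ C * eLpNorm f 2 Measure.count := by
  obtain ⟨C, hC⟩ := exists_tsum_sphericalMaximal_sq_le hd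
  refine ⟨NNReal.sqrt C, fun f => ?_⟩
  rw [← ENNReal.pow_le_pow_left_iff two_ne_zero, mul_pow, ← ENNReal.coe_pow, NNReal.sq_sqrt,
    eLpNorm_two_count_sq, eLpNorm_two_count_sq]
  simp only [enorm_eq_self]
  refine (tsum_sphericalMaximal_sq_le_iSup f).trans (iSup_le fun k => ?_)
  refine (hC _ (boxTruncation f k) fun x hx => if_neg hx).trans ?_
  gcongr with x
  rw [boxTruncation]
  split_ifs
  · rw [← Real.norm_eq_abs, enorm_norm]
  · rw [enorm_zero]
    exact zero_le
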